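/- All logarithms are base 2, and $H(q)=\sum_x q(x)\log(1/q(x))$ is the Shannon entropy. A coupling of probability distributions $p_1,\dots,p_m$ is a joint distribution on the product of their state sets whose $i$-th marginal is $p_i$ for every $i$. The model of computation is the real RAM: a random access machine that performs addition, subtraction and comparison of natural numbers, addition, subtraction, multiplication, division and comparison of real numbers, conversion of natural numbers to reals, and memory accesses with computed addresses, each in one step (there is no rounding of reals and no logarithm). Theorem. There are a real-RAM algorithm and an absolute constant $C$ such that for all $m\ge 2$, all $n$, all $0<\varepsilon<\tfrac12$, and all probability distributions $p_1,\dots,p_m$ with at most $n$ states each, the algorithm, given $m,n,\varepsilon$ and $p_1,\dots,p_m$, halts after at most $$\left(\frac n\varepsilon\right)^{C\cdot m^4\cdot 2^{6m}\cdot\log^3(1/\varepsilon)/\varepsilon^2}$$ steps and outputs a coupling $\mathrm{ALG}$ of $p_1,\dots,p_m$ with $$H(\mathrm{ALG})\le H(\mathrm{OPT})+\varepsilon,$$ where $\mathrm{OPT}$ is a coupling of $p_1,\dots,p_m$ of minimum entropy (which exists). -/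

import Mathlib

noncomputable section

/-! ### Entropy and couplings -/

namespace MinEntropyCoupling

/-- `p` is a probability vector. States of mass zero are allowed, so a probability vector indexed
by `Fin n` is a discrete distribution with at most `n` states. -/
def IsDistribution {ι : Type*} [Fintype ι] (p : ι → ℝ) : Prop :=
  (∀ j, 0 ≤ p j) ∧ ∑ j, p j = 1

/-- Shannon entropy in bits, with the convention `0 * log (1 / 0) = 0`. -/
def entropy {ι : Type*} [Fintype ι] (q : ι → ℝ) : ℝ :=
  ∑ x, q x * Real.logb 2 (1 / q x)

/-- `q` is a coupling of `p 0, …, p (m - 1)`: a joint distribution whose `i`-th marginal is `p i`. -/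
def IsCoupling {m n : ℕ} (p : Fin m → Fin n → ℝ) (q : (Fin m → Fin n) → ℝ) : Prop :=
  IsDistribution q ∧ ∀ (i : Fin m) (j : Fin n), ∑ x with x i = j, q x = p i j

/-- `q` is a coupling of minimum entropy. -/
def IsMinEntropyCoupling {m n : ℕ} (p : Fin m → Fin n → ℝ) (q : (Fin m → Fin n) → ℝ) : Prop :=
  IsCoupling p q ∧ ∀ q', IsCoupling p q' → entropy q ≤ entropy q'

end MinEntropyCoupling

/-! ### The real RAM

A random access machine with unit-cost operations. It has integer memory, on which it can add,
subtract (truncated at zero) and compare, and real memory, on which it can add, subtract, multiply,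
divide and compare exactly. A natural number can be converted to a real number, but not conversely
(there is no rounding operation), and there are no logarithms or roots. Addresses are natural
numbers, computed at run time. The memory is organised in arrays; the array that an operation
accesses is fixed in the program text, so that a program uses only finitely many arrays. -/

namespace RealRAM

/-- Memory contents: cell `i` of the `a`-th integer array is `nat a i`, and cell `i` of the `a`-th
real array is `real a i`. -/
structure Mem where
  nat : ℕ → ℕ → ℕ
  real : ℕ → ℕ → ℝ

/-- Write `v` to cell `i` of the `a`-th integer array. -/
def Mem.setNat (s : Mem) (a i v : ℕ) : Mem :=
  { s with nat := Function.update s.nat a (Function.update (s.nat a) i v) }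

/-- Write `v` to cell `i` of the `a`-th real array. -/
def Mem.setReal (s : Mem) (a i : ℕ) (v : ℝ) : Mem :=
  { s with real := Function.update s.real a (Function.update (s.real a) i v) }

/-- Integer expressions: constants, memory reads, addition, truncated subtraction. -/
inductive NatExpr where
  | const (c : ℕ)
  | load (a : ℕ) (i : NatExpr)
  | add (e f : NatExpr)
  | sub (e f : NatExpr)

/-- The value of an integer expression. -/
def NatExpr.eval (s : Mem) : NatExpr → ℕ
  | .const c => c
  | .load a i => s.nat a (i.eval s)
  | .add e f => e.eval s + f.eval s
  | .sub e f => e.eval s - f.eval s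

/-- The number of operations that are needed to evaluate an integer expression. -/
def NatExpr.cost : NatExpr → ℕ
  | .const _ => 1
  | .load _ i => i.cost + 1
  | .add e f => e.cost + f.cost + 1
  | .sub e f => e.cost + f.cost + 1

/-- Real expressions: conversion of natural numbers, memory reads, and field operations. -/
inductive RealExpr where
  | ofNat (e : NatExpr)
  | load (a : ℕ) (i : NatExpr)
  | add (e f : RealExpr)
  | sub (e f : RealExpr)
  | mul (e f : RealExpr)
  | div (e f : RealExpr)

/-- The value of a real expression; a division by zero returns zero. -/
def RealExpr.eval (s : Mem) : RealExpr → ℝ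
  | .ofNat e => (e.eval s : ℝ)
  | .load a i => s.real a (i.eval s)
  | .add e f => e.eval s + f.eval s
  | .sub e f => e.eval s - f.eval s
  | .mul e f => e.eval s * f.eval s
  | .div e f => e.eval s / f.eval s

/-- The number of operations that are needed to evaluate a real expression. -/
def RealExpr.cost : RealExpr → ℕ
  | .ofNat e => e.cost + 1
  | .load _ i => i.cost + 1
  | .add e f => e.cost + f.cost + 1
  | .sub e f => e.cost + f.cost + 1
  | .mul e f => e.cost + f.cost + 1
  | .div e f => e.cost + f.cost + 1

/-- Tests: comparisons and their Boolean combinations. -/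
inductive Test where
  | natLe (e f : NatExpr)
  | realLe (e f : RealExpr)
  | not (b : Test)
  | and (b c : Test)

/-- Whether a test succeeds. -/
def Test.Holds (s : Mem) : Test → Prop
  | .natLe e f => e.eval s ≤ f.eval s
  | .realLe e f => e.eval s ≤ f.eval s
  | .not b => ¬ b.Holds s
  | .and b c => b.Holds s ∧ c.Holds s

/-- The number of operations that are needed to perform a test. -/
def Test.cost : Test → ℕ
  | .natLe e f => e.cost + f.cost + 1
  | .realLe e f => e.cost + f.cost + 1
  | .not b => b.cost + 1
  | .and b c => b.cost + c.cost + 1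

/-- Programs. A program is a finite text, independent of the input on which it is run. -/
inductive Prog where
  | skip
  /-- write the value of `e` to cell `i` of the `a`-th integer array -/
  | setNat (a : ℕ) (i e : NatExpr)
  /-- write the value of `e` to cell `i` of the `a`-th real array -/
  | setReal (a : ℕ) (i : NatExpr) (e : RealExpr)
  | seq (P Q : Prog)
  /-- if `b` then `P` else `Q` -/
  | ite (b : Test) (P Q : Prog)
  /-- while `b` do `P` -/
  | loop (b : Test) (P : Prog)

/-- `Runs P s t s'`: started in memory `s`, the program `P` halts after exactly `t` steps, in
memory `s'`. -/
inductive Runs : Prog → Mem → ℕ → Mem → Prop where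
  | skip (s : Mem) : Runs .skip s 1 s
  | setNat (a : ℕ) (i e : NatExpr) (s : Mem) :
      Runs (.setNat a i e) s (i.cost + e.cost + 1) (s.setNat a (i.eval s) (e.eval s))
  | setReal (a : ℕ) (i : NatExpr) (e : RealExpr) (s : Mem) :
      Runs (.setReal a i e) s (i.cost + e.cost + 1) (s.setReal a (i.eval s) (e.eval s))
  | seq {P Q : Prog} {s s' s'' : Mem} {t u : ℕ} :
      Runs P s t s' → Runs Q s' u s'' → Runs (.seq P Q) s (t + u) s''
  | iteTrue {b : Test} {P Q : Prog} {s s' : Mem} {t : ℕ} :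
      b.Holds s → Runs P s t s' → Runs (.ite b P Q) s (b.cost + t + 1) s'
  | iteFalse {b : Test} {P Q : Prog} {s s' : Mem} {t : ℕ} :
      ¬ b.Holds s → Runs Q s t s' → Runs (.ite b P Q) s (b.cost + t + 1) s'
  | loopDone {b : Test} {P : Prog} {s : Mem} :
      ¬ b.Holds s → Runs (.loop b P) s (b.cost + 1) s
  | loopStep {b : Test} {P : Prog} {s s' s'' : Mem} {t u : ℕ} :
      b.Holds s → Runs P s t s' → Runs (.loop b P) s' u s'' →
      Runs (.loop b P) s (b.cost + t + u + 1) s''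

/-- Execution is deterministic: running time and final memory are functions of the program and the
initial memory. -/
theorem Runs.deterministic {P : Prog} {s s₁ s₂ : Mem} {t₁ t₂ : ℕ}
    (h₁ : Runs P s t₁ s₁) (h₂ : Runs P s t₂ s₂) : t₁ = t₂ ∧ s₁ = s₂ := by
  induction h₁ generalizing t₂ s₂ with
  | skip s => cases h₂; exact ⟨rfl, rfl⟩
  | setNat a i e s => cases h₂; exact ⟨rfl, rfl⟩
  | setReal a i e s => cases h₂; exact ⟨rfl, rfl⟩
  | seq _ _ ih₁ ih₂ =>
    cases h₂ with
    | seq k₁ k₂ =>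
      obtain ⟨rfl, rfl⟩ := ih₁ k₁
      obtain ⟨rfl, rfl⟩ := ih₂ k₂
      exact ⟨rfl, rfl⟩
  | iteTrue hb _ ih =>
    cases h₂ with
    | iteTrue _ k => obtain ⟨rfl, rfl⟩ := ih k; exact ⟨rfl, rfl⟩
    | iteFalse hb' _ => exact absurd hb hb'
  | iteFalse hb _ ih =>
    cases h₂ with
    | iteTrue hb' _ => exact absurd hb' hb
    | iteFalse _ k => obtain ⟨rfl, rfl⟩ := ih k; exact ⟨rfl, rfl⟩
  | loopDone hb =>
    cases h₂ with
    | loopDone _ => exact ⟨rfl, rfl⟩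
    | loopStep hb' _ _ => exact absurd hb' hb
  | loopStep hb _ _ ih₁ ih₂ =>
    cases h₂ with
    | loopDone hb' => exact absurd hb hb'
    | loopStep _ k₁ k₂ =>
      obtain ⟨rfl, rfl⟩ := ih₁ k₁
      obtain ⟨rfl, rfl⟩ := ih₂ k₂
      exact ⟨rfl, rfl⟩

end RealRAM

/-! ### Input and output of a coupling algorithm -/

namespace MinEntropyCoupling

open RealRAM

/-- The initial memory: `m` and `n` are in cells `0` and `1` of integer array `0`, the accuracy `ε`
is in cell `0` of real array `0`, and the mass `p i j` is in cell `i * n + j` of real array `1`.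
All other cells hold zero. -/
def input (m n : ℕ) (ε : ℝ) (p : Fin m → Fin n → ℝ) : Mem where
  nat a k := if a = 0 then (if k = 0 then m else if k = 1 then n else 0) else 0
  real a k :=
    if a = 0 then (if k = 0 then ε else 0)
    else if a = 1 then
      (if h : k < m * n then
        p (finProdFinEquiv.symm ⟨k, h⟩).1 (finProdFinEquiv.symm ⟨k, h⟩).2 else 0)
    else 0

/-- The joint table that is read off from a final memory: the mass of `x` is in cell
`x 0 + x 1 * n + x 2 * n ^ 2 + ⋯` of real array `2`. -/
def output (m n : ℕ) (s : Mem) : (Fin m → Fin n) → ℝ :=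
  fun x => s.real 2 (∑ i : Fin m, (x i : ℕ) * n ^ (i : ℕ))

end MinEntropyCoupling

end

/-! ### Running loops -/

namespace RealRAM

/-! Masses are measured in units of 1/U. A coupling is regarded as a collection of entries which,
for every marginal separately, have to be packed into bins, namely the states of that marginal. Put
K = 4^g. Every entry is rounded down to one of the sizes x 0 > x 1 > ..., which have the ratio
K/(K+1) (`size`). The excess is at most a 1/K fraction of the mass; it is collected and turned into
additional entries, w = K g levels further down (`Profile.avail`). An entry of size x t costs (t -
w) log(1 + 1/K) bits per unit of mass, so the numbers of entries of the various sizes determine the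
cost, and rounding raises it by at most 8/2^g over the entropy of the coupling (`exists_chain`).

The packings of different marginals interact only through these numbers, and a bin has to decide
only about entries of w consecutive sizes. Since (1 + 1/K)^K ≥ 2, an entry w levels below a bin is
smaller by a factor 2^g. Such entries can be poured one after another into the space that is left,
and cut where a bin is full. A bin is responsible for at most one cut, so at most a 2^(-g) fraction
of the mass is cut in each marginal (`Packing.changes_le`), and a cut costs at most one bit on the
mass of the entry (`sum_negMulLog_cells_le`). Hence a sweep through the levels, from large to small,
has to remember only w demands and one amount of pooled space per marginal, the number of new
entries, and the cost so far. Such sweeps are the chains (`Chain`). A coupling yields a chain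
(`Profile.chain`), and a chain yields packings of the same entries in all marginals
(`Chain.packing`), that is, a partial coupling whose entropy is at most the cost of the chain plus
m/2^g.

The demands are at most 3^σ, where σ = 3g + 3mh and n ≤ 2^h, so a state is coded by `Inp.bits` =
O(4^g g σ m) bits, and a cheapest chain is found by dynamic programming over all codes
(`trace_spec`). The uncovered probability is at most 10 n^m / 2^(σ - g) (`leftover_le`); the product
coupling of the residual marginals makes the result an exact coupling and adds at most 16/2^g to the
entropy (`isCoupling_table`, `entropy_table_le`). The total error (m + 24)/2^g is at most ε because
2^(m+5) ≤ ε 2^g. Conversely 2^g ≤ 2^(m+6)/ε, which bounds the number of codes (`Inp.bits_le`).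

The machine can neither multiply natural numbers nor round. All integer tables are therefore
described by terms with bounded sums, whose values and evaluation times are polynomial in the
contents of the memory (`NTerm.exists_correct`). Floors are obtained by counting successful
comparisons (`mass_eq`). Real arithmetic beyond comparisons is needed only for the residuals and the
final table. -/

theorem Runs.loop_count {b : Test} {P : Prog} {I : ℕ → Mem → Prop} {N B : ℕ}
    (hstep : ∀ j < N, ∀ s, I j s → b.Holds s ∧ ∃ t s', Runs P s t s' ∧ t ≤ B ∧ I (j + 1) s')
    (hdone : ∀ s, I N s → ¬ b.Holds s) {j : ℕ} (hj : j ≤ N) {s : Mem} (hs : I j s) :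
    ∃ t s', Runs (.loop b P) s t s' ∧ t ≤ (N - j) * (B + b.cost + 1) + b.cost + 1 ∧ I N s' := by
  induction h : N - j generalizing j s with
  | zero =>
    obtain rfl : j = N := by omega
    exact ⟨_, s, .loopDone (hdone s hs), by omega, hs⟩
  | succ r ih =>
    obtain ⟨hb, t, s', hrun, ht, hI⟩ := hstep j (by omega) s hs
    obtain ⟨u, s'', hrun', hu, hI'⟩ := ih (j := j + 1) (by omega) hI (by omega)
    refine ⟨_, s'', .loopStep hb hrun hrun', ?_, hI'⟩
    rw [Nat.succ_mul]
    omega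

@[simp] theorem Mem.setNat_nat (s : Mem) (a i v b j : ℕ) :
    (s.setNat a i v).nat b j = if b = a ∧ j = i then v else s.nat b j := by
  by_cases h : b = a
  · subst h
    by_cases h' : j = i <;> simp [Mem.setNat, Function.update, h']
  · simp [Mem.setNat, Function.update, h]

@[simp] theorem Mem.setNat_real (s : Mem) (a i v : ℕ) : (s.setNat a i v).real = s.real := rfl

@[simp] theorem Mem.setReal_nat (s : Mem) (a i : ℕ) (v : ℝ) : (s.setReal a i v).nat = s.nat := rfl

@[simp] theorem Mem.setReal_real (s : Mem) (a i : ℕ) (v : ℝ) (b j : ℕ) :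
    (s.setReal a i v).real b j = if b = a ∧ j = i then v else s.real b j := by
  by_cases h : b = a
  · subst h
    by_cases h' : j = i <;> simp [Mem.setReal, Function.update, h']
  · simp [Mem.setReal, Function.update, h]

/-! ### A language of terms with bounded sums -/

/-- Put a value in front of a sequence of values. -/
def push {α : Type*} (k : α) (e : ℕ → α) : ℕ → α
  | 0 => k
  | i + 1 => e i

@[simp] theorem push_zero {α : Type*} (k : α) (e : ℕ → α) : push k e 0 = k := rfl
@[simp] theorem push_succ {α : Type*} (k : α) (e : ℕ → α) (i : ℕ) : push k e (i + 1) = e i := rfl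

/-- Terms for natural numbers. Integer array `0` is scratch memory; `arr a` refers to integer array
`a + 1`. Variables are de Bruijn indices. -/
inductive NTerm where
  | const (c : ℕ)
  | var (i : ℕ)
  | arr (a : ℕ) (t : NTerm)
  | add (t u : NTerm)
  | sub (t u : NTerm)
  /-- if `t ≤ u` then `v` else `w` -/
  | ite (t u v w : NTerm)
  /-- the sum of `t` over all values less than `b` of the variable `0` -/
  | sum (b t : NTerm)
  /-- `1` if `t ≤ real[a][u] * v`, and `0` otherwise -/
  | rle (t : NTerm) (a : ℕ) (u v : NTerm)

namespace NTerm

open Classical in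
noncomputable def eval (s : Mem) : NTerm → (ℕ → ℕ) → ℕ
  | const c, _ => c
  | var i, e => e i
  | arr a t, e => s.nat (a + 1) (t.eval s e)
  | add t u, e => t.eval s e + u.eval s e
  | sub t u, e => t.eval s e - u.eval s e
  | ite t u v w, e => if t.eval s e ≤ u.eval s e then v.eval s e else w.eval s e
  | sum b t, e => ∑ k ∈ Finset.range (b.eval s e), t.eval s (push k e)
  | rle t a u v, e => if (t.eval s e : ℝ) ≤ s.real a (u.eval s e) * (v.eval s e : ℝ) then 1 else 0

theorem eval_congr {s s' : Mem} (hn : ∀ a, s'.nat (a + 1) = s.nat (a + 1)) (hr : s'.real = s.real)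
    (τ : NTerm) (e : ℕ → ℕ) : τ.eval s' e = τ.eval s e := by
  induction τ generalizing e with
  | const c => rfl
  | var i => rfl
  | arr a t ih => simp [eval, ih, hn]
  | add t u iht ihu => simp [eval, iht, ihu]
  | sub t u iht ihu => simp [eval, iht, ihu]
  | ite t u v w iht ihu ihv ihw => simp [eval, iht, ihu, ihv, ihw]
  | sum b t ihb iht => simp [eval, ihb, iht]
  | rle t a u v iht ihu ihv => simp [eval, iht, ihu, ihv, hr]

theorem pow_aux {Y a b : ℕ} (hY : 2 ≤ Y) (hab : a ≤ b) : Y ^ a ≤ Y ^ b :=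
  Nat.pow_le_pow_right (by omega) hab

/-- The values of a term are polynomially bounded in the contents of the memory. -/
theorem eval_le (τ : NTerm) : ∃ c : ℕ, ∀ (s : Mem) (e : ℕ → ℕ) (Y : ℕ), 2 ≤ Y →
    (∀ a k, s.nat (a + 1) k ≤ Y) → (∀ i, e i ≤ Y) → τ.eval s e ≤ Y ^ c := by
  induction τ with
  | const c =>
    refine ⟨c, fun s e Y hY _ _ => ?_⟩
    exact (Nat.lt_pow_self (by omega : 1 < Y)).le
  | var i => exact ⟨1, fun s e Y _ _ he => by simpa [eval] using he i⟩
  | arr a t _ => exact ⟨1, fun s e Y _ hs _ => by simpa [eval] using hs a _⟩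
  | add t u iht ihu =>
    obtain ⟨c, hc⟩ := iht
    obtain ⟨d, hd⟩ := ihu
    refine ⟨c + d + 1, fun s e Y hY hs he => ?_⟩
    have h1 := (hc s e Y hY hs he).trans (pow_aux hY (by omega : c ≤ c + d))
    have h2 := (hd s e Y hY hs he).trans (pow_aux hY (by omega : d ≤ c + d))
    simp only [eval, pow_succ]
    nlinarith
  | sub t u iht ihu =>
    obtain ⟨c, hc⟩ := iht
    exact ⟨c, fun s e Y hY hs he => (Nat.sub_le _ _).trans (hc s e Y hY hs he)⟩
  | ite t u v w iht ihu ihv ihw =>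
    obtain ⟨c, hc⟩ := ihv
    obtain ⟨d, hd⟩ := ihw
    refine ⟨c + d, fun s e Y hY hs he => ?_⟩
    have h1 := (hc s e Y hY hs he).trans (pow_aux hY (by omega : c ≤ c + d))
    have h2 := (hd s e Y hY hs he).trans (pow_aux hY (by omega : d ≤ c + d))
    simp only [eval]
    split_ifs <;> assumption
  | sum b t ihb iht =>
    obtain ⟨c, hc⟩ := ihb
    obtain ⟨d, hd⟩ := iht
    -- The summation variable is bounded only by Y ^ c, so the bound for the summand is applied with
    -- Y ^ (c + 1) in place of Y.
    refine ⟨c + (c + 1) * d, fun s e Y hY hs he => ?_⟩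
    have h1 := hc s e Y hY hs he
    have hY1 : Y ≤ Y ^ (c + 1) := by
      simpa using pow_aux hY (by omega : 1 ≤ c + 1)
    have h2 : ∀ k ∈ Finset.range (b.eval s e), t.eval s (push k e) ≤ (Y ^ (c + 1)) ^ d := by
      intro k hk
      refine hd s _ _ (hY.trans hY1) (fun a k => (hs a k).trans hY1) ?_
      rintro (_ | i)
      · exact ((Finset.mem_range.1 hk).le.trans h1).trans (pow_aux hY (by omega))
      · exact (he i).trans hY1
    calc (sum b t).eval s e ≤ (Finset.range (b.eval s e)).card • (Y ^ (c + 1)) ^ d :=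
          Finset.sum_le_card_nsmul _ _ _ h2
      _ ≤ Y ^ c * (Y ^ (c + 1)) ^ d := by
          simpa using Nat.mul_le_mul_right _ h1
      _ = Y ^ (c + (c + 1) * d) := by rw [← pow_mul, ← pow_add]
  | rle t a u v _ _ _ =>
    refine ⟨0, fun s e Y hY hs he => ?_⟩
    simp only [eval]
    split_ifs <;> simp

/-- Read a cell of the scratch memory. -/
abbrev reg (r : ℕ) : NatExpr := .load 0 (.const r)

/-- A program that puts the value of a term into scratch cell `r`; the variable `i` is in scratch
cell `loc i`, and only scratch cells from `r` on are changed. -/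
def compile : NTerm → (ℕ → ℕ) → ℕ → Prog
  | const c, _, r => .setNat 0 (.const r) (.const c)
  | var i, loc, r => .setNat 0 (.const r) (reg (loc i))
  | arr a t, loc, r => .seq (t.compile loc r) (.setNat 0 (.const r) (.load (a + 1) (reg r)))
  | add t u, loc, r => .seq (t.compile loc r) (.seq (u.compile loc (r + 1))
      (.setNat 0 (.const r) (.add (reg r) (reg (r + 1)))))
  | sub t u, loc, r => .seq (t.compile loc r) (.seq (u.compile loc (r + 1))
      (.setNat 0 (.const r) (.sub (reg r) (reg (r + 1)))))
  | ite t u v w, loc, r => .seq (t.compile loc r) (.seq (u.compile loc (r + 1))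
      (.ite (.natLe (reg r) (reg (r + 1))) (v.compile loc r) (w.compile loc r)))
  -- Cell r accumulates the sum, r + 1 holds the summation variable, r + 2 the number of summands;
  -- the summand is evaluated from r + 3 on.
  | sum b t, loc, r => .seq (b.compile loc (r + 2)) (.seq (.setNat 0 (.const r) (.const 0))
      (.seq (.setNat 0 (.const (r + 1)) (.const 0))
      (.loop (.natLe (.add (reg (r + 1)) (.const 1)) (reg (r + 2)))
        (.seq (t.compile (push (r + 1) loc) (r + 3))
        (.seq (.setNat 0 (.const r) (.add (reg r) (reg (r + 3))))
        (.setNat 0 (.const (r + 1)) (.add (reg (r + 1)) (.const 1))))))))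
  | rle t a u v, loc, r => .seq (t.compile loc r) (.seq (u.compile loc (r + 1))
      (.seq (v.compile loc (r + 2))
      (.ite (.realLe (.ofNat (reg r)) (.mul (.load a (reg (r + 1))) (.ofNat (reg (r + 2)))))
        (.setNat 0 (.const r) (.const 1)) (.setNat 0 (.const r) (.const 0)))))

end NTerm

/-- Nothing but scratch cells from `r` on has changed. -/
structure Frame (r : ℕ) (s s' : Mem) : Prop where
  nat : ∀ a, s'.nat (a + 1) = s.nat (a + 1)
  real : s'.real = s.real
  scratch : ∀ k < r, s'.nat 0 k = s.nat 0 k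

theorem Frame.refl (r : ℕ) (s : Mem) : Frame r s s := ⟨fun _ => rfl, rfl, fun _ _ => rfl⟩

theorem Frame.trans {r r' : ℕ} {s s' s'' : Mem} (h : Frame r s s') (h' : Frame r' s' s'')
    (hr : r ≤ r') : Frame r s s'' :=
  ⟨fun a => (h'.nat a).trans (h.nat a), h'.real.trans h.real,
    fun k hk => (h'.scratch k (by omega)).trans (h.scratch k hk)⟩

theorem Frame.set {r i : ℕ} (s : Mem) (v : ℕ) (hi : r ≤ i) : Frame r s (s.setNat 0 i v) := by
  refine ⟨fun a => ?_, rfl, fun k hk => ?_⟩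
  · funext k; simp
  · have : k ≠ i := by omega
    simp [this]

/-! ### Correctness and polynomial running time of compiled terms -/

namespace NTerm

/-- The exponent depends on the term alone. Y bounds the arrays and the variables, but not the
scratch array, whose other contents are irrelevant. -/
def Correct (τ : NTerm) (c : ℕ) : Prop :=
  ∀ (loc : ℕ → ℕ) (r : ℕ) (s : Mem) (e : ℕ → ℕ) (Y : ℕ), (∀ i, loc i < r) → 2 ≤ Y →
    (∀ a k, s.nat (a + 1) k ≤ Y) → (∀ i, s.nat 0 (loc i) = e i) → (∀ i, e i ≤ Y) →
    ∃ t s', Runs (τ.compile loc r) s t s' ∧ t ≤ Y ^ c ∧ s'.nat 0 r = τ.eval s e ∧ Frame r s s'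

/-- A later subterm is evaluated after earlier ones have overwritten scratch cells; its value is
still the one in the original memory, since neither the arrays nor the cells of the variables are
affected. -/
theorem Correct.next {τ : NTerm} {c : ℕ} (hc : Correct τ c) {loc : ℕ → ℕ} {r r' : ℕ} {s s' : Mem}
    {e : ℕ → ℕ} {Y : ℕ} (hloc : ∀ i, loc i < r) (hY : 2 ≤ Y)
    (hs : ∀ a k, s.nat (a + 1) k ≤ Y) (hl : ∀ i, s.nat 0 (loc i) = e i) (he : ∀ i, e i ≤ Y)
    (hf : Frame r s s') (hr : r ≤ r') :
    ∃ t s'', Runs (τ.compile loc r') s' t s'' ∧ t ≤ Y ^ c ∧ s''.nat 0 r' = τ.eval s e ∧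
      Frame r' s' s'' := by
  have := hc loc r' s' e Y (fun i => (hloc i).trans_le hr) hY
    (fun a k => by rw [hf.nat]; exact hs a k)
    (fun i => by rw [hf.scratch _ (hloc i)]; exact hl i) he
  rwa [eval_congr hf.nat hf.real] at this

/-- The common beginning of the inductive step for every operation that evaluates two operands. -/
theorem correct_binary {t u : NTerm} {c d : ℕ} (hc : Correct t c) (hd : Correct u d)
    {loc : ℕ → ℕ} {r : ℕ} {s : Mem}
    {e : ℕ → ℕ} {Y : ℕ} (hloc : ∀ i, loc i < r) (hY : 2 ≤ Y)
    (hs : ∀ a k, s.nat (a + 1) k ≤ Y) (hl : ∀ i, s.nat 0 (loc i) = e i) (he : ∀ i, e i ≤ Y) {Q : Prog} {T : ℕ}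
    {Post : Mem → Prop}
    (hQ : ∀ s', Frame r s s' → s'.nat 0 r = t.eval s e → s'.nat 0 (r + 1) = u.eval s e →
      ∃ t' s'', Runs Q s' t' s'' ∧ t' ≤ T ∧ Post s'') :
    ∃ t' s', Runs (.seq (t.compile loc r) (.seq (u.compile loc (r + 1)) Q)) s t' s' ∧
      t' ≤ Y ^ c + Y ^ d + T ∧ Post s' := by
  obtain ⟨t₁, s₁, r₁, ht₁, v₁, f₁⟩ := hc loc r s e Y hloc hY hs hl he
  obtain ⟨t₂, s₂, r₂, ht₂, v₂, f₂⟩ := hd.next hloc hY hs hl he f₁ (Nat.le_succ r)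
  obtain ⟨t₃, s₃, r₃, ht₃, p⟩ := hQ s₂ (f₁.trans f₂ (Nat.le_succ r))
    (by rw [f₂.scratch r (by omega), v₁]) v₂
  exact ⟨_, s₃, .seq r₁ (.seq r₂ r₃), by omega, p⟩

theorem sixteen_le {Y : ℕ} (hY : 2 ≤ Y) : 16 ≤ Y ^ 4 := by
  calc 16 = 2 ^ 4 := by norm_num
    _ ≤ Y ^ 4 := Nat.pow_le_pow_left hY 4

/-- Constant overheads are absorbed into the exponent: 16 ≤ Y ^ 4 because 2 ≤ Y. -/
theorem pow_bound {Y P T : ℕ} (hY : 2 ≤ Y) {a : ℕ} (hP : P = Y ^ a) (hT : T ≤ 16 * P) :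
    T ≤ Y ^ (a + 4) := by
  rw [pow_add, ← hP]
  nlinarith [sixteen_le hY]

theorem one_le_pow' {Y : ℕ} (hY : 2 ≤ Y) (a : ℕ) : 1 ≤ Y ^ a := Nat.one_le_pow _ _ (by omega)

theorem exists_correct (τ : NTerm) : ∃ c, Correct τ c := by
  induction τ with
  | const c =>
    refine ⟨4, fun loc r s e Y _ hY _ _ _ => ⟨_, _, .setNat _ _ _ _, ?_, ?_, Frame.set _ _ le_rfl⟩⟩
    · have := sixteen_le hY
      simp [NatExpr.cost]; omega
    · simp [NatExpr.eval, eval]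
  | var i =>
    refine ⟨4, fun loc r s e Y _ hY _ hl _ => ⟨_, _, .setNat _ _ _ _, ?_, ?_, Frame.set _ _ le_rfl⟩⟩
    · have := sixteen_le hY
      simp [NatExpr.cost]; omega
    · simp [NatExpr.eval, eval, hl]
  | arr a t iht =>
    obtain ⟨c, hc⟩ := iht
    refine ⟨c + 4, fun loc r s e Y hloc hY hs hl he => ?_⟩
    obtain ⟨t₁, s₁, r₁, ht₁, v₁, f₁⟩ := hc loc r s e Y hloc hY hs hl he
    refine ⟨_, _, .seq r₁ (.setNat _ _ _ _), ?_, ?_, f₁.trans (Frame.set _ _ le_rfl) le_rfl⟩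
    · refine pow_bound hY rfl ?_
      have := one_le_pow' hY c
      simp [NatExpr.cost]; omega
    · simp [NatExpr.eval, eval, v₁, f₁.nat]
  | add t u iht ihu =>
    obtain ⟨c, hc⟩ := iht
    obtain ⟨d, hd⟩ := ihu
    refine ⟨c + d + 4, fun loc r s e Y hloc hY hs hl he => ?_⟩
    obtain ⟨t', s', h1, h2, h3⟩ := correct_binary hc hd hloc hY hs hl he (T := 10)
      (Q := .setNat 0 (.const r) (.add (reg r) (reg (r + 1))))
      (Post := fun s' => s'.nat 0 r = t.eval s e + u.eval s e ∧ Frame r s s')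
      (fun s' hf h1 h2 => ⟨_, _, .setNat _ _ _ _, by simp [NatExpr.cost], by
        simp [NatExpr.eval, h1, h2], hf.trans (Frame.set _ _ le_rfl) le_rfl⟩)
    refine ⟨t', s', h1, pow_bound hY rfl ?_, h3.1, h3.2⟩
    have := pow_aux hY (by omega : c ≤ c + d)
    have := pow_aux hY (by omega : d ≤ c + d)
    have := one_le_pow' hY (c + d)
    omega
  | sub t u iht ihu =>
    obtain ⟨c, hc⟩ := iht
    obtain ⟨d, hd⟩ := ihu
    refine ⟨c + d + 4, fun loc r s e Y hloc hY hs hl he => ?_⟩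
    obtain ⟨t', s', h1, h2, h3⟩ := correct_binary hc hd hloc hY hs hl he (T := 10)
      (Q := .setNat 0 (.const r) (.sub (reg r) (reg (r + 1))))
      (Post := fun s' => s'.nat 0 r = t.eval s e - u.eval s e ∧ Frame r s s')
      (fun s' hf h1 h2 => ⟨_, _, .setNat _ _ _ _, by simp [NatExpr.cost], by
        simp [NatExpr.eval, h1, h2], hf.trans (Frame.set _ _ le_rfl) le_rfl⟩)
    refine ⟨t', s', h1, pow_bound hY rfl ?_, h3.1, h3.2⟩
    have := pow_aux hY (by omega : c ≤ c + d)
    have := pow_aux hY (by omega : d ≤ c + d)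
    have := one_le_pow' hY (c + d)
    omega
  | ite t u v w iht ihu ihv ihw =>
    obtain ⟨c, hc⟩ := iht
    obtain ⟨d, hd⟩ := ihu
    obtain ⟨c', hc'⟩ := ihv
    obtain ⟨d', hd'⟩ := ihw
    refine ⟨c + d + (c' + d') + 4, fun loc r s e Y hloc hY hs hl he => ?_⟩
    obtain ⟨t', s', h1, h2, h3⟩ := correct_binary hc hd hloc hY hs hl he
      (T := 10 + Y ^ c' + Y ^ d')
      (Q := .ite (.natLe (reg r) (reg (r + 1))) (v.compile loc r) (w.compile loc r))
      (Post := fun s' => s'.nat 0 r = (if t.eval s e ≤ u.eval s e then v.eval s e else w.eval s e)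
        ∧ Frame r s s')
      (fun s' hf h1 h2 => by
        by_cases h : t.eval s e ≤ u.eval s e
        · obtain ⟨t₁, s₁, r₁, ht₁, v₁, f₁⟩ := hc'.next hloc hY hs hl he hf le_rfl
          refine ⟨_, s₁, .iteTrue ?_ r₁, ?_, ?_, hf.trans f₁ le_rfl⟩
          · simpa [Test.Holds, NatExpr.eval, h1, h2] using h
          · simp [Test.cost, NatExpr.cost]; omega
          · rw [v₁, if_pos h]
        · obtain ⟨t₁, s₁, r₁, ht₁, v₁, f₁⟩ := hd'.next hloc hY hs hl he hf le_rfl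
          refine ⟨_, s₁, .iteFalse ?_ r₁, ?_, ?_, hf.trans f₁ le_rfl⟩
          · simpa [Test.Holds, NatExpr.eval, h1, h2] using h
          · simp [Test.cost, NatExpr.cost]; omega
          · rw [v₁, if_neg h])
    refine ⟨t', s', h1, pow_bound hY rfl ?_, h3.1, h3.2⟩
    have := pow_aux hY (by omega : c ≤ c + d + (c' + d'))
    have := pow_aux hY (by omega : d ≤ c + d + (c' + d'))
    have := pow_aux hY (by omega : c' ≤ c + d + (c' + d'))
    have := pow_aux hY (by omega : d' ≤ c + d + (c' + d'))
    have := one_le_pow' hY (c + d + (c' + d'))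
    omega
  | sum b t ihb iht =>
    obtain ⟨c, hc⟩ := ihb
    obtain ⟨d, hd⟩ := iht
    obtain ⟨c', hc'⟩ := b.eval_le
    -- The bound of the sum takes time Y ^ c; there are at most Y ^ c' rounds of about Y ^ ((c' + 1)
    -- * d) steps; the two summands 4 absorb constant factors.
    refine ⟨c + (c' + (c' + 1) * d) + 4 + 4, fun loc r s e Y hloc hY hs hl he => ?_⟩
    obtain ⟨t₁, s₁, r₁, ht₁, v₁, f₁⟩ := hc.next hloc hY hs hl he (Frame.refl r s)
      (by omega : r ≤ r + 2)
    have hb := hc' s e Y hY hs he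
    set N := b.eval s e with hN
    have hY1 : Y ≤ Y ^ (c' + 1) := by simpa using pow_aux hY (by omega : 1 ≤ c' + 1)
    let I : ℕ → Mem → Prop := fun j s' => Frame r s s' ∧
      s'.nat 0 r = ∑ k ∈ Finset.range j, t.eval s (push k e) ∧ s'.nat 0 (r + 1) = j ∧
      s'.nat 0 (r + 2) = N
    let P : Prog := .seq (t.compile (push (r + 1) loc) (r + 3))
        (.seq (.setNat 0 (.const r) (.add (reg r) (reg (r + 3))))
        (.setNat 0 (.const (r + 1)) (.add (reg (r + 1)) (.const 1))))
    have hloop := Runs.loop_count (b := .natLe (.add (reg (r + 1)) (.const 1)) (reg (r + 2)))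
      (P := P) (I := I) (N := N) (B := (Y ^ (c' + 1)) ^ d + 20) ?_ ?_ (Nat.zero_le N)
      (s := (s₁.setNat 0 r 0).setNat 0 (r + 1) 0) ?_
    · obtain ⟨t₂, s₂, r₂, ht₂, hI₂⟩ := hloop
      refine ⟨_, s₂, .seq r₁ (.seq (.setNat _ _ _ _) (.seq (.setNat _ _ _ _) r₂)), ?_, ?_, hI₂.1⟩
      · rw [pow_add]
        refine (?_ : _ ≤ 16 * (16 * Y ^ (c + (c' + (c' + 1) * d)))).trans ?_
        · have e1 : (Y ^ (c' + 1)) ^ d = Y ^ ((c' + 1) * d) := by rw [← pow_mul]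
          have e2 : Y ^ (c' + (c' + 1) * d) = Y ^ c' * Y ^ ((c' + 1) * d) := pow_add _ _ _
          have h3 := pow_aux hY (by omega : c ≤ c + (c' + (c' + 1) * d))
          have h4 := pow_aux hY (by omega : c' + (c' + 1) * d ≤ c + (c' + (c' + 1) * d))
          have h5 := pow_aux hY (by omega : c' ≤ c + (c' + (c' + 1) * d))
          have h6 := one_le_pow' hY (c + (c' + (c' + 1) * d))
          rw [e1] at ht₂
          simp only [Test.cost, NatExpr.cost, Nat.sub_zero] at ht₂ ⊢
          have h7 : N * (Y ^ ((c' + 1) * d) + 20 + (1 + 1 + 1 + 1 + (1 + 1) + 1) + 1) ≤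
              Y ^ (c' + (c' + 1) * d) + 28 * Y ^ c' := by
            rw [e2]
            calc _ = N * Y ^ ((c' + 1) * d) + 28 * N := by ring
              _ ≤ _ := Nat.add_le_add (Nat.mul_le_mul_right _ hb) (Nat.mul_le_mul_left _ hb)
          omega
        · rw [pow_add]
          have := sixteen_le hY
          calc _ = 16 * Y ^ (c + (c' + (c' + 1) * d)) * 16 := by ring
            _ ≤ Y ^ 4 * Y ^ (c + (c' + (c' + 1) * d)) * Y ^ 4 := by gcongr
            _ = _ := by ring
      · exact hI₂.2.1
    · rintro j hj s' ⟨hf, h1, h2, h3⟩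
      refine ⟨by simp [Test.Holds, NatExpr.eval, h2, h3]; omega, ?_⟩
      -- In the body the summation variable is an additional variable, so the common bound for the
      -- variables rises to Y ^ (c' + 1).
      have hd' := hd (push (r + 1) loc) (r + 3) s' (push j e) (Y ^ (c' + 1))
        (by rintro (_ | i)
            · simp
            · exact (hloc i).trans (by omega)) (hY.trans hY1)
        (fun a k => by rw [hf.nat]; exact (hs a k).trans hY1)
        (by rintro (_ | i)
            · simpa using h2
            · simp only [push_succ]; rw [hf.scratch _ (hloc i)]; exact hl i)
        (by rintro (_ | i)
            · exact (hj.le.trans hb).trans (pow_aux hY (by omega))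
            · exact (he i).trans hY1)
      rw [eval_congr hf.nat hf.real] at hd'
      obtain ⟨t₂, s₂, r₂, ht₂, v₂, f₂⟩ := hd'
      refine ⟨_, _, .seq r₂ (.seq (.setNat _ _ _ _) (.setNat _ _ _ _)), ?_, ?_, ?_, ?_, ?_⟩
      · simp only [NatExpr.cost]; omega
      · exact (hf.trans f₂ (by omega)).trans ((Frame.set _ _ le_rfl).trans
          (Frame.set _ _ (by omega : r ≤ r + 1)) le_rfl) le_rfl
      · simp [NatExpr.eval, v₂, f₂.scratch r (by omega), h1, Finset.sum_range_succ]
      · simp [NatExpr.eval, f₂.scratch (r + 1) (by omega), h2]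
      · simp [NatExpr.eval, f₂.scratch (r + 2) (by omega), h3]
    · rintro s' ⟨hf, h1, h2, h3⟩
      simp [Test.Holds, NatExpr.eval, h2, h3]
    · refine ⟨⟨fun a => ?_, ?_, fun k hk => ?_⟩, ?_, ?_, ?_⟩
      · funext k; simp [f₁.nat]
      · simp [f₁.real]
      · have e1 : k ≠ r := by omega
        have e2 : k ≠ r + 1 := by omega
        simp [e1, e2, f₁.scratch k (by omega)]
      · simp
      · simp
      · simp [v₁]
  | rle t a u v iht ihu ihv =>
    obtain ⟨c, hc⟩ := iht
    obtain ⟨d, hd⟩ := ihu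
    obtain ⟨c', hc'⟩ := ihv
    refine ⟨c + d + c' + 1 + 4, fun loc r s e Y hloc hY hs hl he => ?_⟩
    obtain ⟨t', s', h1, h2, h3⟩ := correct_binary hc hd hloc hY hs hl he
      (T := 10 + 10 + Y ^ c')
      (Q := .seq (v.compile loc (r + 2)) (.ite (.realLe (.ofNat (reg r))
        (.mul (.load a (reg (r + 1))) (.ofNat (reg (r + 2)))))
        (.setNat 0 (.const r) (.const 1)) (.setNat 0 (.const r) (.const 0))))
      (Post := fun s' => s'.nat 0 r = (rle t a u v).eval s e ∧ Frame r s s')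
      (fun s' hf h1 h2 => by
        obtain ⟨t₁, s₁, r₁, ht₁, v₁, f₁⟩ := hc'.next hloc hY hs hl he hf (by omega : r ≤ r + 2)
        by_cases h : (t.eval s e : ℝ) ≤ s.real a (u.eval s e) * (v.eval s e : ℝ)
        · refine ⟨_, _, .seq r₁ (.iteTrue ?_ (.setNat _ _ _ _)), ?_, ?_,
            (hf.trans f₁ (by omega)).trans (Frame.set _ _ le_rfl) le_rfl⟩
          · simpa [Test.Holds, RealExpr.eval, NatExpr.eval, f₁.scratch, h1, h2, v₁, f₁.real,
              hf.real] using h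
          · simp [Test.cost, NatExpr.cost, RealExpr.cost]; omega
          · simp [NatExpr.eval, eval, h]
        · refine ⟨_, _, .seq r₁ (.iteFalse ?_ (.setNat _ _ _ _)), ?_, ?_,
            (hf.trans f₁ (by omega)).trans (Frame.set _ _ le_rfl) le_rfl⟩
          · simpa [Test.Holds, RealExpr.eval, NatExpr.eval, f₁.scratch, h1, h2, v₁, f₁.real,
              hf.real] using h
          · simp [Test.cost, NatExpr.cost, RealExpr.cost]; omega
          · simp only [eval, if_neg h]
            simp [NatExpr.eval])
    refine ⟨t', s', h1, pow_bound hY rfl ?_, h3.1, h3.2⟩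
    have := pow_aux hY (by omega : c ≤ c + d + c')
    have := pow_aux hY (by omega : d ≤ c + d + c')
    have := pow_aux hY (by omega : c' ≤ c + d + c')
    have := one_le_pow' hY (c + d + c')
    have : 2 * Y ^ (c + d + c') ≤ Y ^ (c + d + c' + 1) := by
      rw [pow_succ, mul_comm]; gcongr
    omega

/-- Rename the variables of a term. -/
def rename : NTerm → (ℕ → ℕ) → NTerm
  | const c, _ => const c
  | var i, ρ => var (ρ i)
  | arr a t, ρ => arr a (t.rename ρ)
  | add t u, ρ => add (t.rename ρ) (u.rename ρ)
  | sub t u, ρ => sub (t.rename ρ) (u.rename ρ)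
  | ite t u v w, ρ => ite (t.rename ρ) (u.rename ρ) (v.rename ρ) (w.rename ρ)
  | sum b t, ρ => sum (b.rename ρ) (t.rename (push 0 fun i => ρ i + 1))
  | rle t a u v, ρ => rle (t.rename ρ) a (u.rename ρ) (v.rename ρ)

theorem eval_rename (s : Mem) (τ : NTerm) (ρ e : ℕ → ℕ) :
    (τ.rename ρ).eval s e = τ.eval s fun i => e (ρ i) := by
  induction τ generalizing ρ e with
  | const c => rfl
  | var i => rfl
  | arr a t ih => simp [eval, rename, ih]
  | add t u iht ihu => simp [eval, rename, iht, ihu]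
  | sub t u iht ihu => simp [eval, rename, iht, ihu]
  | ite t u v w iht ihu ihv ihw => simp [eval, rename, iht, ihu, ihv, ihw]
  | sum b t ihb iht =>
    simp only [eval, rename, ihb, iht]
    refine Finset.sum_congr rfl fun k _ => ?_
    congr 1
    funext i
    cases i <;> rfl
  | rle t a u v iht ihu ihv => simp [eval, rename, iht, ihu, ihv]

end NTerm

end RealRAM

/-! ### Filling arrays one after another -/

namespace RealRAM

/-- A family of arrays: integer array `b + 1` is to hold `val b I k` in the cells `k < bnd b I`, for
every input `I`. -/
structure Spec (ι : Type) where
  val : ℕ → ι → ℕ → ℕ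
  bnd : ℕ → ι → ℕ
  init : ι → Mem
  size : ι → ℕ
  two_le_size : ∀ I, 2 ≤ size I

/-- The first `a` arrays have been filled. -/
structure Spec.Holds {ι : Type} (A : Spec ι) (a : ℕ) (I : ι) (s : Mem) : Prop where
  nat : ∀ b < a, ∀ k < A.bnd b I, s.nat (b + 1) k = A.val b I k
  real : s.real = (A.init I).real

/-- The first `a` arrays can be filled in time polynomial in `size`. -/
def Spec.Realizable {ι : Type} (A : Spec ι) (a : ℕ) : Prop :=
  ∃ (P : Prog) (c : ℕ), ∀ I, ∃ t s, Runs P (A.init I) t s ∧ t ≤ A.size I ^ c ∧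
    (∀ b k, s.nat (b + 1) k ≤ A.size I ^ c) ∧ A.Holds a I s

/-- Environments in which a term is evaluated, while array `a` is being filled. The cells less than
`idx` of this array have been filled. -/
class Scope {ι : outParam Type} (A : outParam (Spec ι)) (a : outParam ℕ) (Γ : Type) where
  mem : Γ → Mem
  env : Γ → ℕ → ℕ
  inp : Γ → ι
  idx : Γ → ℕ
  holds : ∀ γ, A.Holds a (inp γ) (mem γ)
  prev : ∀ γ, ∀ j < idx γ, (mem γ).nat (a + 1) j = A.val a (inp γ) j

/-- The scope of the term for the length of the array, which has no variables of its own. -/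
structure Base {ι : Type} (A : Spec ι) (a : ℕ) : Type where
  inp : ι
  mem : Mem
  holds : A.Holds a inp mem

instance {ι : Type} (A : Spec ι) (a : ℕ) : Scope A a (Base A a) where
  mem := Base.mem
  env _ _ := 0
  inp := Base.inp
  idx _ := 0
  holds := Base.holds
  prev _ _ h := absurd h (Nat.not_lt_zero _)

/-- The scope of a cell that depends only on earlier arrays. -/
structure Fill {ι : Type} (A : Spec ι) (a : ℕ) : Type where
  inp : ι
  mem : Mem
  holds : A.Holds a inp mem
  k : ℕ
  lt : k < A.bnd a inp

instance {ι : Type} (A : Spec ι) (a : ℕ) : Scope A a (Fill A a) where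
  mem := Fill.mem
  env γ _ := γ.k
  inp := Fill.inp
  idx _ := 0
  holds := Fill.holds
  prev _ _ h := absurd h (Nat.not_lt_zero _)

/-- The scope of a cell that may also read the preceding cells of its own array. -/
structure FillRec {ι : Type} (A : Spec ι) (a : ℕ) : Type where
  inp : ι
  mem : Mem
  holds : A.Holds a inp mem
  k : ℕ
  lt : k < A.bnd a inp
  prev : ∀ j < k, mem.nat (a + 1) j = A.val a inp j

instance {ι : Type} (A : Spec ι) (a : ℕ) : Scope A a (FillRec A a) where
  mem := FillRec.mem
  env γ _ := γ.k
  inp := FillRec.inp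
  idx := FillRec.k
  holds := FillRec.holds
  prev := FillRec.prev

/-- One more variable, with values less than `b`. -/
structure Push (Γ : Type) (b : Γ → ℕ) : Type where
  base : Γ
  k : ℕ
  lt : k < b base

instance {ι : Type} {A : Spec ι} {a : ℕ} (Γ : Type) [Scope A a Γ] (b : Γ → ℕ) :
    Scope A a (Push Γ b) where
  mem γ := Scope.mem γ.base
  env γ := push γ.k (Scope.env γ.base)
  inp γ := Scope.inp γ.base
  idx γ := Scope.idx γ.base
  holds γ := Scope.holds γ.base
  prev γ := Scope.prev γ.base

/-! ### Closure properties of the functions that terms compute -/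

section Calc

variable {ι : Type} {A : Spec ι} {a : ℕ} {Γ : Type} [Scope A a Γ]

/-- `f` is the value of a term. -/
def Calc (f : Γ → ℕ) : Prop :=
  ∃ τ : NTerm, ∀ γ : Γ, τ.eval (Scope.mem γ) (Scope.env γ) = f γ

open Classical in
/-- The truth value of `p` is the value of a term. -/
def CalcP (p : Γ → Prop) : Prop := Calc fun γ => if p γ then 1 else 0

theorem Calc.congr {f g : Γ → ℕ} (hf : Calc f) (h : ∀ γ, f γ = g γ) : Calc g := by
  obtain ⟨τ, hτ⟩ := hf
  exact ⟨τ, fun γ => (hτ γ).trans (h γ)⟩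

theorem CalcP.congr {p r : Γ → Prop} (hp : CalcP p) (h : ∀ γ, p γ ↔ r γ) : CalcP r := by
  obtain rfl : p = r := funext fun γ => propext (h γ)
  exact hp

theorem Calc.const (c : ℕ) : Calc fun _ : Γ => c := ⟨.const c, fun _ => rfl⟩

theorem Calc.add {f g : Γ → ℕ} (hf : Calc f) (hg : Calc g) : Calc fun γ => f γ + g γ := by
  obtain ⟨τ, hτ⟩ := hf
  obtain ⟨υ, hυ⟩ := hg
  exact ⟨.add τ υ, fun γ => by simp [NTerm.eval, hτ, hυ]⟩

theorem Calc.sub {f g : Γ → ℕ} (hf : Calc f) (hg : Calc g) : Calc fun γ => f γ - g γ := by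
  obtain ⟨τ, hτ⟩ := hf
  obtain ⟨υ, hυ⟩ := hg
  exact ⟨.sub τ υ, fun γ => by simp [NTerm.eval, hτ, hυ]⟩

theorem Calc.weaken {f : Γ → ℕ} (hf : Calc f) (b : Γ → ℕ) :
    Calc fun γ : Push Γ b => f γ.base := by
  obtain ⟨τ, hτ⟩ := hf
  refine ⟨τ.rename Nat.succ, fun γ => ?_⟩
  rw [NTerm.eval_rename]
  exact hτ γ.base

theorem Calc.top (b : Γ → ℕ) : Calc fun γ : Push Γ b => γ.k := ⟨.var 0, fun _ => rfl⟩

theorem Calc.sum {b : Γ → ℕ} (hb : Calc b) {F : Γ → ℕ → ℕ}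
    (hF : Calc fun γ : Push Γ b => F γ.base γ.k) :
    Calc fun γ => ∑ k ∈ Finset.range (b γ), F γ k := by
  obtain ⟨τ, hτ⟩ := hb
  obtain ⟨υ, hυ⟩ := hF
  refine ⟨.sum τ υ, fun γ => ?_⟩
  simp only [NTerm.eval, hτ]
  exact Finset.sum_congr rfl fun k hk => hυ ⟨γ, k, Finset.mem_range.1 hk⟩

/-- A product is a sum of equal summands; this takes time proportional to the first factor, which is
harmless because all values stay polynomial. -/
theorem Calc.mul {f g : Γ → ℕ} (hf : Calc f) (hg : Calc g) : Calc fun γ => f γ * g γ :=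
  (hf.sum (F := fun γ _ => g γ) (hg.weaken f)).congr fun γ => by simp

open Classical in
theorem CalcP.le {f g : Γ → ℕ} (hf : Calc f) (hg : Calc g) : CalcP fun γ => f γ ≤ g γ := by
  obtain ⟨τ, hτ⟩ := hf
  obtain ⟨υ, hυ⟩ := hg
  exact ⟨.ite τ υ (.const 1) (.const 0), fun γ => by simp [NTerm.eval, hτ, hυ]⟩

theorem CalcP.ite {p : Γ → Prop} {f g : Γ → ℕ} (hp : CalcP p) (hf : Calc f) (hg : Calc g)
    [∀ γ, Decidable (p γ)] : Calc fun γ => if p γ then f γ else g γ := by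
  obtain ⟨π, hπ⟩ := hp
  obtain ⟨τ, hτ⟩ := hf
  obtain ⟨υ, hυ⟩ := hg
  refine ⟨.ite (.const 1) π τ υ, fun γ => ?_⟩
  simp only [NTerm.eval, hτ, hυ, hπ]
  by_cases h : p γ <;> simp [h]

theorem CalcP.calc {p : Γ → Prop} (hp : CalcP p) [∀ γ, Decidable (p γ)] :
    Calc fun γ => if p γ then 1 else 0 := hp.ite (.const 1) (.const 0)

theorem CalcP.of_calc {p : Γ → Prop} [∀ γ, Decidable (p γ)]
    (hp : Calc fun γ => if p γ then 1 else 0) : CalcP p :=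
  Calc.congr hp fun γ => by by_cases h : p γ <;> simp [h]

theorem CalcP.not {p : Γ → Prop} (hp : CalcP p) : CalcP fun γ => ¬ p γ := by
  classical
  exact CalcP.of_calc ((hp.ite (.const 0) (.const 1)).congr fun γ => by
    by_cases h : p γ <;> simp [h])

theorem CalcP.and {p r : Γ → Prop} (hp : CalcP p) (hr : CalcP r) : CalcP fun γ => p γ ∧ r γ := by
  classical
  exact CalcP.of_calc ((hp.ite (hr.ite (.const 1) (.const 0)) (.const 0)).congr fun γ => by
    by_cases h : p γ <;> simp [h])

theorem CalcP.imp {p r : Γ → Prop} (hp : CalcP p) (hr : CalcP r) : CalcP fun γ => p γ → r γ :=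
  (hp.and hr.not).not.congr fun γ => by tauto

theorem CalcP.lt {f g : Γ → ℕ} (hf : Calc f) (hg : Calc g) : CalcP fun γ => f γ < g γ :=
  (CalcP.le hg hf).not.congr fun γ => by simp

theorem CalcP.eq {f g : Γ → ℕ} (hf : Calc f) (hg : Calc g) : CalcP fun γ => f γ = g γ :=
  ((CalcP.le hf hg).and (CalcP.le hg hf)).congr fun γ => by omega

theorem CalcP.exists {b : Γ → ℕ} (hb : Calc b) {p : Γ → ℕ → Prop}
    (hp : CalcP fun γ : Push Γ b => p γ.base γ.k) : CalcP fun γ => ∃ k < b γ, p γ k := by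
  classical
  refine (CalcP.le (.const 1) (hb.sum (F := fun γ k => if p γ k then 1 else 0) hp)).congr fun γ => ?_
  rw [Nat.one_le_iff_ne_zero, Ne, Finset.sum_eq_zero_iff]
  push Not
  simp

theorem CalcP.forall {b : Γ → ℕ} (hb : Calc b) {p : Γ → ℕ → Prop}
    (hp : CalcP fun γ : Push Γ b => p γ.base γ.k) : CalcP fun γ => ∀ k < b γ, p γ k :=
  (CalcP.exists hb (p := fun γ k => ¬ p γ k) hp.not).not.congr fun γ => by simp

theorem CalcP.cond {c p r : Γ → Prop} (hc : CalcP c) (hp : CalcP p) (hr : CalcP r)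
    [∀ γ, Decidable (c γ)] : CalcP fun γ => if c γ then p γ else r γ :=
  ((hc.imp hp).and (hc.not.imp hr)).congr fun γ => by split_ifs with h <;> simp [h]

/-- The quotient counts the multiples (k + 1) * b that do not exceed a; the condition on b
reproduces the convention a / 0 = 0. -/
theorem div_eq_sum (a b : ℕ) :
    a / b = ∑ k ∈ Finset.range a, if 1 ≤ b ∧ (k + 1) * b ≤ a then 1 else 0 := by
  rcases Nat.eq_zero_or_pos b with rfl | hb
  · simp
  · rw [Finset.sum_boole]
    have : (Finset.range a).filter (fun k => 1 ≤ b ∧ (k + 1) * b ≤ a) = Finset.range (a / b) := by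
      ext k
      have h1 := Nat.div_le_self a b
      simp only [Finset.mem_filter, Finset.mem_range, ← Nat.le_div_iff_mul_le hb]
      omega
    rw [this]
    simp

theorem Calc.div {f g : Γ → ℕ} (hf : Calc f) (hg : Calc g) : Calc fun γ => f γ / g γ := by
  refine (hf.sum (F := fun γ k => if 1 ≤ g γ ∧ (k + 1) * g γ ≤ f γ then 1 else 0) ?_).congr
    fun γ => (div_eq_sum _ _).symm
  exact CalcP.calc (.and (.le (.const 1) (hg.weaken f))
    (.le (.mul ((Calc.top f).add (.const 1)) (hg.weaken f)) (hf.weaken f)))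

theorem Calc.mod {f g : Γ → ℕ} (hf : Calc f) (hg : Calc g) : Calc fun γ => f γ % g γ :=
  (hf.sub (hg.mul (hf.div hg))).congr fun γ => by
    have := Nat.mod_add_div (f γ) (g γ)
    omega

open Classical in
/-- The least number that satisfies `p`, if there is one that is less than `b`. -/
noncomputable def least (b : ℕ) (p : ℕ → Prop) : ℕ :=
  ∑ k ∈ Finset.range b, if ∀ j < k + 1, ¬ p j then 1 else 0

/-- The sum in `least` counts the numbers that precede the first solution. -/
theorem least_spec {b : ℕ} {p : ℕ → Prop} {k : ℕ} (hk : k < b) (hp : p k) :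
    p (least b p) ∧ least b p ≤ k := by
  classical
  have hex : ∃ k, p k := ⟨k, hp⟩
  have hle : Nat.find hex ≤ k := Nat.find_min' hex hp
  suffices least b p = Nat.find hex by rw [this]; exact ⟨Nat.find_spec hex, hle⟩
  unfold least
  rw [Finset.sum_boole]
  have : (Finset.range b).filter (fun k => ∀ j < k + 1, ¬ p j) = Finset.range (Nat.find hex) := by
    ext i
    simp only [Finset.mem_filter, Finset.mem_range, Nat.lt_find_iff]
    constructor
    · rintro ⟨_, h⟩ j hj
      exact h j (by omega)
    · intro h
      refine ⟨?_, fun j hj => h j (by omega)⟩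
      by_contra hi
      exact h k (by omega) hp
  rw [this]
  simp

theorem least_le (b : ℕ) (p : ℕ → Prop) : least b p ≤ b := by
  classical
  unfold least
  rw [Finset.sum_boole]
  exact_mod_cast (Finset.card_filter_le _ _).trans (by simp)

theorem Calc.least {b : Γ → ℕ} (hb : Calc b) {p : Γ → ℕ → Prop}
    (hp : CalcP fun γ : Push (Push Γ b) (fun γ => γ.k + 1) => p γ.base.base γ.k) :
    Calc fun γ => least (b γ) (p γ) := by
  classical
  refine hb.sum (F := fun γ k => if ∀ j < k + 1, ¬ p γ j then 1 else 0) ?_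
  exact CalcP.calc (CalcP.forall (b := fun γ : Push Γ b => γ.k + 1)
    (p := fun γ j => ¬ p γ.base j) ((Calc.top b).add (.const 1)) hp.not)

/-- Read an array that has been filled. -/
theorem Calc.read (b : ℕ) {f : Γ → ℕ} (hf : Calc f) (hb : b < a)
    (h : ∀ γ, f γ < A.bnd b (Scope.inp γ)) : Calc fun γ => A.val b (Scope.inp γ) (f γ) := by
  obtain ⟨τ, hτ⟩ := hf
  refine ⟨.arr b τ, fun γ => ?_⟩
  simp only [NTerm.eval, hτ]
  exact (Scope.holds γ).nat b hb _ (h γ)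

/-- Compare with an input of real type. -/
theorem CalcP.realLe (r : ℕ) {f g i : Γ → ℕ} (hf : Calc f) (hi : Calc i) (hg : Calc g) :
    CalcP fun γ => (f γ : ℝ) ≤ (A.init (Scope.inp γ)).real r (i γ) * (g γ : ℝ) := by
  obtain ⟨τ, hτ⟩ := hf
  obtain ⟨υ, hυ⟩ := hg
  obtain ⟨κ, hκ⟩ := hi
  refine ⟨.rle τ r κ υ, fun γ => ?_⟩
  simp only [NTerm.eval, hτ, hυ, hκ, (Scope.holds γ).real]

end Calc

theorem Calc.fillIndex {ι : Type} {A : Spec ι} {a : ℕ} : Calc fun γ : Fill A a => γ.k :=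
  ⟨.var 0, fun _ => rfl⟩

theorem Calc.fillRecIndex {ι : Type} {A : Spec ι} {a : ℕ} : Calc fun γ : FillRec A a => γ.k :=
  ⟨.var 0, fun _ => rfl⟩

/-- The program that fills the cells less than `b` of array `a`. -/
def fillProg (a : ℕ) (b τ : NTerm) : Prog :=
  .seq (.setNat 0 (.const 0) (.const 0)) (.seq (b.compile (fun _ => 0) 1)
    (.seq (.setNat 0 (.const 0) (.const 0))
    (.loop (.natLe (.add (NTerm.reg 0) (.const 1)) (NTerm.reg 1))
      (.seq (τ.compile (fun _ => 0) 2)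
      (.seq (.setNat (a + 1) (NTerm.reg 0) (NTerm.reg 2))
      (.setNat 0 (.const 0) (.add (NTerm.reg 0) (.const 1))))))))

/-- A bound on the values v is required beforehand: a cell may depend on earlier cells, and only
with such a bound do the contents stay below Y, so that one time bound serves for all cells. -/
theorem fillProg_spec (b τ : NTerm) : ∃ c, ∀ (a : ℕ) (s : Mem) (v : ℕ → ℕ) (Y : ℕ), 2 ≤ Y →
    (∀ b k, s.nat (b + 1) k ≤ Y) → (∀ k < b.eval s fun _ => 0, v k ≤ Y) →
    (∀ k < b.eval s fun _ => 0, ∀ s' : Mem, (∀ b ≠ a, s'.nat (b + 1) = s.nat (b + 1)) →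
      s'.real = s.real → (∀ j < k, s'.nat (a + 1) j = v j) → τ.eval s' (fun _ => k) = v k) →
    ∃ t s', Runs (fillProg a b τ) s t s' ∧ t ≤ Y ^ c ∧ (∀ b k, s'.nat (b + 1) k ≤ Y) ∧
      (∀ b ≠ a, s'.nat (b + 1) = s.nat (b + 1)) ∧ s'.real = s.real ∧
      (∀ k < b.eval s fun _ => 0, s'.nat (a + 1) k = v k) := by
  obtain ⟨c, hc⟩ := b.exists_correct
  obtain ⟨d, hd⟩ := τ.exists_correct
  obtain ⟨c', hc'⟩ := b.eval_le
  refine ⟨c + (c' + (c' + 1) * d) + 4 + 4, fun a s v Y hY hs hv hτ => ?_⟩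
  have hf₀ : Frame 0 s (s.setNat 0 0 0) := Frame.set _ _ le_rfl
  obtain ⟨t₁, s₁, r₁, ht₁, v₁, f₁⟩ := hc (fun _ => 0) 1 (s.setNat 0 0 0) (fun _ => 0) Y (by simp) hY
    (by simpa using hs) (by simp) (by omega)
  rw [NTerm.eval_congr hf₀.nat hf₀.real] at v₁
  have hb := hc' s (fun _ => 0) Y hY hs (by omega)
  set N := b.eval s fun _ => 0 with hN
  have hY1 : Y ≤ Y ^ (c' + 1) := by simpa using NTerm.pow_aux hY (by omega : 1 ≤ c' + 1)
  let I : ℕ → Mem → Prop := fun j s' => (∀ b ≠ a, s'.nat (b + 1) = s.nat (b + 1)) ∧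
    s'.real = s.real ∧ (∀ b k, s'.nat (b + 1) k ≤ Y) ∧ (∀ k < j, s'.nat (a + 1) k = v k) ∧
    s'.nat 0 0 = j ∧ s'.nat 0 1 = N
  have hloop := Runs.loop_count (b := .natLe (.add (NTerm.reg 0) (.const 1)) (NTerm.reg 1))
    (P := .seq (τ.compile (fun _ => 0) 2)
      (.seq (.setNat (a + 1) (NTerm.reg 0) (NTerm.reg 2))
      (.setNat 0 (.const 0) (.add (NTerm.reg 0) (.const 1)))))
    (I := I) (N := N) (B := (Y ^ (c' + 1)) ^ d + 20) ?_ ?_ (Nat.zero_le N)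
    (s := s₁.setNat 0 0 0) ?_
  · obtain ⟨t₂, s₂, r₂, ht₂, hI₂⟩ := hloop
    refine ⟨_, s₂, .seq (.setNat _ _ _ _) (.seq r₁ (.seq (.setNat _ _ _ _) r₂)), ?_, hI₂.2.2.1,
      hI₂.1, hI₂.2.1, hI₂.2.2.2.1⟩
    rw [pow_add]
    refine (?_ : _ ≤ 16 * (16 * Y ^ (c + (c' + (c' + 1) * d)))).trans ?_
    · have e1 : (Y ^ (c' + 1)) ^ d = Y ^ ((c' + 1) * d) := by rw [← pow_mul]
      have e2 : Y ^ (c' + (c' + 1) * d) = Y ^ c' * Y ^ ((c' + 1) * d) := pow_add _ _ _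
      have h3 := NTerm.pow_aux hY (by omega : c ≤ c + (c' + (c' + 1) * d))
      have h4 := NTerm.pow_aux hY (by omega : c' + (c' + 1) * d ≤ c + (c' + (c' + 1) * d))
      have h5 := NTerm.pow_aux hY (by omega : c' ≤ c + (c' + (c' + 1) * d))
      have h6 := NTerm.one_le_pow' hY (c + (c' + (c' + 1) * d))
      rw [e1] at ht₂
      simp only [Test.cost, NatExpr.cost, Nat.sub_zero] at ht₂ ⊢
      have h7 : N * (Y ^ ((c' + 1) * d) + 20 + (1 + 1 + 1 + 1 + (1 + 1) + 1) + 1) ≤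
          Y ^ (c' + (c' + 1) * d) + 28 * Y ^ c' := by
        rw [e2]
        calc _ = N * Y ^ ((c' + 1) * d) + 28 * N := by ring
          _ ≤ _ := Nat.add_le_add (Nat.mul_le_mul_right _ hb) (Nat.mul_le_mul_left _ hb)
      omega
    · rw [pow_add]
      have := NTerm.sixteen_le hY
      calc _ = 16 * Y ^ (c + (c' + (c' + 1) * d)) * 16 := by ring
        _ ≤ Y ^ 4 * Y ^ (c + (c' + (c' + 1) * d)) * Y ^ 4 := by gcongr
        _ = _ := by ring
  · rintro j hj s' ⟨h1, h2, h3, h4, h5, h6⟩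
    refine ⟨by simp [Test.Holds, NatExpr.eval, h5, h6]; omega, ?_⟩
    obtain ⟨t₂, s₂, r₂, ht₂, v₂, f₂⟩ := hd (fun _ => 0) 2 s' (fun _ => j) (Y ^ (c' + 1)) (by simp)
      (hY.trans hY1) (fun a k => (h3 a k).trans hY1) (fun _ => h5)
      (fun _ => (hj.le.trans hb).trans (NTerm.pow_aux hY (by omega)))
    rw [hτ j hj s' h1 h2 h4] at v₂
    have h0 : s₂.nat 0 0 = j := (f₂.scratch 0 (by omega)).trans h5
    refine ⟨_, _, .seq r₂ (.seq (.setNat _ _ _ _) (.setNat _ _ _ _)), ?_, ?_, ?_, ?_, ?_, ?_, ?_⟩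
    · simp only [NatExpr.cost]; omega
    · intro b hb
      funext k
      simp [hb, f₂.nat, h1 b hb]
    · simp [f₂.real, h2]
    · intro b k
      simp only [NatExpr.eval, Mem.setNat_nat]
      simp only [Nat.add_eq_zero_iff, one_ne_zero, and_false, false_and, if_false]
      split_ifs
      · rw [v₂]; exact hv j hj
      · rw [f₂.nat]; exact h3 b k
    · intro k hk
      simp only [NatExpr.eval, Mem.setNat_nat, h0]
      simp only [Nat.add_eq_zero_iff, one_ne_zero, and_false, false_and, if_false, true_and]
      split_ifs with hkj
      · rw [v₂, hkj]
      · rw [f₂.nat]; exact h4 k (by omega)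
    · simp [NatExpr.eval, h0]
    · simp [NatExpr.eval, f₂.scratch 1 (by omega), h6]
  · rintro s' ⟨h1, h2, h3, h4, h5, h6⟩
    simp [Test.Holds, NatExpr.eval, h5, h6]
  · refine ⟨fun b _ => ?_, ?_, fun b k => ?_, by simp, by simp, by simp [v₁]⟩
    · funext k; simp [f₁.nat]
    · simp [f₁.real]
    · simp [f₁.nat]; exact hs b k

/-! ### Adding one array -/

section Realizable

variable {ι : Type} {A : Spec ι} {a : ℕ}

/-- Fill one more array, in which every cell may depend on the preceding ones. -/
theorem Spec.Realizable.fillRec (h : A.Realizable a) (hb : Calc fun γ : Base A a => A.bnd a γ.inp)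
    (hf : Calc fun γ : FillRec A a => A.val a γ.inp γ.k)
    (hv : ∃ c, ∀ I, ∀ k < A.bnd a I, A.val a I k ≤ A.size I ^ c) : A.Realizable (a + 1) := by
  obtain ⟨P, c, hP⟩ := h
  obtain ⟨β, hβ⟩ := hb
  obtain ⟨τ, hτ⟩ := hf
  obtain ⟨d, hd⟩ := hv
  obtain ⟨c', hc'⟩ := fillProg_spec β τ
  -- The power c + d + 1 of `size` bounds both the old contents (exponent c) and the new values
  -- (exponent d), and is at least 2.
  refine ⟨.seq P (fillProg a β τ), (c + d + 1) * c' + (c + d + 1) + 1, fun I => ?_⟩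
  obtain ⟨t, s, hrun, ht, hs, hh⟩ := hP I
  have h2 := A.two_le_size I
  have hb : β.eval s (fun _ => 0) = A.bnd a I := hβ ⟨I, s, hh⟩
  have hY : 2 ≤ A.size I ^ (c + d + 1) := by
    simpa using h2.trans (NTerm.pow_aux h2 (by omega : 1 ≤ c + d + 1) |>.trans' (by simp))
  obtain ⟨t', s', hrun', ht', hs', hn, hr, hval⟩ := hc' a s (A.val a I) (A.size I ^ (c + d + 1)) hY
    (fun b k => (hs b k).trans (NTerm.pow_aux h2 (by omega)))
    (fun k hk => (hd I k (hb ▸ hk)).trans (NTerm.pow_aux h2 (by omega)))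
    (fun k hk s' hn hr hprev => hτ ⟨I, s', ⟨fun b hb k hk => by
      rw [hn b (by omega)]; exact hh.nat b hb k hk, hr.trans hh.real⟩, k, hb ▸ hk, hprev⟩)
  refine ⟨_, s', .seq hrun hrun', ?_, fun b k => (hs' b k).trans (NTerm.pow_aux h2 ?_), ?_⟩
  · rw [← pow_mul] at ht'
    have e1 := NTerm.pow_aux h2 (by omega : c ≤ (c + d + 1) * c' + (c + d + 1))
    have e2 := NTerm.pow_aux h2 (by omega : (c + d + 1) * c' ≤ (c + d + 1) * c' + (c + d + 1))
    rw [pow_succ _ ((c + d + 1) * c' + (c + d + 1))]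
    nlinarith
  · omega
  · refine ⟨fun b hba k hk => ?_, hr.trans hh.real⟩
    rcases Nat.lt_succ_iff_lt_or_eq.1 hba with h | rfl
    · rw [hn b (by omega)]; exact hh.nat b h k hk
    · exact hval k (hb ▸ hk)

/-- Fill one more array. -/
theorem Spec.Realizable.fill (h : A.Realizable a) (hb : Calc fun γ : Base A a => A.bnd a γ.inp)
    (hf : Calc fun γ : Fill A a => A.val a γ.inp γ.k) : A.Realizable (a + 1) := by
  refine h.fillRec hb ?_ ?_
  · obtain ⟨τ, hτ⟩ := hf
    exact ⟨τ, fun γ => hτ ⟨γ.inp, γ.mem, γ.holds, γ.k, γ.lt⟩⟩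
  -- Without recursion the bound on the values comes for free: first the length of the array, hence
  -- the index, then the value is polynomially bounded.
  · obtain ⟨P, c, hP⟩ := h
    obtain ⟨β, hβ⟩ := hb
    obtain ⟨τ, hτ⟩ := hf
    obtain ⟨d, hd⟩ := β.eval_le
    obtain ⟨d', hd'⟩ := τ.eval_le
    refine ⟨((c + 1) * d + (c + 1)) * d', fun I k hk => ?_⟩
    obtain ⟨t, s, hrun, ht, hs, hh⟩ := hP I
    have h2 := A.two_le_size I
    have hY : 2 ≤ A.size I ^ (c + 1) := by
      simpa using h2.trans (NTerm.pow_aux h2 (by omega : 1 ≤ c + 1) |>.trans' (by simp))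
    have hb : β.eval s (fun _ => 0) = A.bnd a I := hβ ⟨I, s, hh⟩
    have h3 := hd s (fun _ => 0) (A.size I ^ (c + 1)) hY
      (fun b k => (hs b k).trans (NTerm.pow_aux h2 (by omega))) (by omega)
    rw [hb, ← pow_mul] at h3
    have h4 := hd' s (fun _ => k) (A.size I ^ ((c + 1) * d + (c + 1)))
      (hY.trans (NTerm.pow_aux h2 (by omega)))
      (fun b k => (hs b k).trans (NTerm.pow_aux h2 (by omega)))
      (fun _ => (hk.le.trans h3).trans (NTerm.pow_aux h2 (by omega)))
    rw [← pow_mul] at h4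
    exact (hτ ⟨I, s, hh, k, hk⟩).symm.le.trans h4

end Realizable

/-! ### Filling arrays of reals -/

/-- The program that fills the cells less than `b` of real array `a`; the index of the cell is in
scratch cell `0`. -/
def realFillProg (a : ℕ) (b : NatExpr) (E : RealExpr) : Prog :=
  .seq (.setNat 0 (.const 0) (.const 0))
    (.loop (.natLe (.add (NTerm.reg 0) (.const 1)) b)
      (.seq (.setReal a (NTerm.reg 0) E)
      (.setNat 0 (.const 0) (.add (NTerm.reg 0) (.const 1)))))

/-- A cell may refer to preceding cells of the same real array. No bound on the values is needed, as
an expression has a fixed cost. -/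
theorem realFillProg_spec (a b : ℕ) (E : RealExpr) (s : Mem) (v : ℕ → ℝ) (N : ℕ)
    (hN : s.nat (b + 1) 0 = N)
    (hE : ∀ k < N, ∀ s' : Mem, (∀ b, s'.nat (b + 1) = s.nat (b + 1)) →
      (∀ b ≠ a, s'.real b = s.real b) → (∀ j < k, s'.real a j = v j) → s'.nat 0 0 = k →
      E.eval s' = v k) :
    ∃ t s', Runs (realFillProg a (.load (b + 1) (.const 0)) E) s t s' ∧
      t ≤ N * (E.cost + 20) + 20 ∧ (∀ b, s'.nat (b + 1) = s.nat (b + 1)) ∧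
      (∀ b ≠ a, s'.real b = s.real b) ∧ ∀ k < N, s'.real a k = v k := by
  let I : ℕ → Mem → Prop := fun j s' => (∀ b, s'.nat (b + 1) = s.nat (b + 1)) ∧
    (∀ b ≠ a, s'.real b = s.real b) ∧ (∀ k < j, s'.real a k = v k) ∧ s'.nat 0 0 = j
  obtain ⟨t, s', r, ht, hI⟩ := Runs.loop_count
    (b := .natLe (.add (NTerm.reg 0) (.const 1)) (.load (b + 1) (.const 0)))
    (P := .seq (.setReal a (NTerm.reg 0) E)
      (.setNat 0 (.const 0) (.add (NTerm.reg 0) (.const 1))))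
    (I := I) (N := N) (B := E.cost + 10) (by
      rintro j hj s' ⟨h1, h2, h3, h4⟩
      refine ⟨by simp [Test.Holds, NatExpr.eval, h4, h1, hN]; omega, _, _,
        .seq (.setReal _ _ _ _) (.setNat _ _ _ _), ?_, ?_, ?_, ?_, ?_⟩
      · simp only [NatExpr.cost]; omega
      · intro b
        funext k
        simp [h1]
      · intro b hb
        funext k
        simp [hb, h2 b hb]
      · intro k hk
        simp only [NatExpr.eval, Mem.setNat_real, Mem.setReal_real, h4]
        split_ifs with h
        · rw [hE j hj s' h1 h2 h3 h4, h.2]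
        · exact h3 k (by simp at h; omega)
      · simp [NatExpr.eval, h4])
    (by
      rintro s' ⟨h1, h2, h3, h4⟩
      simp [Test.Holds, NatExpr.eval, h4, h1, hN])
    (Nat.zero_le N) (s := s.setNat 0 0 0) (by
      refine ⟨fun b => ?_, fun b _ => rfl, by simp, by simp⟩
      funext k; simp)
  refine ⟨_, s', .seq (.setNat _ _ _ _) r, ?_, hI.1, hI.2.1, hI.2.2.1⟩
  simp only [Test.cost, NatExpr.cost, Nat.sub_zero] at ht ⊢
  have : N * (E.cost + 10 + (1 + 1 + 1 + 1 + (1 + 1) + 1) + 1) ≤ N * (E.cost + 20) :=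
    Nat.mul_le_mul_left _ (by omega)
  omega

end RealRAM

/-! ### Entropy -/

namespace MinEntropyCoupling

open Real Finset

theorem mul_logb_inv (y : ℝ) : y * Real.logb 2 (1 / y) = negMulLog y / log 2 := by
  rw [Real.logb, one_div, Real.log_inv, negMulLog]
  ring

theorem entropy_eq {ι : Type*} [Fintype ι] (q : ι → ℝ) :
    entropy q = (∑ x, negMulLog (q x)) / log 2 := by
  simp only [entropy, mul_logb_inv, Finset.sum_div]

/-- Both log x and log y are at most log (x + y). -/
theorem negMulLog_add_le {x y : ℝ} (hx : 0 ≤ x) (hy : 0 ≤ y) :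
    negMulLog (x + y) ≤ negMulLog x + negMulLog y := by
  rcases hx.eq_or_lt with rfl | hx
  · simp
  rcases hy.eq_or_lt with rfl | hy
  · simp
  have h1 : log x ≤ log (x + y) := log_le_log hx (by linarith)
  have h2 : log y ≤ log (x + y) := log_le_log hy (by linarith)
  simp only [negMulLog]
  nlinarith

theorem negMulLog_sum_le {ι : Type*} (s : Finset ι) (f : ι → ℝ) (hf : ∀ i ∈ s, 0 ≤ f i) :
    negMulLog (∑ i ∈ s, f i) ≤ ∑ i ∈ s, negMulLog (f i) := by
  classical
  induction s using Finset.induction_on with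
  | empty => simp
  | insert a s ha ih =>
    rw [sum_insert ha, sum_insert ha]
    have h1 := negMulLog_add_le (hf a (mem_insert_self a s))
      (sum_nonneg fun i hi => hf i (mem_insert_of_mem hi))
    have h2 := ih fun i hi => hf i (mem_insert_of_mem hi)
    linarith

/-- This is log z ≤ z - 1 at z = 1 / √y. It bounds the entropy of the small uncovered mass. -/
theorem negMulLog_le_sqrt {y : ℝ} (hy : 0 ≤ y) : negMulLog y ≤ 2 * √y := by
  rcases hy.eq_or_lt with rfl | hy
  · simp
  have hs : 0 < √y := sqrt_pos.2 hy
  have h1 : log (√y)⁻¹ ≤ (√y)⁻¹ - 1 := log_le_sub_one_of_pos (by positivity)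
  rw [log_inv] at h1
  have h2 : log y = 2 * log √y := by
    conv_lhs => rw [← sq_sqrt hy.le]
    rw [log_pow]; norm_num
  have h3 : y = √y * √y := (mul_self_sqrt hy.le).symm
  rw [negMulLog, h2]
  have h4 : -y * (2 * log √y) ≤ 2 * y * (√y)⁻¹ - 2 * y := by nlinarith
  have h5 : y * (√y)⁻¹ = √y := by
    nth_rewrite 1 [h3]
    exact mul_inv_cancel_right₀ hs.ne' _
  nlinarith

theorem continuous_entropy {ι : Type*} [Fintype ι] : Continuous (entropy : (ι → ℝ) → ℝ) := by
  have : (entropy : (ι → ℝ) → ℝ) = fun q => (∑ x, negMulLog (q x)) / log 2 := by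
    funext q; exact entropy_eq q
  rw [this]
  fun_prop

/-- The product of distributions, and more generally of mass vectors of the same total mass. -/
theorem sum_prod_filter {m n : ℕ} (r : Fin m → Fin n → ℝ) {c : ℝ} (hr : ∀ i, ∑ j, r i j = c)
    (i : Fin m) (j : Fin n) :
    ∑ x : Fin m → Fin n with x i = j, ∏ k, r k (x k) = r i j * c ^ (m - 1) := by
  classical
  have h1 : ∑ x : Fin m → Fin n with x i = j, ∏ k, r k (x k) =
      ∑ x : Fin m → Fin n, ∏ k, (if k = i then (if x k = j then r k (x k) else 0) else r k (x k)) := by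
    rw [sum_filter]
    refine sum_congr rfl fun x _ => ?_
    by_cases h : x i = j
    · simp only [h, if_true]
      refine prod_congr rfl fun k _ => ?_
      split_ifs with h1 h2 <;> simp_all
    · rw [if_neg h]
      exact (prod_eq_zero (mem_univ i) (by simp [h])).symm
  rw [h1, ← Fintype.prod_sum (fun k l => if k = i then (if l = j then r k l else 0) else r k l)]
  rw [← mul_prod_erase _ _ (mem_univ i)]
  congr 1
  · simp
  · rw [prod_congr rfl (g := fun _ => c) (fun k hk => by simp [(mem_erase.1 hk).1, hr])]
    simp

theorem sum_prod_univ {m n : ℕ} (r : Fin m → Fin n → ℝ) {c : ℝ} (hr : ∀ i, ∑ j, r i j = c) :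
    ∑ x : Fin m → Fin n, ∏ k, r k (x k) = c ^ m := by
  rw [← Fintype.prod_sum]
  simp [hr]

theorem isCoupling_prod {m n : ℕ} {p : Fin m → Fin n → ℝ} (hp : ∀ i, IsDistribution (p i)) :
    IsCoupling p fun x => ∏ i, p i (x i) := by
  refine ⟨⟨fun x => prod_nonneg fun i _ => (hp i).1 _, ?_⟩, fun i j => ?_⟩
  · simpa using sum_prod_univ p fun i => (hp i).2
  · simpa using sum_prod_filter p (fun i => (hp i).2) i j

/-- The couplings form a nonempty compact set, and entropy is continuous. -/
theorem exists_isMinEntropyCoupling {m n : ℕ} {p : Fin m → Fin n → ℝ}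
    (hp : ∀ i, IsDistribution (p i)) : ∃ q, IsMinEntropyCoupling p q := by
  have hsub : {q | IsCoupling p q} ⊆ Set.Icc (0 : (Fin m → Fin n) → ℝ) 1 := fun q hq => by
    refine ⟨hq.1.1, fun x => ?_⟩
    calc q x ≤ ∑ x, q x := single_le_sum (fun x _ => hq.1.1 x) (mem_univ x)
      _ = 1 := hq.1.2
  have hclosed : IsClosed {q | IsCoupling p q} := by
    have : {q | IsCoupling p q} = (⋂ x, {q : (Fin m → Fin n) → ℝ | 0 ≤ q x}) ∩
        {q | ∑ x, q x = 1} ∩ ⋂ i, ⋂ j, {q | ∑ x with x i = j, q x = p i j} := by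
      ext q
      simp [IsCoupling, IsDistribution]
    rw [this]
    refine ((isClosed_iInter fun x => ?_).inter ?_).inter (isClosed_iInter fun i =>
      isClosed_iInter fun j => ?_)
    · exact isClosed_le continuous_const (by fun_prop)
    · exact isClosed_eq (by fun_prop) continuous_const
    · exact isClosed_eq (by fun_prop) continuous_const
  obtain ⟨q, hq, hmin⟩ := (isCompact_Icc.of_isClosed_subset hclosed hsub).exists_isMinOn
    ⟨_, isCoupling_prod hp⟩ continuous_entropy.continuousOn
  exact ⟨q, hq, fun q' hq' => hmin hq'⟩

/-! ### The entropy of a mass vector that is given by cells -/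

theorem sum_range_mul {M : Type*} [AddCommMonoid M] (N x : ℕ) (F : ℕ → M) :
    ∑ o ∈ range (N * x), F o = ∑ e ∈ range N, ∑ r ∈ range x, F (e * x + r) := by
  induction N with
  | zero => simp
  | succ N ih => rw [Nat.succ_mul, sum_range_add, ih, sum_range_succ]

theorem card_image_range_le {X : Type*} [DecidableEq X] (φ : ℕ → X) (x : ℕ) :
    ((range (x + 1)).image φ).card ≤ 1 + ∑ r ∈ range x, if φ (r + 1) ≠ φ r then 1 else 0 := by
  induction x with
  | zero => simp
  | succ x ih =>
    rw [range_add_one, image_insert, sum_range_succ]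
    by_cases h : φ (x + 1) = φ x
    · rw [insert_eq_of_mem (mem_image.2 ⟨x, by simp, h.symm⟩)]
      omega
    · have := card_insert_le (φ (x + 1)) ((range (x + 1)).image φ)
      rw [if_pos h]
      omega

/-- An entry with k changes lies at no more than 1 + k points; by 1 + k ≤ 2 ^ k every change costs
at most one bit. -/
theorem log_one_add_le (k : ℕ) : log (1 + k) ≤ k * log 2 := by
  have h : ((1 : ℝ) + k) ≤ 2 ^ k := by
    have := Nat.lt_two_pow_self (n := k)
    have h2 : k + 1 ≤ 2 ^ k := this
    have h3 : ((k + 1 : ℕ) : ℝ) ≤ ((2 ^ k : ℕ) : ℝ) := by exact_mod_cast h2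
    push_cast at h3
    linarith
  calc log (1 + k) ≤ log (2 ^ k) := log_le_log (by positivity) h
    _ = k * log 2 := by rw [log_pow]

/-- Mass `x` in units of `1 / U`, distributed over the points of `s`. -/
theorem sum_negMulLog_le_card {X : Type*} (s : Finset X) (c : X → ℕ) (U : ℝ) (hU : 0 < U)
    (x : ℕ) (hx : 0 < x) (hs : ∑ y ∈ s, c y = x) :
    ∑ y ∈ s, negMulLog (c y / U) ≤ x / U * (log (U / x) + log s.card) := by
  have hx' : (0 : ℝ) < x := by exact_mod_cast hx
  have hcard : (0 : ℝ) < s.card := by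
    rw [Nat.cast_pos, Finset.card_pos]
    by_contra h
    rw [not_nonempty_iff_eq_empty] at h
    simp [h] at hs
    omega
  have hsum : ∑ y ∈ s, (c y : ℝ) = x := by exact_mod_cast hs
  -- Gibbs' inequality pointwise, against the uniform distribution on s: log z ≤ z - 1 at z = x /
  -- (s.card * c y). The second term on the right sums to zero.
  have key : ∀ y ∈ s, negMulLog (c y / U) ≤
      c y / U * (log (U / x) + log s.card) + (x / s.card - c y) / U := by
    intro y _
    rcases Nat.eq_zero_or_pos (c y) with h | h
    · simp [h]; positivity
    have hc : (0 : ℝ) < c y := by exact_mod_cast h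
    have h1 := log_le_sub_one_of_pos (x := x / (s.card * c y)) (by positivity)
    rw [log_div hx'.ne' (by positivity), log_mul hcard.ne' hc.ne'] at h1
    rw [negMulLog, log_div hc.ne' hU.ne', log_div hU.ne' hx'.ne']
    have h2 : (x / s.card - c y : ℝ) / U = c y / U * (x / (s.card * c y) - 1) := by
      field_simp
    rw [h2]
    have h3 : (0 : ℝ) < c y / U := by positivity
    nlinarith
  calc ∑ y ∈ s, negMulLog (c y / U)
      ≤ ∑ y ∈ s, (c y / U * (log (U / x) + log s.card) + (x / s.card - c y) / U) :=
        sum_le_sum key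
    _ = x / U * (log (U / x) + log s.card) := by
        rw [sum_add_distrib, ← sum_mul, ← sum_div, ← sum_div, sum_sub_distrib, hsum]
        simp only [sum_const, nsmul_eq_mul]
        field_simp
        ring

/-- The entropy of the mass vector in which each of the cells `o` of an entry of size `x` has mass
`1 / U` and is at the point `φ o`. -/
theorem sum_negMulLog_entry_le {X : Type*} [Fintype X] [DecidableEq X] (φ : ℕ → X) (U : ℝ)
    (hU : 0 < U) (x : ℕ) (hx : 0 < x) :
    ∑ y, negMulLog ((∑ r ∈ range x, if φ r = y then 1 else 0 : ℕ) / U) ≤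
      x / U * log (U / x) +
        log 2 * (x / U * (∑ r ∈ range (x - 1), if φ (r + 1) ≠ φ r then 1 else 0 : ℕ)) := by
  obtain ⟨x, rfl⟩ : ∃ x', x = x' + 1 := ⟨x - 1, by omega⟩
  set s := (range (x + 1)).image φ with hs
  have h1 : ∑ y, negMulLog ((∑ r ∈ range (x + 1), if φ r = y then 1 else 0 : ℕ) / U) =
      ∑ y ∈ s, negMulLog ((∑ r ∈ range (x + 1), if φ r = y then 1 else 0 : ℕ) / U) := by
    symm
    refine sum_subset (subset_univ _) fun y _ hy => ?_
    have : (∑ r ∈ range (x + 1), if φ r = y then 1 else 0) = 0 := by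
      refine sum_eq_zero fun r hr => if_neg fun h => hy ?_
      exact mem_image.2 ⟨r, hr, h⟩
    simp [this]
  have h2 := sum_negMulLog_le_card s (fun y => ∑ r ∈ range (x + 1), if φ r = y then 1 else 0) U hU
    (x + 1) hx (by
      rw [sum_comm]
      rw [sum_congr rfl (g := fun _ => 1)]
      · simp
      · intro r hr
        rw [sum_ite_eq, if_pos (mem_image_of_mem φ hr)])
  have h3 : log s.card ≤ (∑ r ∈ range x, if φ (r + 1) ≠ φ r then 1 else 0 : ℕ) * log 2 := by
    refine le_trans (log_le_log ?_ ?_) (log_one_add_le _)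
    · rw [Nat.cast_pos, Finset.card_pos]
      exact ⟨φ 0, mem_image_of_mem φ (by simp)⟩
    · exact_mod_cast card_image_range_le φ x
  rw [h1]
  refine h2.trans ?_
  have h4 : (0 : ℝ) ≤ (x + 1 : ℕ) / U := by positivity
  simp only [Nat.add_sub_cancel]
  nlinarith [mul_le_mul_of_nonneg_left h3 h4]

/-- The number of cells in `x`-blocks that lie at another point than the preceding cell of the
block. -/
def changes {X : Type*} [DecidableEq X] (φ : ℕ → X) (N x : ℕ) : ℕ :=
  ∑ o ∈ range (N * x), if ¬ x ∣ o ∧ φ o ≠ φ (o - 1) then 1 else 0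

theorem changes_eq {X : Type*} [DecidableEq X] (φ : ℕ → X) (N x : ℕ) :
    changes φ N x =
      ∑ e ∈ range N, ∑ r ∈ range (x - 1), if φ (e * x + (r + 1)) ≠ φ (e * x + r) then 1 else 0 := by
  rw [changes, sum_range_mul]
  refine sum_congr rfl fun e _ => ?_
  rcases Nat.eq_zero_or_pos x with rfl | hx
  · simp
  obtain ⟨x, rfl⟩ : ∃ x', x = x' + 1 := ⟨x - 1, by omega⟩
  rw [sum_range_succ', Nat.add_sub_cancel]
  have h0 : (x + 1) ∣ e * (x + 1) + 0 := ⟨e, by ring⟩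
  rw [if_neg fun h => h.1 h0, add_zero]
  refine sum_congr rfl fun r hr => ?_
  have h1 : ¬ (x + 1) ∣ e * (x + 1) + (r + 1) := by
    rw [Nat.dvd_add_right ⟨e, by ring⟩]
    exact fun h => absurd (Nat.le_of_dvd (by omega) h) (by simp at hr; omega)
  rw [← add_assoc] at h1 ⊢
  simp [h1]

/-- By subadditivity the mass of a point may be split into the contributions of the single entries.
An entry at one point contributes exactly x / U * log (U / x), and every change adds at most log 2
times its mass. -/
theorem sum_negMulLog_cells_le {X : Type*} [Fintype X] [DecidableEq X] (s : Finset ℕ)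
    (N x : ℕ → ℕ) (hx : ∀ t ∈ s, 0 < x t) (φ : ℕ → ℕ → X) (U : ℝ) (hU : 0 < U) :
    ∑ y, negMulLog ((∑ t ∈ s, ∑ o ∈ range (N t * x t), if φ t o = y then 1 else 0 : ℕ) / U) ≤
      ∑ t ∈ s, N t * (x t / U * log (U / x t)) +
        log 2 * ∑ t ∈ s, x t / U * (changes (φ t) (N t) (x t) : ℕ) := by
  have h1 : ∀ y, negMulLog
      ((∑ t ∈ s, ∑ o ∈ range (N t * x t), if φ t o = y then 1 else 0 : ℕ) / U) ≤
      ∑ t ∈ s, ∑ e ∈ range (N t), negMulLog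
        ((∑ r ∈ range (x t), if φ t (e * x t + r) = y then 1 else 0 : ℕ) / U) := by
    intro y
    rw [Nat.cast_sum, sum_div]
    refine (negMulLog_sum_le _ _ fun t _ => by positivity).trans (sum_le_sum fun t _ => ?_)
    rw [sum_range_mul, Nat.cast_sum, sum_div]
    exact negMulLog_sum_le _ _ fun t _ => by positivity
  refine (sum_le_sum fun y _ => h1 y).trans ?_
  rw [sum_comm, mul_sum, ← sum_add_distrib]
  refine sum_le_sum fun t ht => ?_
  rw [sum_comm]
  refine (sum_le_sum fun e _ =>
    sum_negMulLog_entry_le (fun r => φ t (e * x t + r)) U hU (x t) (hx t ht)).trans ?_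
  rw [sum_add_distrib, changes_eq]
  simp only [sum_const, card_range, nsmul_eq_mul, Nat.cast_sum, mul_sum]
  exact le_rfl

end MinEntropyCoupling

/-! ### Packing the entries into the states of one marginal -/

namespace MinEntropyCoupling

open Finset

open Classical in
/-- The number of `ℓ < L` with `P ℓ`. -/
noncomputable def countLt (L : ℕ) (P : ℕ → Prop) : ℕ := ∑ ℓ ∈ range L, if P ℓ then 1 else 0

/-- The solutions form an initial segment, whose length is their number; thus `countLt` finds the
first bin that violates a monotone condition. -/
theorem lt_countLt_iff {L : ℕ} {P : ℕ → Prop} (hP : ∀ ℓ ℓ', ℓ ≤ ℓ' → ℓ' < L → P ℓ' → P ℓ) {ℓ : ℕ}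
    (hℓ : ℓ < L) : ℓ < countLt L P ↔ P ℓ := by
  classical
  rw [countLt, sum_boole, Nat.cast_id]
  constructor
  · intro h
    by_contra hn
    have hsub : (range L).filter P ⊆ range ℓ := by
      intro k hk
      rw [mem_filter, mem_range] at hk
      rw [mem_range]
      by_contra hk'
      exact hn (hP ℓ k (by omega) hk.1 hk.2)
    have := card_le_card hsub
    rw [card_range] at this
    exact absurd h (not_lt.2 this)
  · intro h
    have hsub : range (ℓ + 1) ⊆ (range L).filter P := by
      intro k hk
      rw [mem_range] at hk
      rw [mem_filter, mem_range]
      exact ⟨by omega, hP k ℓ (by omega) hℓ h⟩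
    have := card_le_card hsub
    simp at this
    omega

/-- A packing of the entries, of which there are `N t` of size `x t` for `t ∈ s`, into bins of sizes
`A ℓ`, for `ℓ < L`. At time `st t` the entries of size `x t` appear, and all but `rem t (st t)` of
them are packed into the space that the bins before `st t` have left for smaller entries. Bin `ℓ`
packs `rem t ℓ - rem t (ℓ + 1)` entries of size `x t` that have appeared, and leaves `rest ℓ`. -/
structure Packing (G L : ℕ) (s : Finset ℕ) (x N st : ℕ → ℕ) (rem : ℕ → ℕ → ℕ) (rest A : ℕ → ℕ) :
    Prop where
  st_le : ∀ t ∈ s, st t ≤ L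
  anti : ∀ t ∈ s, ∀ ℓ, st t ≤ ℓ → ℓ < L → rem t (ℓ + 1) ≤ rem t ℓ
  last : ∀ t ∈ s, rem t L = 0
  le : ∀ t ∈ s, rem t (st t) ≤ N t
  cap : ∀ ℓ < L, rest ℓ + ∑ t ∈ s, (if st t ≤ ℓ then (rem t ℓ - rem t (ℓ + 1)) * x t else 0) = A ℓ
  pool : ∀ t ∈ s, ∑ t' ∈ s with t' ≤ t, (N t' - rem t' (st t')) * x t' ≤ ∑ ℓ ∈ range (st t), rest ℓ
  big : ∀ t ∈ s, ∀ ℓ < st t, A ℓ ≠ 0 → G * x t ≤ A ℓ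

/-- The bin that contains cell `o` of the entries of size `x t`. -/
noncomputable def bin (L : ℕ) (s : Finset ℕ) (x N st : ℕ → ℕ) (rem : ℕ → ℕ → ℕ) (rest : ℕ → ℕ)
    (t o : ℕ) : ℕ :=
  -- The poured entries lie end to end on a line, ordered by t. The spaces `rest ℓ` lie end to end
  -- on the same line, and a cell belongs to the bin whose space covers its position.
  if o < (N t - rem t (st t)) * x t then
    countLt L fun ℓ => ∑ ℓ' ∈ range (ℓ + 1), rest ℓ' ≤
      (∑ t' ∈ s with t' < t, (N t' - rem t' (st t')) * x t') + o
  -- Bin ℓ takes the cells from (N t - rem t ℓ) * x t to (N t - rem t (ℓ + 1)) * x t. These limits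
  -- are multiples of x t, so these entries are not cut.
  else countLt L fun ℓ => ℓ < st t ∨ (N t - rem t (ℓ + 1)) * x t ≤ o

namespace Packing

variable {G L : ℕ} {s : Finset ℕ} {x N st : ℕ → ℕ} {rem : ℕ → ℕ → ℕ} {rest A : ℕ → ℕ}

theorem anti' (h : Packing G L s x N st rem rest A) {t : ℕ} (ht : t ∈ s) {ℓ ℓ' : ℕ}
    (h1 : st t ≤ ℓ) (h2 : ℓ ≤ ℓ') (h3 : ℓ' ≤ L) : rem t ℓ' ≤ rem t ℓ := by
  induction ℓ', h2 using Nat.le_induction with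
  | base => exact le_rfl
  | succ k hk ih => exact (h.anti t ht k (by omega) (by omega)).trans (ih (by omega))

/-- The bin of a cell of an entry that is packed into the space for smaller entries. -/
theorem bin_pool (h : Packing G L s x N st rem rest A) {t : ℕ} (ht : t ∈ s) {o : ℕ}
    (ho : o < (N t - rem t (st t)) * x t) :
    bin L s x N st rem rest t o < st t ∧
    (∀ ℓ < L, ℓ < bin L s x N st rem rest t o ↔ ∑ ℓ' ∈ range (ℓ + 1), rest ℓ' ≤
      (∑ t' ∈ s with t' < t, (N t' - rem t' (st t')) * x t') + o) := by
  have hmono : ∀ ℓ ℓ', ℓ ≤ ℓ' → ℓ' < L → ∑ k ∈ range (ℓ' + 1), rest k ≤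
      (∑ t' ∈ s with t' < t, (N t' - rem t' (st t')) * x t') + o →
      ∑ k ∈ range (ℓ + 1), rest k ≤
      (∑ t' ∈ s with t' < t, (N t' - rem t' (st t')) * x t') + o := by
    intro ℓ ℓ' hl _ hp
    exact (sum_le_sum_of_subset (range_subset_range.2 (by omega))).trans hp
  have hspec : ∀ ℓ < L, ℓ < bin L s x N st rem rest t o ↔ ∑ ℓ' ∈ range (ℓ + 1), rest ℓ' ≤
      (∑ t' ∈ s with t' < t, (N t' - rem t' (st t')) * x t') + o := by
    intro ℓ hℓ
    rw [bin, if_pos ho]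
    exact lt_countLt_iff hmono hℓ
  refine ⟨?_, hspec⟩
  have hpool := h.pool t ht
  have hsplit : ∑ t' ∈ s with t' ≤ t, (N t' - rem t' (st t')) * x t' =
      (∑ t' ∈ s with t' < t, (N t' - rem t' (st t')) * x t') + (N t - rem t (st t)) * x t := by
    have : s.filter (fun t' => t' ≤ t) = insert t (s.filter fun t' => t' < t) := by
      ext k
      simp only [mem_filter, mem_insert]
      constructor
      · rintro ⟨h1, h2⟩
        rcases h2.eq_or_lt with h3 | h3
        · exact Or.inl h3
        · exact Or.inr ⟨h1, h3⟩
      · rintro (rfl | ⟨h1, h2⟩)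
        · exact ⟨ht, le_rfl⟩
        · exact ⟨h1, h2.le⟩
    rw [this, sum_insert (by simp), add_comm]
  rw [hsplit] at hpool
  have hst := h.st_le t ht
  have hpos : st t ≠ 0 := by
    intro h0
    rw [h0] at hpool ho
    simp at hpool
    rcases hpool.2 with h1 | h1 <;> simp [h1] at ho
  by_contra hlt
  have h1 := (hspec (st t - 1) (by omega)).1 (by omega)
  rw [Nat.sub_add_cancel (by omega)] at h1
  omega

/-- The bin of a cell of an entry that is not packed into the space for smaller entries. -/
theorem bin_direct (h : Packing G L s x N st rem rest A) {t : ℕ} (ht : t ∈ s) {o : ℕ}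
    (ho : ¬ o < (N t - rem t (st t)) * x t) :
    (∀ ℓ < L, ℓ < bin L s x N st rem rest t o ↔ (ℓ < st t ∨ (N t - rem t (ℓ + 1)) * x t ≤ o)) := by
  intro ℓ hℓ
  rw [bin, if_neg ho]
  refine lt_countLt_iff ?_ hℓ
  rintro ℓ ℓ' hl hl' (hp | hp)
  · exact Or.inl (by omega)
  · by_cases hlt : ℓ < st t
    · exact Or.inl hlt
    · refine Or.inr ((Nat.mul_le_mul_right _ ?_).trans hp)
      have := h.anti' ht (by omega : st t ≤ ℓ + 1) (by omega : ℓ + 1 ≤ ℓ' + 1) (by omega)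
      omega

theorem bin_lt (h : Packing G L s x N st rem rest A) {t : ℕ} (ht : t ∈ s) {o : ℕ}
    (ho : o < N t * x t) : bin L s x N st rem rest t o < L := by
  by_cases hp : o < (N t - rem t (st t)) * x t
  · exact (h.bin_pool ht hp).1.trans_le (h.st_le t ht)
  · have hst := h.st_le t ht
    have hne : st t ≠ L := by
      intro h0
      rw [h0, h.last t ht] at hp
      exact hp ho
    by_contra hlt
    rcases (h.bin_direct ht hp (L - 1) (by omega)).1 (by omega) with h1 | h1
    · omega
    · rw [Nat.sub_add_cancel (by omega), h.last t ht, Nat.sub_zero] at h1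
      omega

/-- The part of the first entries in the pool before those of size `x t`. -/
theorem head_add_le (s : Finset ℕ) (f : ℕ → ℕ) {t t' : ℕ} (ht : t ∈ s) (h : t < t') :
    ∑ k ∈ s with k < t, f k + f t ≤ ∑ k ∈ s with k < t', f k := by
  have : insert t (s.filter fun k => k < t) ⊆ s.filter fun k => k < t' := by
    intro k hk
    rw [mem_insert, mem_filter] at hk
    rw [mem_filter]
    rcases hk with rfl | ⟨h1, h2⟩
    · exact ⟨ht, h⟩
    · exact ⟨h1, by omega⟩
  calc _ = ∑ k ∈ insert t (s.filter fun k => k < t), f k := by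
        rw [sum_insert (by simp), add_comm]
    _ ≤ _ := sum_le_sum_of_subset this

/-- A cell of the pool is determined by its position on the line. -/
theorem head_inj {s : Finset ℕ} {f : ℕ → ℕ} {t t' o o' : ℕ} (ht : t ∈ s) (ht' : t' ∈ s)
    (ho : o < f t) (ho' : o' < f t')
    (h : ∑ k ∈ s with k < t, f k + o = ∑ k ∈ s with k < t', f k + o') : t = t' ∧ o = o' := by
  rcases lt_trichotomy t t' with hl | rfl | hl
  · have := head_add_le s f ht hl
    omega
  · exact ⟨rfl, by omega⟩
  · have := head_add_le s f ht' hl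
    omega

/-- No bin is overfull. -/
theorem count_le (h : Packing G L s x N st rem rest A) {ℓ : ℕ} (hℓ : ℓ < L) :
    ∑ t ∈ s, ∑ o ∈ range (N t * x t), (if bin L s x N st rem rest t o = ℓ then 1 else 0) ≤ A ℓ := by
  classical
  set f : ℕ → ℕ := fun t => (N t - rem t (st t)) * x t with hf
  -- The cells of a bin are the poured ones, estimated jointly for all t below, and the directly
  -- packed ones, at most (rem t ℓ - rem t (ℓ + 1)) * x t in number.
  have h1 : ∀ t ∈ s,
      ∑ o ∈ range (N t * x t), (if bin L s x N st rem rest t o = ℓ then 1 else 0) ≤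
      (∑ o ∈ range (f t), if bin L s x N st rem rest t o = ℓ then 1 else 0) +
      (if st t ≤ ℓ then (rem t ℓ - rem t (ℓ + 1)) * x t else 0) := by
    intro t ht
    have hle : f t ≤ N t * x t := Nat.mul_le_mul_right _ (Nat.sub_le _ _)
    rw [← sum_range_add_sum_Ico _ hle]
    refine Nat.add_le_add_left ?_ _
    have hbin : ∀ o, f t ≤ o → bin L s x N st rem rest t o = ℓ → st t ≤ ℓ ∧
        (N t - rem t ℓ) * x t ≤ o ∧ o < (N t - rem t (ℓ + 1)) * x t := by
      intro o ho hb
      have hd := h.bin_direct ht (not_lt.2 ho)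
      rw [hb] at hd
      have h2 := (hd ℓ hℓ).not.1 (lt_irrefl _)
      push Not at h2
      refine ⟨h2.1, ?_, h2.2⟩
      rcases h2.1.eq_or_lt with h3 | h3
      · rw [← h3]; exact ho
      · rcases (hd (ℓ - 1) (by omega)).1 (by omega) with h4 | h4
        · omega
        · rwa [Nat.sub_add_cancel (by omega)] at h4
    rw [sum_boole, Nat.cast_id]
    split_ifs with hst
    · have hsub : (Ico (f t) (N t * x t)).filter (fun o => bin L s x N st rem rest t o = ℓ) ⊆
          Ico ((N t - rem t ℓ) * x t) ((N t - rem t (ℓ + 1)) * x t) := by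
        intro o ho
        rw [mem_filter, mem_Ico] at ho
        exact mem_Ico.2 (hbin o ho.1.1 ho.2).2
      refine (card_le_card hsub).trans ?_
      rw [Nat.card_Ico, ← Nat.sub_mul]
      refine Nat.mul_le_mul_right _ ?_
      omega
    · rw [Nat.le_zero, card_eq_zero, filter_eq_empty_iff]
      intro o ho hb
      rw [mem_Ico] at ho
      exact hst (hbin o ho.1 hb).1
  refine (sum_le_sum h1).trans ?_
  rw [sum_add_distrib, ← h.cap ℓ hℓ]
  refine Nat.add_le_add_right ?_ _
  have h2 : ∑ t ∈ s, ∑ o ∈ range (f t), (if bin L s x N st rem rest t o = ℓ then 1 else 0) =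
      ((s.sigma fun t => range (f t)).filter
        fun z => bin L s x N st rem rest z.1 z.2 = ℓ).card := by
    rw [card_filter, sum_sigma]
  rw [h2]
  have h3 : rest ℓ = (Ico (∑ k ∈ range ℓ, rest k) (∑ k ∈ range (ℓ + 1), rest k)).card := by
    rw [Nat.card_Ico, sum_range_succ]
    omega
  rw [h3]
  -- The position on the line maps the poured cells of bin ℓ injectively into an interval of length
  -- `rest ℓ`.
  refine card_le_card_of_injOn (fun z => (∑ k ∈ s with k < z.1, f k) + z.2) ?_ ?_
  · rintro ⟨t, o⟩ hz
    simp only [coe_filter, mem_sigma, mem_range, Set.mem_ofPred_eq] at hz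
    obtain ⟨⟨ht, ho⟩, hb⟩ := hz
    have hp := (h.bin_pool ht ho).2
    rw [hb] at hp
    rw [coe_Ico, Set.mem_Ico]
    constructor
    · rcases Nat.eq_zero_or_pos ℓ with rfl | h0
      · simp
      · have := (hp (ℓ - 1) (by omega)).1 (by omega)
        rwa [Nat.sub_add_cancel (by omega)] at this
    · exact not_le.1 ((hp ℓ hℓ).not.1 (lt_irrefl _))
  · rintro ⟨t, o⟩ hz ⟨t', o'⟩ hz' heq
    simp only [coe_filter, mem_sigma, mem_range, Set.mem_ofPred_eq] at hz hz'
    obtain ⟨rfl, rfl⟩ := head_inj hz.1.1 hz'.1.1 hz.1.2 hz'.1.2 heq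
    rfl

/-- Few entries are distributed over several bins. -/
theorem changes_le (h : Packing G L s x N st rem rest A) :
    G * ∑ t ∈ s, x t * changes (bin L s x N st rem rest t) (N t) (x t) ≤ ∑ ℓ ∈ range L, A ℓ := by
  classical
  set f : ℕ → ℕ := fun t => (N t - rem t (st t)) * x t with hf
  -- Directly packed entries contribute no change, since the limits between bins are multiples of x
  -- t.
  have h1 : ∀ t ∈ s, changes (bin L s x N st rem rest t) (N t) (x t) ≤
      ∑ o ∈ range (f t), if ¬ x t ∣ o ∧ bin L s x N st rem rest t o ≠
        bin L s x N st rem rest t (o - 1) then 1 else 0 := by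
    intro t ht
    have hle : f t ≤ N t * x t := Nat.mul_le_mul_right _ (Nat.sub_le _ _)
    rw [changes, ← sum_range_add_sum_Ico _ hle]
    refine (Nat.add_le_add_left (Nat.le_of_eq (sum_eq_zero ?_)) _).trans (Nat.add_zero _).le
    intro o ho
    rw [mem_Ico] at ho
    rw [if_neg]
    rintro ⟨hd, hne⟩
    have ho1 : f t ≤ o - 1 := by
      have : f t ≠ o := fun h0 => hd (h0 ▸ Dvd.intro_left _ rfl)
      omega
    apply hne
    rw [bin, bin, if_neg (not_lt.2 ho.1), if_neg (not_lt.2 ho1)]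
    congr 1
    funext ℓ
    have : (N t - rem t (ℓ + 1)) * x t ≠ o := fun h0 => hd (h0 ▸ Dvd.intro_left _ rfl)
    refine propext (or_congr_right ?_)
    omega
  set Z := (s.sigma fun t => range (f t)).filter fun z => ¬ x z.1 ∣ z.2 ∧
    bin L s x N st rem rest z.1 z.2 ≠ bin L s x N st rem rest z.1 (z.2 - 1) with hZ
  have h2 : ∑ t ∈ s, x t * changes (bin L s x N st rem rest t) (N t) (x t) ≤
      ∑ z ∈ Z, x z.1 := by
    rw [hZ, sum_filter, sum_sigma]
    refine sum_le_sum fun t ht => (Nat.mul_le_mul_left _ (h1 t ht)).trans ?_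
    rw [mul_sum]
    refine sum_le_sum fun o _ => ?_
    simp only
    split_ifs <;> simp
  have hmem : ∀ z ∈ Z, z.1 ∈ s ∧ z.2 < f z.1 ∧ 0 < z.2 ∧
      bin L s x N st rem rest z.1 z.2 ≠ bin L s x N st rem rest z.1 (z.2 - 1) := by
    intro z hz
    rw [hZ, mem_filter, mem_sigma, mem_range] at hz
    refine ⟨hz.1.1, hz.1.2, Nat.pos_of_ne_zero fun h0 => hz.2.1 (by simp [h0]), hz.2.2⟩
  -- Bins increase along the line, and a cell of Z lies in a later bin than its predecessor. So
  -- among two cells of Z the later one is in a strictly later bin: a bin is responsible for at most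
  -- one cut.
  have hcmp : ∀ z ∈ Z, ∀ z' ∈ Z, (∑ k ∈ s with k < z.1, f k) + z.2 <
      (∑ k ∈ s with k < z'.1, f k) + z'.2 →
      bin L s x N st rem rest z.1 z.2 < bin L s x N st rem rest z'.1 z'.2 := by
    intro z hz z' hz' hlt
    simp only [hf] at hlt
    obtain ⟨a1, a2, a3, a4⟩ := hmem z hz
    obtain ⟨b1, b2, b3, b4⟩ := hmem z' hz'
    obtain ⟨p1, p2⟩ := h.bin_pool a1 a2
    obtain ⟨q1, q2⟩ := h.bin_pool b1 b2
    obtain ⟨r1, r2⟩ := h.bin_pool b1 (show z'.2 - 1 < f z'.1 by omega)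
    have e1 := h.st_le _ a1
    have e2 := h.st_le _ b1
    have hle : bin L s x N st rem rest z.1 z.2 ≤ bin L s x N st rem rest z'.1 (z'.2 - 1) := by
      by_contra hc
      push Not at hc
      have := (p2 _ (by omega)).1 hc
      exact lt_irrefl _ ((r2 _ (by omega)).2 (this.trans (by omega)))
    have hle' : bin L s x N st rem rest z'.1 (z'.2 - 1) ≤ bin L s x N st rem rest z'.1 z'.2 := by
      by_contra hc
      push Not at hc
      have := (r2 _ (by omega)).1 hc
      exact lt_irrefl _ ((q2 _ (by omega)).2 (this.trans (by omega)))
    omega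
  have hinj : Set.InjOn (fun z : (_ : ℕ) × ℕ => bin L s x N st rem rest z.1 z.2) Z := by
    rintro ⟨t, o⟩ hz ⟨t', o'⟩ hz' heq
    simp only at heq
    rcases lt_trichotomy ((∑ k ∈ s with k < t, f k) + o) ((∑ k ∈ s with k < t', f k) + o')
      with hl | he | hl
    · exact absurd heq (hcmp _ hz _ hz' hl).ne
    · obtain ⟨rfl, rfl⟩ := head_inj (hmem _ hz).1 (hmem _ hz').1 (hmem _ hz).2.1 (hmem _ hz').2.1 he
      rfl
    · exact absurd heq (hcmp _ hz' _ hz hl).ne'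
  calc G * ∑ t ∈ s, x t * changes (bin L s x N st rem rest t) (N t) (x t)
      ≤ G * ∑ z ∈ Z, x z.1 := Nat.mul_le_mul_left _ h2
    _ = ∑ z ∈ Z, G * x z.1 := mul_sum _ _ _
    _ ≤ ∑ z ∈ Z, A (bin L s x N st rem rest z.1 z.2) := by
        refine sum_le_sum fun z hz => ?_
        obtain ⟨a1, a2, a3, a4⟩ := hmem z hz
        obtain ⟨p1, p2⟩ := h.bin_pool a1 a2
        -- A bin of size zero has no space left for smaller entries, hence contains no poured cell.
        refine h.big _ a1 _ p1 fun h0 => ?_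
        have e1 := h.st_le _ a1
        have hcap := h.cap _ (p1.trans_le e1)
        rw [h0] at hcap
        have hrest : rest (bin L s x N st rem rest z.1 z.2) = 0 := by omega
        have h3 := (p2 _ (p1.trans_le e1)).not.1 (lt_irrefl _)
        rw [sum_range_succ, hrest, add_zero] at h3
        rcases Nat.eq_zero_or_pos (bin L s x N st rem rest z.1 z.2) with h4 | h4
        · rw [h4] at h3; simp at h3
        · have h5 := (p2 (bin L s x N st rem rest z.1 z.2 - 1) (by omega)).1 (by omega)
          rw [Nat.sub_add_cancel (by omega)] at h5
          exact h3 h5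
    _ = ∑ ℓ ∈ Z.image fun z => bin L s x N st rem rest z.1 z.2, A ℓ := (sum_image hinj).symm
    _ ≤ ∑ ℓ ∈ range L, A ℓ := by
        refine sum_le_sum_of_subset fun ℓ hℓ => ?_
        obtain ⟨z, hz, rfl⟩ := mem_image.1 hℓ
        obtain ⟨a1, a2, a3, a4⟩ := hmem z hz
        exact mem_range.2 ((h.bin_pool a1 a2).1.trans_le (h.st_le _ a1))

/-- The sizes of the entries and of the bins. -/
theorem total (h : Packing G L s x N st rem rest A) :
    ∑ t ∈ s, N t * x t + ∑ ℓ ∈ range L, rest ℓ =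
      ∑ ℓ ∈ range L, A ℓ + ∑ t ∈ s, (N t - rem t (st t)) * x t := by
  have h1 : ∑ ℓ ∈ range L, A ℓ = ∑ ℓ ∈ range L, rest ℓ +
      ∑ t ∈ s, ∑ ℓ ∈ range L, (if st t ≤ ℓ then (rem t ℓ - rem t (ℓ + 1)) * x t else 0) := by
    rw [sum_comm, ← sum_add_distrib]
    exact sum_congr rfl fun ℓ hℓ => (h.cap ℓ (mem_range.1 hℓ)).symm
  have h2 : ∀ t ∈ s, ∑ ℓ ∈ range L, (if st t ≤ ℓ then (rem t ℓ - rem t (ℓ + 1)) * x t else 0) =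
      rem t (st t) * x t := by
    intro t ht
    have key : ∀ k, st t ≤ k → k ≤ L → ∑ ℓ ∈ range k,
        (if st t ≤ ℓ then (rem t ℓ - rem t (ℓ + 1)) * x t else 0) + rem t k * x t =
        rem t (st t) * x t := by
      intro k hk
      induction k, hk using Nat.le_induction with
      | base =>
        intro _
        rw [sum_eq_zero fun ℓ hℓ => if_neg (by simp at hℓ; omega), zero_add]
      | succ k hk ih =>
        intro hk'
        rw [sum_range_succ, if_pos hk, ← ih (by omega), add_assoc, ← Nat.add_mul,
          Nat.sub_add_cancel (h.anti t ht k hk (by omega))]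
    have := key L (h.st_le t ht) le_rfl
    rw [h.last t ht] at this
    simpa using this
  rw [h1, sum_congr rfl h2]
  have h3 : ∑ t ∈ s, N t * x t =
      ∑ t ∈ s, rem t (st t) * x t + ∑ t ∈ s, (N t - rem t (st t)) * x t := by
    rw [← sum_add_distrib]
    refine sum_congr rfl fun t ht => ?_
    rw [← Nat.add_mul, Nat.add_sub_cancel' (h.le t ht)]
  omega

end Packing

end MinEntropyCoupling

/-! ### Chains of states -/

namespace MinEntropyCoupling

open Finset

/-- The transition at clock `s` and bin `b`. A state `δ` consists of the demands `δ (i * w + c)`,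
the number of entries of size `x (s + c)` that have not been packed in marginal `i`, the space
`δ (m * w + i)` for small entries in marginal `i`, the number `δ (m * w + m)` of entries of the size
that appeared last, and the cost `δ (m * w + m + 1)`. For `b = m * n`, entries of size `x (s + w)`
appear. -/
def Step (m n w : ℕ) (x a : ℕ → ℕ) (s b : ℕ) (δ δ' : ℕ → ℕ) : Prop :=
  if b < m * n then
    -- Bin b = i * n + j is opened at exactly one clock, that of its level. At s = 0 truncated
    -- subtraction makes the condition void.
    if x s ≤ a b ∧ a b < x (s - 1) then
      (∀ d < m * w + m + 2, (¬ d / w = b / n ∧ ¬ d = m * w + b / n) → δ' d = δ d) ∧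
      (∀ c < w, δ' (b / n * w + c) ≤ δ (b / n * w + c)) ∧
      δ (m * w + b / n) ≤ δ' (m * w + b / n) ∧
      δ' (m * w + b / n) + ∑ c ∈ range w, (δ (b / n * w + c) - δ' (b / n * w + c)) * x (s + c) =
        δ (m * w + b / n) + a b
    else ∀ d < m * w + m + 2, δ' d = δ d
  else
    δ' (m * w + m + 1) = δ (m * w + m + 1) + δ' (m * w + m) * (x (s + w) * s) ∧
    -- Entries of size x s must be packed before the window moves on; what is not demanded of the
    -- new entries is poured into the pool.
    ∀ i < m, δ (i * w) = 0 ∧ (∀ c < w - 1, δ' (i * w + c) = δ (i * w + c + 1)) ∧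
      δ' (i * w + (w - 1)) ≤ δ' (m * w + m) ∧
      δ' (m * w + i) + (δ' (m * w + m) - δ' (i * w + (w - 1))) * x (s + w) = δ (m * w + i)

/-- Each clock consists of m * n transitions at bins and a last one at which new entries appear,
whence the factor m * n + 1. At the end no demand may be open, but pooled space may be left over. -/
structure Chain (m n w S : ℕ) (x a : ℕ → ℕ) (δ : ℕ → ℕ → ℕ) : Prop where
  zero : ∀ d < m * w + m + 2, δ 0 d = 0
  step : ∀ ℓ < S * (m * n + 1), Step m n w x a (ℓ / (m * n + 1)) (ℓ % (m * n + 1)) (δ ℓ) (δ (ℓ + 1))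
  final : ∀ d < m * w, δ (S * (m * n + 1)) d = 0

section

variable (m n w S : ℕ) (x a : ℕ → ℕ) (δ : ℕ → ℕ → ℕ)

/-- The time at which the entries of size `x t` have appeared. -/
def startTime (t : ℕ) : ℕ := (t - w + 1) * (m * n + 1)

/-- The number of entries of size `x t`. -/
def entryCount (t : ℕ) : ℕ := δ (startTime m n w t) (m * w + m)

/-- The number of entries of size `x t` that remain to be packed in marginal `i`. -/
def remaining (i t ℓ : ℕ) : ℕ :=
  if ℓ / (m * n + 1) ≤ t then δ ℓ (i * w + (t - ℓ / (m * n + 1))) else 0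

/-- The pool grows only at bins; the decrease when entries appear is not counted here. -/
def restSpace (i ℓ : ℕ) : ℕ :=
  if ℓ % (m * n + 1) < m * n then δ (ℓ + 1) (m * w + i) - δ ℓ (m * w + i) else 0

/-- Every time counts as a bin of marginal i; it has size zero unless a state of marginal i is
opened at that time, so that each state occurs at most once. -/
def binSize (i ℓ : ℕ) : ℕ :=
  if ℓ % (m * n + 1) < m * n ∧ ℓ % (m * n + 1) / n = i ∧
    x (ℓ / (m * n + 1)) ≤ a (ℓ % (m * n + 1)) ∧ a (ℓ % (m * n + 1)) < x (ℓ / (m * n + 1) - 1)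
  then a (ℓ % (m * n + 1)) else 0

end

theorem layer_div {s b q : ℕ} (hb : b < q) : (s * q + b) / q = s := by
  rw [mul_comm, Nat.mul_add_div (by omega), Nat.div_eq_of_lt hb, add_zero]

theorem layer_mod {s b q : ℕ} (hb : b < q) : (s * q + b) % q = b := by
  rw [mul_comm, Nat.mul_add_mod, Nat.mod_eq_of_lt hb]

theorem idx_div {i c w : ℕ} (hc : c < w) : (i * w + c) / w = i := layer_div hc

theorem idx_lt {i c w m : ℕ} (hi : i < m) (hc : c < w) : i * w + c < m * w := by
  calc i * w + c < i * w + w := by omega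
    _ = (i + 1) * w := by ring
    _ ≤ m * w := Nat.mul_le_mul_right _ hi

namespace Chain

variable {m n w S : ℕ} {x a : ℕ → ℕ} {δ : ℕ → ℕ → ℕ}

theorem bin_step (h : Chain m n w S x a δ) {s b : ℕ} (hs : s < S) (hb : b < m * n) :
    Step m n w x a s b (δ (s * (m * n + 1) + b)) (δ (s * (m * n + 1) + b + 1)) := by
  have := h.step (s * (m * n + 1) + b) (by
    calc _ < s * (m * n + 1) + (m * n + 1) := by omega
      _ = (s + 1) * (m * n + 1) := by ring
      _ ≤ _ := Nat.mul_le_mul_right _ hs)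
  rwa [layer_div (by omega), layer_mod (by omega)] at this

theorem intro_step (h : Chain m n w S x a δ) {s : ℕ} (hs : s < S) :
    Step m n w x a s (m * n) (δ (s * (m * n + 1) + m * n)) (δ ((s + 1) * (m * n + 1))) := by
  have := h.step (s * (m * n + 1) + m * n) (by
    calc _ < s * (m * n + 1) + (m * n + 1) := by omega
      _ = (s + 1) * (m * n + 1) := by ring
      _ ≤ _ := Nat.mul_le_mul_right _ hs)
  rw [layer_div (by omega), layer_mod (by omega)] at this
  rwa [Nat.succ_mul]

/-- What a transition at a bin does to the demands and the space of marginal `i`. -/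
theorem bin_cases (h : Chain m n w S x a δ) {s b : ℕ} (hs : s < S) (hb : b < m * n) {i : ℕ}
    (hi : i < m) (hw : 0 < w) :
    (b / n = i ∧ x s ≤ a b ∧ a b < x (s - 1) ∧
      (∀ c < w, δ (s * (m * n + 1) + b + 1) (i * w + c) ≤ δ (s * (m * n + 1) + b) (i * w + c)) ∧
      δ (s * (m * n + 1) + b) (m * w + i) ≤ δ (s * (m * n + 1) + b + 1) (m * w + i) ∧
      δ (s * (m * n + 1) + b + 1) (m * w + i) + ∑ c ∈ range w, (δ (s * (m * n + 1) + b) (i * w + c) -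
        δ (s * (m * n + 1) + b + 1) (i * w + c)) * x (s + c) =
        δ (s * (m * n + 1) + b) (m * w + i) + a b) ∨
    (¬ (b / n = i ∧ x s ≤ a b ∧ a b < x (s - 1)) ∧
      (∀ c < w, δ (s * (m * n + 1) + b + 1) (i * w + c) = δ (s * (m * n + 1) + b) (i * w + c)) ∧
      δ (s * (m * n + 1) + b + 1) (m * w + i) = δ (s * (m * n + 1) + b) (m * w + i)) := by
  have hstep := h.bin_step hs hb
  rw [Step, if_pos hb] at hstep
  have hbn : b / n < m := Nat.div_lt_of_lt_mul (by rwa [mul_comm])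
  have hRw : ∀ k, m ≤ (m * w + k) / w := fun k =>
    (Nat.le_div_iff_mul_le hw).2 (Nat.le_add_right _ _)
  split_ifs at hstep with hact
  · obtain ⟨h1, h2, h3, h4⟩ := hstep
    by_cases hbi : b / n = i
    · left
      subst hbi
      exact ⟨rfl, hact.1, hact.2, h2, h3, h4⟩
    · right
      refine ⟨fun hh => hbi hh.1, fun c hc => h1 _ ?_ ⟨?_, ?_⟩, h1 _ (by omega) ⟨?_, by omega⟩⟩
      · have := idx_lt hi hc
        omega
      · rw [idx_div hc]; exact fun hh => hbi hh.symm
      · exact ((idx_lt hi hc).trans_le (Nat.le_add_right _ _)).ne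
      · exact (hbn.trans_le (hRw i)).ne'
  · right
    refine ⟨fun hh => hact hh.2, fun c hc => hstep _ ?_, hstep _ (by omega)⟩
    have := idx_lt hi hc
    omega

theorem exists_layer {q S ℓ : ℕ} (hℓ : ℓ < S * (q + 1)) :
    ∃ s b, ℓ = s * (q + 1) + b ∧ s < S ∧ b < q + 1 :=
  ⟨ℓ / (q + 1), ℓ % (q + 1), (Nat.div_add_mod' _ _).symm,
    Nat.div_lt_of_lt_mul (by rwa [mul_comm]), Nat.mod_lt _ (by omega)⟩

/-- No entries with index less than w ever appear: the first to appear has index w. -/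
theorem early_zero (h : Chain m n w S x a δ) {i : ℕ} (hi : i < m) (hw : 0 < w) {s b : ℕ}
    (hs : s < S) (hb : b < m * n + 1) :
    ∀ c < w, s + c < w → δ (s * (m * n + 1) + b) (i * w + c) = 0 := by
  induction s generalizing b with
  | zero =>
    induction b with
    | zero =>
      intro c hc _
      rw [Nat.zero_mul, Nat.zero_add]
      refine h.zero _ ?_
      have := idx_lt hi hc
      omega
    | succ b ih =>
      intro c hc hcw
      have := ih (by omega) c hc hcw
      rcases h.bin_cases (s := 0) (b := b) hs (by omega) hi hw with hh | hh
      · have := hh.2.2.2.1 c hc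
        rw [← add_assoc]
        omega
      · have := hh.2.1 c hc
        rw [← add_assoc]
        omega
  | succ s ihs =>
    induction b with
    | zero =>
      intro c hc hcw
      have hstep := h.intro_step (by omega : s < S)
      rw [Step, if_neg (lt_irrefl _)] at hstep
      rw [add_zero, (hstep.2 i hi).2.1 c (by omega)]
      exact ihs (by omega) (by omega) (c + 1) (by omega) (by omega)
    | succ b ih =>
      intro c hc hcw
      have := ih (by omega) c hc hcw
      rcases h.bin_cases (s := s + 1) (b := b) hs (by omega) hi hw with hh | hh
      · have := hh.2.2.2.1 c hc
        rw [← add_assoc]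
        omega
      · have := hh.2.1 c hc
        rw [← add_assoc]
        omega

theorem remaining_eq (i t : ℕ) {s b : ℕ} (hb : b < m * n + 1) :
    remaining m n w δ i t (s * (m * n + 1) + b) =
      if s ≤ t then δ (s * (m * n + 1) + b) (i * w + (t - s)) else 0 := by
  rw [remaining, layer_div hb]

/-- Moving the window renumbers the demands but loses none, since the one that drops out is zero. -/
theorem remaining_intro (h : Chain m n w S x a δ) {i : ℕ} (hi : i < m) {t s : ℕ}
    (hs : s < S) (hts : t < s + w) :
    remaining m n w δ i t (s * (m * n + 1) + m * n + 1) =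
      remaining m n w δ i t (s * (m * n + 1) + m * n) := by
  have e : s * (m * n + 1) + m * n + 1 = (s + 1) * (m * n + 1) + 0 := by ring
  rw [e, remaining_eq i t (by omega), remaining_eq i t (by omega)]
  have hstep := h.intro_step hs
  rw [Step, if_neg (lt_irrefl _)] at hstep
  obtain ⟨h1, h2, -⟩ := hstep.2 i hi
  rw [add_zero]
  rcases lt_trichotomy s t with hl | rfl | hl
  · rw [if_pos (by omega), if_pos hl.le, h2 _ (by omega)]
    congr 1
    omega
  · rw [if_neg (by omega), if_pos le_rfl, Nat.sub_self, add_zero, h1]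
  · rw [if_neg (by omega), if_neg (by omega)]

theorem lt_of_start_le {t s b : ℕ} (hb : b < m * n + 1)
    (h : startTime m n w t ≤ s * (m * n + 1) + b) : t < s + w := by
  by_contra hc
  have : (s + 1) * (m * n + 1) ≤ startTime m n w t := Nat.mul_le_mul_right _ (by omega)
  rw [Nat.succ_mul] at this
  omega

theorem start_le_of_lt {t s b : ℕ} (ht : w ≤ t) (h : t < s + w) :
    startTime m n w t ≤ s * (m * n + 1) + b :=
  (Nat.mul_le_mul_right _ (by omega)).trans (Nat.le_add_right _ _)

theorem remaining_bin (h : Chain m n w S x a δ) {i : ℕ} (hi : i < m) (hw : 0 < w) {t s b : ℕ}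
    (hs : s < S) (hb : b < m * n) (hts : t < s + w) :
    remaining m n w δ i t (s * (m * n + 1) + b + 1) ≤ remaining m n w δ i t (s * (m * n + 1) + b) ∧
    (¬ (b / n = i ∧ x s ≤ a b ∧ a b < x (s - 1)) →
      remaining m n w δ i t (s * (m * n + 1) + b + 1) =
        remaining m n w δ i t (s * (m * n + 1) + b)) := by
  rw [add_assoc, remaining_eq i t (by omega), remaining_eq i t (by omega), ← add_assoc]
  split_ifs with hle
  · rcases h.bin_cases hs hb hi hw with hh | hh
    · exact ⟨hh.2.2.2.1 _ (by omega), fun hn => absurd ⟨hh.1, hh.2.1, hh.2.2.1⟩ hn⟩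
    · exact ⟨(hh.2.1 _ (by omega)).le, fun _ => hh.2.1 _ (by omega)⟩
  · simp

/-- Conservation of pooled space: bins add `restSpace`, and the appearance of entries removes what
is poured. As the first summand is nonnegative, everything poured fits into earlier space. -/
theorem pool_eq (h : Chain m n w S x a δ) {i : ℕ} (hi : i < m) (hw : 0 < w) {ℓ : ℕ}
    (hℓ : ℓ ≤ S * (m * n + 1)) :
    δ ℓ (m * w + i) + ∑ t ∈ Ico w (w + S) with startTime m n w t ≤ ℓ,
      (entryCount m n w δ t - remaining m n w δ i t (startTime m n w t)) * x t =
      ∑ ℓ' ∈ range ℓ, restSpace m n w δ i ℓ' := by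
  induction ℓ with
  | zero =>
    rw [h.zero _ (by omega), sum_range_zero, zero_add, sum_eq_zero]
    intro t ht
    rw [mem_filter] at ht
    have : 0 < startTime m n w t := Nat.mul_pos (by omega) (by omega)
    omega
  | succ ℓ ih =>
    have ih := ih (by omega)
    obtain ⟨s, b, rfl, hs, hb⟩ := exists_layer (Nat.lt_of_succ_le hℓ)
    rw [sum_range_succ, ← ih, restSpace, layer_mod hb]
    rcases (Nat.lt_succ_iff_lt_or_eq.1 hb) with hb' | rfl
    · rw [if_pos hb']
      have hset : (Ico w (w + S)).filter (fun t => startTime m n w t ≤ s * (m * n + 1) + b + 1) =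
          (Ico w (w + S)).filter fun t => startTime m n w t ≤ s * (m * n + 1) + b := by
        refine filter_congr fun t ht => ⟨fun hh => ?_, fun hh => by omega⟩
        rw [mem_Ico] at ht
        refine start_le_of_lt ht.1 (lt_of_start_le (b := b + 1) (by omega) hh)
      rw [hset]
      have hle : δ (s * (m * n + 1) + b) (m * w + i) ≤ δ (s * (m * n + 1) + b + 1) (m * w + i) := by
        rcases h.bin_cases hs hb' hi hw with hh | hh
        · exact hh.2.2.2.2.1
        · exact hh.2.2.ge
      omega
    · rw [if_neg (lt_irrefl _), add_zero]
      have e : s * (m * n + 1) + m * n + 1 = (s + 1) * (m * n + 1) := by ring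
      have hst : startTime m n w (s + w) = (s + 1) * (m * n + 1) := by
        rw [startTime, Nat.add_sub_cancel]
      have hset : (Ico w (w + S)).filter (fun t => startTime m n w t ≤
            s * (m * n + 1) + m * n + 1) =
          insert (s + w) ((Ico w (w + S)).filter fun t => startTime m n w t ≤
            s * (m * n + 1) + m * n) := by
        ext t
        simp only [mem_filter, mem_insert, mem_Ico]
        constructor
        · rintro ⟨⟨h1, h2⟩, h3⟩
          rw [e] at h3
          have h4 := lt_of_start_le (s := s + 1) (b := 0) (by omega) h3
          rcases (by omega : t = s + w ∨ t < s + w) with h5 | h5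
          · exact Or.inl h5
          · exact Or.inr ⟨⟨h1, h2⟩, start_le_of_lt h1 h5⟩
        · rintro (rfl | ⟨h1, h2⟩)
          · exact ⟨⟨by omega, by omega⟩, by rw [hst, e]⟩
          · exact ⟨h1, by omega⟩
      rw [hset, sum_insert]
      · have hstep := h.intro_step hs
        rw [Step, if_neg (lt_irrefl _)] at hstep
        obtain ⟨-, -, -, h4⟩ := hstep.2 i hi
        have e2 : remaining m n w δ i (s + w) ((s + 1) * (m * n + 1)) =
            δ ((s + 1) * (m * n + 1)) (i * w + (w - 1)) := by
          have := remaining_eq (m := m) (n := n) (w := w) (δ := δ) i (s + w) (s := s + 1) (b := 0)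
            (by omega)
          rw [add_zero, if_pos (by omega)] at this
          rw [this]
          congr 2
          omega
        rw [entryCount, hst, e, e2]
        omega
      · rw [mem_filter, hst, ← e]
        omega

/-- Bins before `startTime` of t were opened at a clock no later than t - w, hence have size at
least x (t - w); so a gap of w levels makes poured entries small compared with their bins. -/
theorem packing (h : Chain m n w S x a δ) {i : ℕ} (hi : i < m) (hw : 0 < w) {G : ℕ}
    (hanti : Antitone x) (hG : ∀ t ∈ Ico w (w + S), G * x t ≤ x (t - w)) :
    Packing G (S * (m * n + 1)) (Ico w (w + S)) x (entryCount m n w δ) (startTime m n w)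
      (remaining m n w δ i) (restSpace m n w δ i) (binSize m n x a i) where
  st_le t ht := by
    rw [mem_Ico] at ht
    exact Nat.mul_le_mul_right _ (by omega)
  anti t ht ℓ h1 h2 := by
    obtain ⟨s, b, rfl, hs, hb⟩ := exists_layer h2
    have hts := lt_of_start_le hb h1
    rcases (Nat.lt_succ_iff_lt_or_eq.1 hb) with hb' | rfl
    · exact (h.remaining_bin hi hw hs hb' hts).1
    · exact (h.remaining_intro hi hs hts).le
  last t ht := by
    rw [mem_Ico] at ht
    have := remaining_eq (m := m) (n := n) (w := w) (δ := δ) i t (s := S) (b := 0) (by omega)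
    rw [add_zero] at this
    rw [this]
    split_ifs with hle
    · exact h.final _ (idx_lt hi (by omega))
    · rfl
  le t ht := by
    rw [mem_Ico] at ht
    have hstep := h.intro_step (by omega : t - w < S)
    rw [Step, if_neg (lt_irrefl _)] at hstep
    have := remaining_eq (m := m) (n := n) (w := w) (δ := δ) i t (s := t - w + 1) (b := 0)
      (by omega)
    rw [add_zero, if_pos (by omega)] at this
    rw [entryCount, startTime, this]
    convert (hstep.2 i hi).2.2.1 using 3
    omega
  cap ℓ hℓ := by
    obtain ⟨s, b, rfl, hs, hb⟩ := exists_layer hℓ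
    rw [restSpace, binSize, layer_mod hb, layer_div hb]
    rcases (Nat.lt_succ_iff_lt_or_eq.1 hb) with hb' | rfl
    · rw [if_pos hb']
      rcases h.bin_cases hs hb' hi hw with ⟨e1, e2, e3, e4, e5, e6⟩ | ⟨e1, e2, e3⟩
      · rw [if_pos ⟨hb', e1, e2, e3⟩]
        have hsum : ∑ t ∈ Ico w (w + S), (if startTime m n w t ≤ s * (m * n + 1) + b then
            (remaining m n w δ i t (s * (m * n + 1) + b) -
              remaining m n w δ i t (s * (m * n + 1) + b + 1)) * x t else 0) =
            ∑ c ∈ range w, (δ (s * (m * n + 1) + b) (i * w + c) -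
              δ (s * (m * n + 1) + b + 1) (i * w + c)) * x (s + c) := by
          have hshift : ∑ c ∈ range w, (δ (s * (m * n + 1) + b) (i * w + c) -
              δ (s * (m * n + 1) + b + 1) (i * w + c)) * x (s + c) =
              ∑ t ∈ Ico (0 + s) (w + s), (δ (s * (m * n + 1) + b) (i * w + (t - s)) -
              δ (s * (m * n + 1) + b + 1) (i * w + (t - s))) * x t := by
            rw [← sum_Ico_add' (fun t => (δ (s * (m * n + 1) + b) (i * w + (t - s)) -
              δ (s * (m * n + 1) + b + 1) (i * w + (t - s))) * x t) 0 w s, range_eq_Ico]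
            refine sum_congr rfl fun c _ => ?_
            rw [Nat.add_sub_cancel, add_comm c s]
          rw [hshift]
          · rw [← sum_filter]
            have hsub : (Ico w (w + S)).filter (fun t => startTime m n w t ≤ s * (m * n + 1) + b)
                ⊆ Ico w (w + s) := by
              intro t ht
              rw [mem_filter, mem_Ico] at ht
              have := lt_of_start_le hb ht.2
              rw [mem_Ico]; omega
            have heq : (Ico w (w + S)).filter (fun t => startTime m n w t ≤ s * (m * n + 1) + b)
                = Ico w (w + s) := by
              refine hsub.antisymm fun t ht => ?_
              rw [mem_Ico] at ht
              rw [mem_filter, mem_Ico]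
              exact ⟨⟨ht.1, by omega⟩, start_le_of_lt ht.1 (by omega)⟩
            rw [heq, zero_add]
            have hrem : ∀ t, (remaining m n w δ i t (s * (m * n + 1) + b) -
                remaining m n w δ i t (s * (m * n + 1) + b + 1)) * x t = if s ≤ t then
                (δ (s * (m * n + 1) + b) (i * w + (t - s)) -
                  δ (s * (m * n + 1) + b + 1) (i * w + (t - s))) * x t else 0 := by
              intro t
              rw [add_assoc (s * (m * n + 1)), remaining_eq i t (by omega),
                remaining_eq i t (by omega)]
              split_ifs <;> simp
            rw [sum_congr rfl fun t _ => hrem t, ← sum_filter]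
            refine sum_subset (fun t ht => ?_) fun t ht ht' => ?_
            · rw [mem_filter, mem_Ico] at ht
              rw [mem_Ico]; omega
            · rw [mem_Ico] at ht
              rw [mem_filter, mem_Ico] at ht'
              have h0 := h.early_zero hi hw hs hb (t - s) (by omega) (by omega)
              rw [h0]; simp
        rw [hsum]
        omega
      · rw [if_neg fun hh => e1 hh.2, e3, Nat.sub_self, zero_add]
        refine sum_eq_zero fun t _ => ?_
        split_ifs with hst
        · rw [(h.remaining_bin hi hw hs hb' (lt_of_start_le hb hst)).2 e1, Nat.sub_self, zero_mul]
        · rfl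
    · rw [if_neg (lt_irrefl _), if_neg fun hh => lt_irrefl _ hh.1, zero_add]
      refine sum_eq_zero fun t _ => ?_
      split_ifs with hst
      · rw [h.remaining_intro hi hs (lt_of_start_le hb hst), Nat.sub_self, zero_mul]
      · rfl
  pool t ht := by
    have ht' := mem_Ico.1 ht
    have := h.pool_eq hi hw (ℓ := startTime m n w t) (Nat.mul_le_mul_right _ (by omega))
    rw [← this]
    refine le_trans (sum_le_sum_of_subset fun t' ht' => ?_) (Nat.le_add_left _ _)
    rw [mem_filter] at ht' ⊢
    exact ⟨ht'.1, Nat.mul_le_mul_right _ (by omega)⟩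
  big t ht ℓ hℓ hA := by
    have ht' := mem_Ico.1 ht
    rw [binSize] at hA ⊢
    split_ifs at hA ⊢ with hc
    · refine (hG t ht).trans (le_trans (hanti ?_) hc.2.2.1)
      have : ℓ / (m * n + 1) < t - w + 1 := Nat.div_lt_of_lt_mul (by rwa [mul_comm])
      omega
    · exact absurd rfl hA

/-- The total size of the entries. -/
theorem total (h : Chain m n w S x a δ) {i : ℕ} (hi : i < m) (hw : 0 < w)
    (hanti : Antitone x) :
    ∑ t ∈ Ico w (w + S), entryCount m n w δ t * x t + δ (S * (m * n + 1)) (m * w + i) =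
      ∑ ℓ ∈ range (S * (m * n + 1)), binSize m n x a i ℓ := by
  have h1 := (h.packing (G := 0) hi hw hanti (by simp)).total
  have h2 := h.pool_eq hi hw le_rfl
  rw [filter_true_of_mem fun t ht => by
    rw [mem_Ico] at ht
    exact Nat.mul_le_mul_right _ (by omega)] at h2
  omega

/-- The cost of a chain. -/
theorem cost_eq (h : Chain m n w S x a δ) (hw : 0 < w) :
    δ (S * (m * n + 1)) (m * w + m + 1) =
      ∑ s ∈ range S, entryCount m n w δ (s + w) * (x (s + w) * s) := by
  have hbin : ∀ s < S, ∀ b ≤ m * n, δ (s * (m * n + 1) + b) (m * w + m + 1) =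
      δ (s * (m * n + 1)) (m * w + m + 1) := by
    intro s hs b
    induction b with
    | zero => intro _; rfl
    | succ b ih =>
      intro hb
      rw [← ih (by omega)]
      have hstep := h.bin_step hs (by omega : b < m * n)
      have hbn : b / n < m := Nat.div_lt_of_lt_mul (by rw [mul_comm]; omega)
      have hdw : m ≤ (m * w + m + 1) / w :=
        (Nat.le_div_iff_mul_le hw).2 (by omega)
      rw [Step, if_pos (by omega)] at hstep
      split_ifs at hstep
      · exact hstep.1 _ (by omega) ⟨by omega, by omega⟩
      · exact hstep _ (by omega)
  have key : ∀ s ≤ S, δ (s * (m * n + 1)) (m * w + m + 1) =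
      ∑ s' ∈ range s, entryCount m n w δ (s' + w) * (x (s' + w) * s') := by
    intro s
    induction s with
    | zero => intro _; rw [zero_mul, sum_range_zero]; exact h.zero _ (by omega)
    | succ s ih =>
      intro hs
      have hstep := h.intro_step (by omega : s < S)
      rw [Step, if_neg (lt_irrefl _)] at hstep
      rw [sum_range_succ, ← ih (by omega), hstep.1, hbin s (by omega) _ le_rfl, entryCount,
        startTime, Nat.add_sub_cancel]
  exact key S le_rfl

/-- The state of marginal `i` that contains cell `o` of the entries of size `x t`. -/
noncomputable def cellState (m n w S : ℕ) (x : ℕ → ℕ) (δ : ℕ → ℕ → ℕ) (i t o : ℕ) : ℕ :=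
  bin (S * (m * n + 1)) (Ico w (w + S)) x (entryCount m n w δ) (startTime m n w)
    (remaining m n w δ i) (restSpace m n w δ i) t o % (m * n + 1) % n

theorem binSize_ne_zero {i ℓ : ℕ} (h : binSize m n x a i ℓ ≠ 0) :
    ℓ % (m * n + 1) < m * n ∧ ℓ % (m * n + 1) / n = i ∧
    x (ℓ / (m * n + 1)) ≤ a (ℓ % (m * n + 1)) ∧ a (ℓ % (m * n + 1)) < x (ℓ / (m * n + 1) - 1) := by
  rw [binSize] at h
  split_ifs at h with hc
  · exact hc
  · exact absurd rfl h

theorem binSize_mod {i ℓ : ℕ} (h : binSize m n x a i ℓ ≠ 0) :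
    ℓ % (m * n + 1) = i * n + ℓ % (m * n + 1) % n ∧ ℓ % (m * n + 1) % n < n := by
  obtain ⟨h1, h2, -⟩ := binSize_ne_zero h
  have hn : 0 < n := Nat.pos_of_ne_zero fun h0 => by simp [h0] at h1
  refine ⟨?_, Nat.mod_lt _ hn⟩
  rw [← h2]
  exact (Nat.div_add_mod' _ _).symm

theorem binSize_eq {i ℓ : ℕ} (h : binSize m n x a i ℓ ≠ 0) :
    binSize m n x a i ℓ = a (i * n + ℓ % (m * n + 1) % n) := by
  rw [← (binSize_mod h).1, binSize, if_pos (binSize_ne_zero h)]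

/-- The clock at which a state is opened is determined by its mass, since x is antitone. -/
theorem binSize_inj (hanti : Antitone x) {i ℓ ℓ' : ℕ} (h : binSize m n x a i ℓ ≠ 0)
    (h' : binSize m n x a i ℓ' ≠ 0) (heq : ℓ % (m * n + 1) % n = ℓ' % (m * n + 1) % n) : ℓ = ℓ' := by
  have e1 := binSize_mod h
  have e2 := binSize_mod h'
  have e3 := binSize_ne_zero h
  have e4 := binSize_ne_zero h'
  have hmod : ℓ % (m * n + 1) = ℓ' % (m * n + 1) := by rw [e1.1, e2.1, heq]
  have hdiv : ℓ / (m * n + 1) = ℓ' / (m * n + 1) := by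
    rw [hmod] at e3
    rcases lt_trichotomy (ℓ / (m * n + 1)) (ℓ' / (m * n + 1)) with hl | he | hl
    · have := hanti (by omega : ℓ / (m * n + 1) ≤ ℓ' / (m * n + 1) - 1)
      omega
    · exact he
    · have := hanti (by omega : ℓ' / (m * n + 1) ≤ ℓ / (m * n + 1) - 1)
      omega
  rw [← Nat.div_add_mod ℓ (m * n + 1), ← Nat.div_add_mod ℓ' (m * n + 1), hmod, hdiv]

/-- A bin that contains a cell cannot have size zero, because no bin is overfull. -/
theorem cellState_lt (h : Chain m n w S x a δ) {i : ℕ} (hi : i < m) (hw : 0 < w)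
    (hanti : Antitone x) {t o : ℕ} (ht : t ∈ Ico w (w + S))
    (ho : o < entryCount m n w δ t * x t) :
    cellState m n w S x δ i t o < n ∧ binSize m n x a i (bin (S * (m * n + 1)) (Ico w (w + S)) x
      (entryCount m n w δ) (startTime m n w)
      (remaining m n w δ i) (restSpace m n w δ i) t o) ≠ 0 := by
  have hp := h.packing (G := 0) hi hw hanti (by simp)
  have hlt := hp.bin_lt ht ho
  have hc := hp.count_le hlt
  have h0 : binSize m n x a i (bin (S * (m * n + 1)) (Ico w (w + S)) x
      (entryCount m n w δ) (startTime m n w)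
      (remaining m n w δ i) (restSpace m n w δ i) t o) ≠ 0 := by
    intro h0
    rw [h0, Nat.le_zero, sum_eq_zero_iff] at hc
    have := sum_eq_zero_iff.1 (hc t ht) o (mem_range.2 ho)
    simp at this
  exact ⟨(binSize_mod h0).2, h0⟩

/-- No state receives more mass than it has. -/
theorem cellState_count_le (h : Chain m n w S x a δ) {i : ℕ} (hi : i < m) (hw : 0 < w)
    (hanti : Antitone x) (j : ℕ) :
    ∑ t ∈ Ico w (w + S), ∑ o ∈ range (entryCount m n w δ t * x t),
      (if cellState m n w S x δ i t o = j then 1 else 0) ≤ a (i * n + j) := by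
  have hp := h.packing (G := 0) hi hw hanti (by simp)
  set β := bin (S * (m * n + 1)) (Ico w (w + S)) x (entryCount m n w δ) (startTime m n w)
      (remaining m n w δ i) (restSpace m n w δ i) with hβ
  by_cases hex : ∃ t ∈ Ico w (w + S), ∃ o < entryCount m n w δ t * x t,
      cellState m n w S x δ i t o = j
  · obtain ⟨t₀, ht₀, o₀, ho₀, hj⟩ := hex
    have h0 := (h.cellState_lt hi hw hanti ht₀ ho₀).2
    rw [← hj]
    have := hp.count_le (hp.bin_lt ht₀ ho₀)
    rw [binSize_eq h0] at this
    refine le_trans (sum_le_sum fun t ht => sum_le_sum fun o ho => ?_) this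
    split_ifs with h1 h2
    · exact le_rfl
    · exact absurd (binSize_inj hanti (h.cellState_lt hi hw hanti ht (mem_range.1 ho)).2 h0 h1) h2
    · exact Nat.zero_le _
    · exact le_rfl
  · push Not at hex
    rw [sum_eq_zero fun t ht => sum_eq_zero fun o ho => if_neg (hex t ht o (mem_range.1 ho))]
    exact Nat.zero_le _

theorem sum_binSize_le (hanti : Antitone x) (i : ℕ) :
    ∑ ℓ ∈ range (S * (m * n + 1)), binSize m n x a i ℓ ≤ ∑ j ∈ range n, a (i * n + j) := by
  classical
  rw [← sum_filter_ne_zero]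
  rw [sum_congr rfl fun ℓ hℓ => binSize_eq (mem_filter.1 hℓ).2]
  rw [← sum_image (f := fun j => a (i * n + j)) (g := fun ℓ => ℓ % (m * n + 1) % n)]
  · refine sum_le_sum_of_subset fun j hj => ?_
    obtain ⟨ℓ, hℓ, rfl⟩ := mem_image.1 hj
    exact mem_range.2 (binSize_mod (mem_filter.1 hℓ).2).2
  · intro ℓ hℓ ℓ' hℓ' heq
    exact binSize_inj hanti (mem_filter.1 hℓ).2 (mem_filter.1 hℓ').2 heq

/-- A change of the state is a change of the bin, so the bound on cuts carries over. -/
theorem changes_cellState_le (h : Chain m n w S x a δ) {i : ℕ} (hi : i < m) (hw : 0 < w) {G : ℕ}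
    (hanti : Antitone x) (hG : ∀ t ∈ Ico w (w + S), G * x t ≤ x (t - w)) :
    G * ∑ t ∈ Ico w (w + S), x t * changes (cellState m n w S x δ i t) (entryCount m n w δ t) (x t) ≤
      ∑ j ∈ range n, a (i * n + j) := by
  refine le_trans ?_ (((h.packing hi hw hanti hG).changes_le).trans (sum_binSize_le hanti i))
  refine Nat.mul_le_mul_left _ (sum_le_sum fun t _ => Nat.mul_le_mul_left _ ?_)
  refine sum_le_sum fun o _ => ?_
  split_ifs with h1 h2
  · exact le_rfl
  · exact absurd ⟨h1.1, fun hh => h1.2 (by simp only [cellState, hh])⟩ h2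
  · exact Nat.zero_le _
  · exact le_rfl

/-- All but the small states are packed at some time. -/
theorem le_sum_binSize {i : ℕ} (hi : i < m)
    (ha : ∀ j < n, a (i * n + j) < x 0) :
    ∑ j ∈ range n, a (i * n + j) ≤
      ∑ ℓ ∈ range (S * (m * n + 1)), binSize m n x a i ℓ + n * x (S - 1) := by
  classical
  have h1 : ∀ j < n, x (S - 1) ≤ a (i * n + j) → ∃ ℓ < S * (m * n + 1),
      binSize m n x a i ℓ = a (i * n + j) ∧ ℓ % (m * n + 1) = i * n + j := by
    intro j hj hle
    -- The clock is the least s with x s ≤ a. It is positive because the state is smaller than x 0,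
    -- and less than S because the state is at least x (S - 1).
    have hex : ∃ s, x s ≤ a (i * n + j) := ⟨_, hle⟩
    have hs := Nat.find_spec hex
    have hs' := Nat.find_min' hex hle
    have h0 : Nat.find hex ≠ 0 := fun h0 => by
      have := ha j hj
      rw [h0] at hs
      omega
    have hlt : a (i * n + j) < x (Nat.find hex - 1) :=
      not_le.1 (Nat.find_min hex (by omega : Nat.find hex - 1 < Nat.find hex))
    have hb := idx_lt (w := n) hi hj
    refine ⟨Nat.find hex * (m * n + 1) + (i * n + j), ?_, ?_, layer_mod (by omega)⟩
    · calc _ < Nat.find hex * (m * n + 1) + (m * n + 1) := by omega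
        _ = (Nat.find hex + 1) * (m * n + 1) := by ring
        _ ≤ _ := Nat.mul_le_mul_right _ (by omega)
    · rw [binSize, layer_mod (by omega : i * n + j < m * n + 1),
        layer_div (by omega : i * n + j < m * n + 1),
        if_pos ⟨hb, idx_div hj, hs, hlt⟩]
  rw [← sum_filter_add_sum_filter_not (range n) fun j => x (S - 1) ≤ a (i * n + j)]
  refine Nat.add_le_add ?_ ?_
  · choose! g hg using h1
    rw [sum_congr rfl fun j hj => (hg j (mem_range.1 (mem_filter.1 hj).1)
      (mem_filter.1 hj).2).2.1.symm]
    rw [← sum_image (f := fun ℓ => binSize m n x a i ℓ) (g := g)]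
    · refine sum_le_sum_of_subset fun ℓ hℓ => ?_
      obtain ⟨j, hj, rfl⟩ := mem_image.1 hℓ
      rw [mem_filter, mem_range] at hj
      exact mem_range.2 (hg j hj.1 hj.2).1
    · intro j hj j' hj' heq
      have hj := mem_filter.1 hj
      have hj' := mem_filter.1 hj'
      rw [mem_range] at hj hj'
      have e1 := (hg j hj.1 hj.2).2.2
      have e2 := (hg j' hj'.1 hj'.2).2.2
      rw [heq, e2] at e1
      omega
  · refine (sum_le_card_nsmul _ _ (x (S - 1)) fun j hj => ?_).trans ?_
    · exact (not_le.1 (mem_filter.1 hj).2).le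
    · rw [smul_eq_mul]
      exact Nat.mul_le_mul_right _ ((card_filter_le _ _).trans (by simp))

end Chain

end MinEntropyCoupling

/-! ### The chain of a coupling -/

namespace MinEntropyCoupling

open Finset

/-- The least `t < S` with `x t ≤ y`, and `S` if there is none. -/
noncomputable def level (S : ℕ) (x : ℕ → ℕ) (y : ℕ) : ℕ := countLt S fun t => y < x t

theorem lt_level_iff {S : ℕ} {x : ℕ → ℕ} (hanti : Antitone x) {y t : ℕ} (ht : t < S) :
    t < level S x y ↔ y < x t :=
  lt_countLt_iff (fun _ _ h _ h' => h'.trans_le (hanti h)) ht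

theorem level_le_iff {S : ℕ} {x : ℕ → ℕ} (hanti : Antitone x) {y t : ℕ} (ht : t < S) :
    level S x y ≤ t ↔ x t ≤ y := by
  rw [← not_lt, lt_level_iff hanti ht, not_lt]

/-- Entries `e ∈ s` of mass `X e` in the states `col i e` of the marginals `i`, whose states have
masses `a (i * n + j)`. -/
structure Profile {E : Type*} (m n w S U : ℕ) (x a : ℕ → ℕ) (s : Finset E) (X : E → ℕ)
    (col : ℕ → E → ℕ) : Prop where
  pos : ∀ t, 0 < x t
  anti : Antitone x
  w_pos : 0 < w
  S_pos : 0 < S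
  large : ∀ t < w, U < x t
  col_lt : ∀ i < m, ∀ e ∈ s, col i e < n
  sum_le : ∀ i < m, ∀ j < n, (∑ e ∈ s, if col i e = j then X e else 0) ≤ a (i * n + j)
  row_le : ∀ i < m, ∑ j ∈ range n, a (i * n + j) ≤ U
  kept : ∀ e ∈ s, x (S - 1) ≤ X e
  total_le : ∑ e ∈ s, X e ≤ U

namespace Profile

section

variable {E : Type*} (m n w S : ℕ) (x a : ℕ → ℕ) (s : Finset E) (X : E → ℕ) (col : ℕ → E → ℕ)

/-- What the mass of an entry exceeds its size. -/
noncomputable def crumb (e : E) : ℕ := X e - x (level S x (X e))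

/-- The excess mass from which entries of size `x t` can be formed. -/
noncomputable def avail (t : ℕ) : ℕ :=
  ∑ e ∈ s, if level S x (X e) + w ≤ t then crumb S x X e else 0

/-- The excess mass of which entries of sizes `x 0, …, x (t - 1)` have been formed. -/
noncomputable def used : ℕ → ℕ
  | 0 => 0
  | t + 1 => used t + (avail w S x s X t - used t) / x t * x t

/-- The number of entries of size `x t` that are formed of excess mass. -/
noncomputable def extra (t : ℕ) : ℕ := (avail w S x s X t - used w S x s X t) / x t

noncomputable def num (t : ℕ) : ℕ :=
  (∑ e ∈ s, if level S x (X e) = t then 1 else 0) + extra w S x s X t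

/-- The time of the bin `b`. -/
noncomputable def binTime (b : ℕ) : ℕ := level S x (a b) * (m * n + 1) + b

/-- An entry is packed when the bin of its own state opens. If this happens before entries of its
size appear, it counts as poured. -/
noncomputable def served (i : ℕ) (e : E) : ℕ := binTime m n S x a (i * n + col i e)

noncomputable def demand (i ℓ t : ℕ) : ℕ :=
  ∑ e ∈ s, if level S x (X e) = t ∧ ℓ ≤ served m n S x a col i e then 1 else 0

noncomputable def packed (i ℓ t : ℕ) : ℕ :=
  ∑ e ∈ s, if served m n S x a col i e < ℓ ∧ level S x (X e) < t then x (level S x (X e)) else 0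

noncomputable def opened (i ℓ : ℕ) : ℕ :=
  ∑ j ∈ range n, if binTime m n S x a (i * n + j) < ℓ then a (i * n + j) else 0

/-- The subtractions are exact by `packed_add_used_le`. -/
noncomputable def pool (i ℓ : ℕ) : ℕ :=
  opened m n S x a i ℓ - packed m n S x a s X col i ℓ (ℓ / (m * n + 1) + w) -
    used w S x s X (ℓ / (m * n + 1) + w)

noncomputable def state (ℓ d : ℕ) : ℕ :=
  if d < m * w then demand m n S x a s X col (d / w) ℓ (ℓ / (m * n + 1) + d % w)
  else if d < m * w + m then pool m n w S x a s X col (d - m * w) ℓ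
  else if d = m * w + m then
    if ℓ / (m * n + 1) = 0 then 0 else num w S x s X (ℓ / (m * n + 1) - 1 + w)
  else ∑ t ∈ range (ℓ / (m * n + 1)), num w S x s X (t + w) * (x (t + w) * t)

end

variable {E : Type*} {m n w S U : ℕ} {x a : ℕ → ℕ} {s : Finset E} {X : E → ℕ} {col : ℕ → E → ℕ}

theorem avail_mono : Monotone (avail w S x s X) := by
  intro t t' h
  refine sum_le_sum fun e _ => ?_
  split_ifs <;> omega

theorem used_succ_le (t : ℕ) : used w S x s X (t + 1) ≤ avail w S x s X t := by
  have key : ∀ t, used w S x s X t ≤ avail w S x s X t →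
      used w S x s X (t + 1) ≤ avail w S x s X t := by
    intro t h
    rw [used]
    have := Nat.div_mul_le_self (avail w S x s X t - used w S x s X t) (x t)
    omega
  induction t with
  | zero => exact key 0 (Nat.zero_le _)
  | succ t ih => exact key _ (ih.trans (avail_mono (Nat.le_succ _)))

theorem used_le (t : ℕ) : used w S x s X t ≤ avail w S x s X (t - 1) := by
  cases t with
  | zero => exact Nat.zero_le _
  | succ t => exact used_succ_le t

/-- What is not used up is the remainder of a division by x t, less than one entry. -/
theorem avail_lt (t : ℕ) (ht : 0 < x t) :
    avail w S x s X t < used w S x s X (t + 1) + x t := by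
  have h1 : used w S x s X t ≤ avail w S x s X t := (used_le t).trans (avail_mono (Nat.sub_le _ _))
  have h2 := Nat.div_add_mod' (avail w S x s X t - used w S x s X t) (x t)
  have h3 := Nat.mod_lt (avail w S x s X t - used w S x s X t) ht
  rw [used]
  omega

theorem used_succ (t : ℕ) :
    used w S x s X (t + 1) = used w S x s X t + extra w S x s X t * x t := rfl

variable (h : Profile m n w S U x a s X col)
include h

theorem bin_lt {i : ℕ} (hi : i < m) {e : E} (he : e ∈ s) : i * n + col i e < m * n :=
  idx_lt hi (h.col_lt i hi e he)

theorem le_bin {i : ℕ} (hi : i < m) {e : E} (he : e ∈ s) : X e ≤ a (i * n + col i e) := by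
  refine le_trans ?_ (h.sum_le i hi _ (h.col_lt i hi e he))
  refine le_trans ?_ (single_le_sum (fun _ _ => Nat.zero_le _) he)
  rw [if_pos rfl]

theorem bin_le {b : ℕ} (hb : b < m * n) : a b ≤ U := by
  have hn : 0 < n := Nat.pos_of_ne_zero fun h0 => by simp [h0] at hb
  have h1 := h.row_le (b / n) (Nat.div_lt_of_lt_mul (by rwa [mul_comm]))
  refine le_trans ?_ h1
  refine le_trans ?_ (single_le_sum (f := fun j => a (b / n * n + j)) (fun _ _ => Nat.zero_le _)
    (mem_range.2 (Nat.mod_lt b hn)))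
  rw [Nat.div_add_mod']

theorem level_lt {e : E} (he : e ∈ s) : level S x (X e) < S := by
  have := (level_le_iff h.anti (Nat.sub_lt h.S_pos one_pos)).2 (h.kept e he)
  have := h.S_pos
  omega

theorem size_le {e : E} (he : e ∈ s) : x (level S x (X e)) ≤ X e :=
  (level_le_iff h.anti (h.level_lt he)).1 le_rfl

theorem entry_le {e : E} (he : e ∈ s) : X e ≤ U :=
  (single_le_sum (fun _ _ => Nat.zero_le _) he).trans h.total_le

theorem size_add_crumb {e : E} (he : e ∈ s) : x (level S x (X e)) + crumb S x X e = X e := by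
  have := h.size_le he
  rw [crumb]
  omega

theorem le_level {y : ℕ} (hy : y ≤ U) (hS : level S x y < S) : w ≤ level S x y := by
  by_contra hc
  have := (level_le_iff h.anti hS).1 le_rfl
  have := h.large _ (not_le.1 hc)
  omega

theorem active_iff {c b : ℕ} (hc : c < S) (hb : b < m * n) :
    (x c ≤ a b ∧ a b < x (c - 1)) ↔ level S x (a b) = c := by
  have hU := h.bin_le hb
  have hw := h.w_pos
  constructor
  · rintro ⟨h1, h2⟩
    have h3 := (level_le_iff h.anti hc).2 h1
    have h4 := (lt_level_iff h.anti (by omega : c - 1 < S)).2 h2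
    omega
  · intro h1
    have h2 := h.le_level hU (by omega)
    exact ⟨(level_le_iff h.anti hc).1 h1.le, (lt_level_iff h.anti (by omega : c - 1 < S)).1 (by omega)⟩

/-- An entry fits into its state, so the state is opened no later than at the level of the entry. -/
theorem bin_level_le {i : ℕ} (hi : i < m) {e : E} (he : e ∈ s) :
    level S x (a (i * n + col i e)) ≤ level S x (X e) :=
  (level_le_iff h.anti (h.level_lt he)).2 ((h.size_le he).trans (h.le_bin hi he))

theorem served_eq_iff {i : ℕ} (hi : i < m) {e : E} (he : e ∈ s) {c b : ℕ} (hb : b < m * n + 1) :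
    served m n S x a col i e = c * (m * n + 1) + b ↔
      i * n + col i e = b ∧ level S x (a b) = c := by
  rw [served, binTime]
  have hlt := h.bin_lt hi he
  constructor
  · intro heq
    have h1 := layer_div (s := level S x (a (i * n + col i e))) (hlt.trans (Nat.lt_succ_self _))
    have h2 := layer_mod (s := level S x (a (i * n + col i e))) (hlt.trans (Nat.lt_succ_self _))
    rw [heq, layer_div hb] at h1
    rw [heq, layer_mod hb] at h2
    exact ⟨h2.symm, by rw [h2]; exact h1.symm⟩
  · rintro ⟨rfl, rfl⟩
    rfl

theorem served_lt {i : ℕ} (hi : i < m) {e : E} (he : e ∈ s) :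
    served m n S x a col i e < (level S x (X e) + 1) * (m * n + 1) := by
  have h1 := Nat.mul_le_mul_right (m * n + 1) (h.bin_level_le hi he)
  have h2 := h.bin_lt hi he
  rw [served, binTime, Nat.succ_mul]
  omega

theorem sum_served_le {i : ℕ} (hi : i < m) (ℓ : ℕ) :
    (∑ e ∈ s, if served m n S x a col i e < ℓ then X e else 0) ≤ opened m n S x a i ℓ := by
  calc (∑ e ∈ s, if served m n S x a col i e < ℓ then X e else 0)
      = ∑ e ∈ s, ∑ j ∈ range n, if binTime m n S x a (i * n + j) < ℓ then
          (if col i e = j then X e else 0) else 0 := by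
        refine sum_congr rfl fun e he => ?_
        rw [sum_eq_single (col i e)]
        · rw [if_pos rfl]; rfl
        · intro j _ hj
          rw [if_neg hj.symm, ite_self]
        · intro hn
          exact absurd (mem_range.2 (h.col_lt i hi e he)) hn
    _ = ∑ j ∈ range n, if binTime m n S x a (i * n + j) < ℓ then
          (∑ e ∈ s, if col i e = j then X e else 0) else 0 := by
        rw [sum_comm]
        refine sum_congr rfl fun j _ => ?_
        split_ifs
        · rfl
        · exact sum_const_zero
    _ ≤ _ := by
        refine sum_le_sum fun j hj => ?_
        split_ifs
        · exact h.sum_le i hi j (mem_range.1 hj)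
        · exact le_rfl

/-- The excess of e becomes available only at index level + w. Since `used` lags by one index, any
excess that has been used belongs to an entry whose level lies before the current clock, hence whose
bin is open. Sizes and excesses are thus charged to entries in open bins, where they fit. -/
theorem packed_add_used_le {i : ℕ} (hi : i < m) (ℓ : ℕ) :
    packed m n S x a s X col i ℓ (ℓ / (m * n + 1) + w) + used w S x s X (ℓ / (m * n + 1) + w) ≤
      opened m n S x a i ℓ := by
  refine le_trans ?_ (h.sum_served_le hi ℓ)
  have h1 := used_le (w := w) (S := S) (x := x) (s := s) (X := X) (ℓ / (m * n + 1) + w)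
  refine (Nat.add_le_add_left h1 _).trans ?_
  rw [packed, avail, ← sum_add_distrib]
  refine sum_le_sum fun e he => ?_
  have h2 := h.size_add_crumb he
  have h3 := h.served_lt hi he
  have h5 := h.w_pos
  by_cases h4 : level S x (X e) < ℓ / (m * n + 1)
  · have : (level S x (X e) + 1) * (m * n + 1) ≤ ℓ :=
      (Nat.mul_le_mul_right _ h4).trans (Nat.div_mul_le_self _ _)
    rw [if_pos ⟨by omega, by omega⟩, if_pos (by omega), if_pos (by omega), h2]
  · rw [if_neg (by omega : ¬ level S x (X e) + w ≤ ℓ / (m * n + 1) + w - 1), add_zero]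
    split_ifs <;> omega

omit h in
theorem state_demand {i c : ℕ} (hi : i < m) (hc : c < w) (ℓ : ℕ) :
    state m n w S x a s X col ℓ (i * w + c) =
      demand m n S x a s X col i ℓ (ℓ / (m * n + 1) + c) := by
  rw [state, if_pos (idx_lt hi hc), idx_div hc, layer_mod hc]

omit h in
theorem state_pool {i : ℕ} (hi : i < m) (ℓ : ℕ) :
    state m n w S x a s X col ℓ (m * w + i) = pool m n w S x a s X col i ℓ := by
  rw [state, if_neg (by omega), if_pos (by omega), Nat.add_sub_cancel_left]

omit h in
theorem state_num (ℓ : ℕ) : state m n w S x a s X col ℓ (m * w + m) =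
    if ℓ / (m * n + 1) = 0 then 0 else num w S x s X (ℓ / (m * n + 1) - 1 + w) := by
  rw [state, if_neg (by omega), if_neg (by omega), if_pos rfl]

omit h in
theorem state_cost (ℓ : ℕ) : state m n w S x a s X col ℓ (m * w + m + 1) =
    ∑ t ∈ range (ℓ / (m * n + 1)), num w S x s X (t + w) * (x (t + w) * t) := by
  rw [state, if_neg (by omega), if_neg (by omega), if_neg (by omega)]

theorem demand_succ {i : ℕ} (hi : i < m) {c b : ℕ} (hb : b < m * n + 1) (t : ℕ) :
    demand m n S x a s X col i (c * (m * n + 1) + b) t =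
      demand m n S x a s X col i (c * (m * n + 1) + b + 1) t +
      ∑ e ∈ s, if level S x (X e) = t ∧ i * n + col i e = b ∧ level S x (a b) = c then 1 else 0 := by
  rw [demand, demand, ← sum_add_distrib]
  refine sum_congr rfl fun e he => ?_
  have := h.served_eq_iff hi he (c := c) hb
  by_cases h1 : level S x (X e) = t
  · simp only [h1, true_and, ← this]
    split_ifs <;> omega
  · simp [h1]

theorem packed_succ {i : ℕ} (hi : i < m) {c b : ℕ} (hb : b < m * n + 1) (t : ℕ) :
    packed m n S x a s X col i (c * (m * n + 1) + b + 1) t =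
      packed m n S x a s X col i (c * (m * n + 1) + b) t +
      ∑ e ∈ s, if level S x (X e) < t ∧ i * n + col i e = b ∧ level S x (a b) = c then
        x (level S x (X e)) else 0 := by
  rw [packed, packed, ← sum_add_distrib]
  refine sum_congr rfl fun e he => ?_
  have := h.served_eq_iff hi he (c := c) hb
  by_cases h1 : level S x (X e) < t
  · simp only [h1, and_true, true_and, ← this]
    split_ifs <;> omega
  · simp [h1]

omit h in
theorem opened_succ {i : ℕ} (hi : i < m) {c b : ℕ} (hb : b < m * n + 1) :
    opened m n S x a i (c * (m * n + 1) + b + 1) = opened m n S x a i (c * (m * n + 1) + b) +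
      if b < m * n ∧ b / n = i ∧ level S x (a b) = c then a b else 0 := by
  have hiff : ∀ j < n, binTime m n S x a (i * n + j) = c * (m * n + 1) + b ↔
      i * n + j = b ∧ level S x (a b) = c := by
    intro j hj
    have hlt := idx_lt hi hj
    rw [binTime]
    constructor
    · intro heq
      have h1 := layer_div (s := level S x (a (i * n + j))) (hlt.trans (Nat.lt_succ_self _))
      have h2 := layer_mod (s := level S x (a (i * n + j))) (hlt.trans (Nat.lt_succ_self _))
      rw [heq, layer_div hb] at h1
      rw [heq, layer_mod hb] at h2
      exact ⟨h2.symm, by rw [h2]; exact h1.symm⟩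
    · rintro ⟨rfl, rfl⟩
      rfl
  have hsum : (∑ j ∈ range n, if i * n + j = b ∧ level S x (a b) = c then a b else 0) =
      if b < m * n ∧ b / n = i ∧ level S x (a b) = c then a b else 0 := by
    split_ifs with hc
    · have hn : 0 < n := Nat.pos_of_ne_zero fun h0 => by simp [h0] at hc
      rw [sum_eq_single (b % n)]
      · rw [if_pos ⟨by rw [← hc.2.1, Nat.div_add_mod'], hc.2.2⟩]
      · intro j hj hne
        refine if_neg fun hh => hne ?_
        rw [← hh.1, layer_mod (mem_range.1 hj)]
      · intro hh
        exact absurd (mem_range.2 (Nat.mod_lt _ hn)) hh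
    · refine sum_eq_zero fun j hj => if_neg fun hh => hc ?_
      have hj := mem_range.1 hj
      refine ⟨?_, ?_, hh.2⟩
      · rw [← hh.1]; exact idx_lt hi hj
      · rw [← hh.1]; exact idx_div hj
  rw [opened, opened, ← hsum, ← sum_add_distrib]
  refine sum_congr rfl fun j hj => ?_
  have := hiff j (mem_range.1 hj)
  by_cases heq : i * n + j = b
  · subst heq
    simp only [true_and] at this ⊢
    simp only [← this]
    split_ifs <;> omega
  · simp only [heq, false_and, if_false, iff_false] at this ⊢
    split_ifs <;> omega

/-- The chain records how the coupling itself fills the states: rounded entries go to their own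
bins, and entries formed of excess mass are always poured. -/
theorem chain : Chain m n w S x a (state m n w S x a s X col) where
  zero d hd := by
    rw [state, Nat.zero_div, if_pos rfl]
    split_ifs with h1 h2
    · refine sum_eq_zero fun e he => if_neg fun hh => ?_
      have := h.le_level (h.entry_le he) (h.level_lt he)
      have := Nat.mod_lt d h.w_pos
      omega
    · simp [pool, opened]
    · rfl
    · rw [range_zero, sum_empty]
  step ℓ hℓ := by
    obtain ⟨c, b, rfl, hc, hb⟩ := Chain.exists_layer hℓ
    rw [layer_div hb, layer_mod hb]
    rcases (Nat.lt_succ_iff_lt_or_eq.1 hb) with hb' | rfl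
    · rw [Step, if_pos hb']
      have hdiv : (c * (m * n + 1) + b + 1) / (m * n + 1) = c := by
        rw [add_assoc, layer_div (by omega)]
      have hrest : ∀ d, m * w + m ≤ d → state m n w S x a s X col (c * (m * n + 1) + b + 1) d =
          state m n w S x a s X col (c * (m * n + 1) + b) d := by
        intro d hd
        rw [state, state, hdiv, layer_div hb, if_neg (by omega : ¬ d < m * w),
          if_neg (by omega : ¬ d < m * w + m), if_neg (by omega : ¬ d < m * w),
          if_neg (by omega : ¬ d < m * w + m)]
      have hdem : ∀ i < m, ∀ c' < w, ¬ (b / n = i ∧ level S x (a b) = c) →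
          state m n w S x a s X col (c * (m * n + 1) + b + 1) (i * w + c') =
          state m n w S x a s X col (c * (m * n + 1) + b) (i * w + c') := by
        intro i hi c' hc' hne
        rw [state_demand hi hc', state_demand hi hc', hdiv, layer_div hb, h.demand_succ hi hb,
          sum_eq_zero, add_zero]
        refine fun e he => if_neg fun hh => hne ⟨?_, hh.2.2⟩
        rw [← hh.2.1, idx_div (h.col_lt i hi e he)]
      have hpool : ∀ i < m, ¬ (b / n = i ∧ level S x (a b) = c) →
          state m n w S x a s X col (c * (m * n + 1) + b + 1) (m * w + i) =
          state m n w S x a s X col (c * (m * n + 1) + b) (m * w + i) := by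
        intro i hi hne
        rw [state_pool hi, state_pool hi, pool, pool, hdiv, layer_div hb, h.packed_succ hi hb,
          opened_succ hi hb, if_neg fun hh => hne hh.2, sum_eq_zero, add_zero, add_zero]
        refine fun e he => if_neg fun hh => hne ⟨?_, hh.2.2⟩
        rw [← hh.2.1, idx_div (h.col_lt i hi e he)]
      simp only [h.active_iff hc hb']
      split_ifs with hact
      · have hi : b / n < m := Nat.div_lt_of_lt_mul (by rwa [mul_comm])
        -- The entries of the state that is opened have a level of at least c. Those below c + w are
        -- packed now and reduce the demands; the others leave their space to the pool.
        have hbin : ∀ e ∈ s, b / n * n + col (b / n) e = b → c ≤ level S x (X e) := by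
          intro e he heq
          have := h.bin_level_le hi he
          rw [heq] at this
          omega
        have hsum : ∑ c' ∈ range w, (state m n w S x a s X col (c * (m * n + 1) + b)
            (b / n * w + c') - state m n w S x a s X col (c * (m * n + 1) + b + 1)
              (b / n * w + c')) * x (c + c') =
            ∑ e ∈ s, if level S x (X e) < c + w ∧ b / n * n + col (b / n) e = b ∧
              level S x (a b) = c then x (level S x (X e)) else 0 := by
          have : ∀ c' ∈ range w, (state m n w S x a s X col (c * (m * n + 1) + b)
              (b / n * w + c') - state m n w S x a s X col (c * (m * n + 1) + b + 1)
              (b / n * w + c')) * x (c + c') =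
              ∑ e ∈ s, if level S x (X e) = c + c' ∧ b / n * n + col (b / n) e = b ∧
                level S x (a b) = c then x (c + c') else 0 := by
            intro c' hc'
            rw [mem_range] at hc'
            rw [state_demand hi hc', state_demand hi hc', hdiv, layer_div hb, h.demand_succ hi hb,
              Nat.add_sub_cancel_left, sum_mul]
            simp only [ite_mul, one_mul, zero_mul]
          rw [sum_congr rfl this, sum_comm]
          refine sum_congr rfl fun e he => ?_
          split_ifs with hh
          · have hle := hbin e he hh.2.1
            rw [sum_eq_single (level S x (X e) - c)]
            · rw [Nat.add_sub_cancel' hle, if_pos ⟨rfl, hh.2⟩]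
            · intro c' _ hne
              exact if_neg fun hh' => hne (by omega)
            · intro hn
              rw [mem_range] at hn
              omega
          · refine sum_eq_zero fun c' hc' => if_neg fun hh' => hh ⟨?_, hh'.2⟩
            rw [mem_range] at hc'
            omega
        have hmass : (∑ e ∈ s, if level S x (X e) < c + w ∧ b / n * n + col (b / n) e = b ∧
              level S x (a b) = c then x (level S x (X e)) else 0) ≤ a b := by
          have hn : 0 < n := Nat.pos_of_ne_zero fun h0 => by simp [h0] at hb'
          have h1 := h.sum_le _ hi (b % n) (Nat.mod_lt _ hn)
          rw [Nat.div_add_mod'] at h1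
          refine le_trans (sum_le_sum fun e he => ?_) h1
          have h2 := h.size_le he
          split_ifs with h3 h4
          · exact h2
          · refine absurd ?_ h4
            have h5 := layer_mod (s := b / n) (h.col_lt _ hi e he)
            rw [h3.2.1] at h5
            exact h5.symm
          · exact Nat.zero_le _
          · exact le_rfl
        have h1 := h.packed_add_used_le hi (c * (m * n + 1) + b)
        have h2 := h.packed_add_used_le hi (c * (m * n + 1) + b + 1)
        rw [hdiv] at h2
        rw [layer_div hb] at h1
        have h3 := h.packed_succ hi (c := c) hb (c + w)
        have h4 := opened_succ (S := S) (x := x) (a := a) hi (c := c) hb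
        rw [if_pos ⟨hb', rfl, hact⟩] at h4
        rw [hsum, state_pool hi, state_pool hi, pool, pool, hdiv, layer_div hb]
        refine ⟨?_, ?_, by omega, by omega⟩
        · intro d hd hne
          rcases lt_or_ge d (m * w) with h5 | h5
          · have h6 := hdem (d / w) (Nat.div_lt_of_lt_mul (by rwa [mul_comm])) (d % w)
              (Nat.mod_lt _ h.w_pos) fun hh => hne.1 hh.1.symm
            rwa [Nat.div_add_mod'] at h6
          · rcases lt_or_ge d (m * w + m) with h6 | h6
            · have h7 := hpool (d - m * w) (by omega) fun hh => hne.2 (by omega)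
              rwa [Nat.add_sub_cancel' h5] at h7
            · exact hrest d h6
        · intro c' hc'
          rw [state_demand hi hc', state_demand hi hc', hdiv, layer_div hb, h.demand_succ hi hb]
          exact Nat.le_add_right _ _
      · intro d hd
        rcases lt_or_ge d (m * w) with h5 | h5
        · have h6 := hdem (d / w) (Nat.div_lt_of_lt_mul (by rwa [mul_comm])) (d % w)
            (Nat.mod_lt _ h.w_pos) fun hh => hact hh.2
          rwa [Nat.div_add_mod'] at h6
        · rcases lt_or_ge d (m * w + m) with h6 | h6
          · have h7 := hpool (d - m * w) (by omega) fun hh => hact hh.2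
            rwa [Nat.add_sub_cancel' h5] at h7
          · exact hrest d h6
    · have hne : ∀ i < m, ∀ e ∈ s, ¬ i * n + col i e = m * n := fun i hi e he =>
        (h.bin_lt hi he).ne
      have hdiv : (c * (m * n + 1) + m * n + 1) / (m * n + 1) = c + 1 := by
        rw [show c * (m * n + 1) + m * n + 1 = (c + 1) * (m * n + 1) + 0 by ring,
          layer_div (by omega)]
      have hdem : ∀ i < m, ∀ t, demand m n S x a s X col i (c * (m * n + 1) + m * n + 1) t =
          demand m n S x a s X col i (c * (m * n + 1) + m * n) t := by
        intro i hi t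
        rw [h.demand_succ hi hb, sum_eq_zero, add_zero]
        exact fun e he => if_neg fun hh => hne i hi e he hh.2.1
      rw [Step, if_neg (lt_irrefl _)]
      have hnum : state m n w S x a s X col (c * (m * n + 1) + m * n + 1) (m * w + m) =
          num w S x s X (c + w) := by
        rw [state_num, hdiv, if_neg (by omega), Nat.add_sub_cancel]
      refine ⟨?_, fun i hi => ⟨?_, fun c' hc' => ?_, ?_, ?_⟩⟩
      · rw [hnum, state_cost, state_cost, hdiv, layer_div hb, sum_range_succ]
      · have h0 := state_demand (n := n) (S := S) (x := x) (a := a) (s := s) (X := X) (col := col)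
          hi h.w_pos (c * (m * n + 1) + m * n)
        rw [add_zero] at h0
        rw [h0, layer_div hb]
        -- An entry of level c is served before the end of clock c, and not in its last transition,
        -- which is at no bin.
        refine sum_eq_zero fun e he => if_neg fun hh => ?_
        have h1 := h.served_lt hi he
        have h2 := h.served_eq_iff hi he (c := c) hb
        have h3 := hne i hi e he
        rw [hh.1, add_zero, Nat.succ_mul] at h1
        exact h3 (h2.1 (by omega)).1
      · rw [state_demand hi (by omega), add_assoc (i * w), state_demand hi (by omega), hdiv,
          layer_div hb, hdem i hi]
        congr 1
        omega
      · rw [hnum, state_demand hi (by have := h.w_pos; omega), hdiv, num]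
        refine le_add_right (sum_le_sum fun e _ => ?_)
        have := h.w_pos
        split_ifs <;> omega
      · rw [hnum, state_demand hi (by have := h.w_pos; omega), hdiv, state_pool hi, state_pool hi,
          pool, pool, hdiv, layer_div hb]
        have hopen := opened_succ (S := S) (x := x) (a := a) hi (c := c) hb
        rw [if_neg fun hh => lt_irrefl _ hh.1, add_zero] at hopen
        rw [show c + 1 + w = c + w + 1 by ring, hopen, h.packed_succ hi hb,
          sum_eq_zero fun e he => if_neg fun hh => hne i hi e he hh.2.1, add_zero, used_succ,
          show c + 1 + (w - 1) = c + w by have := h.w_pos; omega]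
        have hsplit : packed m n S x a s X col i (c * (m * n + 1) + m * n) (c + w + 1) =
            packed m n S x a s X col i (c * (m * n + 1) + m * n) (c + w) +
            (∑ e ∈ s, if level S x (X e) = c + w ∧
              served m n S x a col i e < c * (m * n + 1) + m * n then 1 else 0) * x (c + w) := by
          rw [packed, packed, sum_mul, ← sum_add_distrib]
          refine sum_congr rfl fun e _ => ?_
          by_cases h1 : served m n S x a col i e < c * (m * n + 1) + m * n
          · rcases lt_trichotomy (level S x (X e)) (c + w) with h2 | h2 | h2
            · simp [h1, h2, h2.ne, h2.trans (Nat.lt_succ_self _)]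
            · simp [h1, h2]
            · simp [h1, h2.not_gt, h2.ne', (Nat.not_lt.2 (Nat.succ_le_of_lt h2) : ¬ _ < c + w + 1)]
          · simp [h1]
        -- What is poured: the new entries whose bins are already open, and those formed of excess
        -- mass.
        have hcount : num w S x s X (c + w) -
            demand m n S x a s X col i (c * (m * n + 1) + m * n + 1) (c + w) =
            (∑ e ∈ s, if level S x (X e) = c + w ∧
              served m n S x a col i e < c * (m * n + 1) + m * n then 1 else 0) +
            extra w S x s X (c + w) := by
          have : (∑ e ∈ s, if level S x (X e) = c + w then 1 else 0) =
              (∑ e ∈ s, if level S x (X e) = c + w ∧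
              served m n S x a col i e < c * (m * n + 1) + m * n then 1 else 0) +
              demand m n S x a s X col i (c * (m * n + 1) + m * n) (c + w) := by
            rw [demand, ← sum_add_distrib]
            refine sum_congr rfl fun e _ => ?_
            by_cases h1 : level S x (X e) = c + w
            · simp only [h1, true_and]
              split_ifs <;> omega
            · simp [h1]
          rw [num, this, hdem i hi]
          omega
        have hle := h.packed_add_used_le hi (c * (m * n + 1) + m * n + 1)
        rw [hdiv, hopen, show c + 1 + w = c + w + 1 by ring, h.packed_succ hi hb,
          sum_eq_zero fun e he => if_neg fun hh => hne i hi e he hh.2.1, add_zero, used_succ] at hle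
        rw [hcount, add_mul]
        omega
  final d hd := by
    have hi : d / w < m := Nat.div_lt_of_lt_mul (by rwa [mul_comm])
    rw [state, if_pos hd]
    refine sum_eq_zero fun e he => if_neg fun hh => ?_
    have h1 := h.served_lt hi he
    have h2 : (level S x (X e) + 1) * (m * n + 1) ≤ S * (m * n + 1) :=
      Nat.mul_le_mul_right _ (h.level_lt he)
    omega

end Profile

end MinEntropyCoupling

/-! ### Bounds on the chain of a coupling -/

namespace MinEntropyCoupling

open Finset

namespace Profile

variable {E : Type*} {m n w S U : ℕ} {x a : ℕ → ℕ} {s : Finset E} {X : E → ℕ} {col : ℕ → E → ℕ}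

theorem sum_extra (N : ℕ) : ∑ t ∈ range N, extra w S x s X t * x t = used w S x s X N := by
  induction N with
  | zero => rfl
  | succ N ih => rw [sum_range_succ, ih, used_succ]

theorem avail_le (t : ℕ) : avail w S x s X t ≤ ∑ e ∈ s, crumb S x X e := by
  refine sum_le_sum fun e _ => ?_
  split_ifs
  · exact le_rfl
  · exact Nat.zero_le _

theorem demand_le_num (i ℓ t : ℕ) : demand m n S x a s X col i ℓ t ≤ num w S x s X t := by
  refine le_add_right (sum_le_sum fun e _ => ?_)
  split_ifs <;> omega

theorem opened_le (i ℓ : ℕ) : opened m n S x a i ℓ ≤ ∑ j ∈ range n, a (i * n + j) := by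
  refine sum_le_sum fun e _ => ?_
  split_ifs <;> omega

variable (h : Profile m n w S U x a s X col)
include h

theorem sum_size_add_crumb :
    ∑ e ∈ s, x (level S x (X e)) + ∑ e ∈ s, crumb S x X e = ∑ e ∈ s, X e := by
  rw [← sum_add_distrib]
  exact sum_congr rfl fun e he => h.size_add_crumb he

theorem sum_num_le (N : ℕ) : ∑ t ∈ range N, num w S x s X t * x t ≤ U := by
  refine le_trans ?_ h.total_le
  rw [← h.sum_size_add_crumb]
  simp only [num, add_mul, sum_add_distrib]
  rw [sum_extra]
  refine add_le_add ?_ ((used_le N).trans (avail_le _))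
  simp only [sum_mul]
  rw [sum_comm]
  refine sum_le_sum fun e _ => ?_
  simp only [ite_mul, one_mul, zero_mul]
  rw [sum_ite_eq]
  split_ifs
  · exact le_rfl
  · exact Nat.zero_le _

theorem num_le (t : ℕ) : num w S x s X t * x t ≤ U :=
  (single_le_sum (f := fun t => num w S x s X t * x t) (fun _ _ => Nat.zero_le _)
    (mem_range.2 (Nat.lt_succ_self t))).trans (h.sum_num_le (t + 1))

theorem pool_le {i : ℕ} (hi : i < m) (ℓ : ℕ) : pool m n w S x a s X col i ℓ ≤ U := by
  have h1 := (opened_le (m := m) (S := S) (x := x) i ℓ).trans (h.row_le i hi)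
  rw [pool]
  omega

theorem cost_le {r : ℕ} (hr : r ≤ S) :
    ∑ t ∈ range r, num w S x s X (t + w) * (x (t + w) * t) ≤ U * S := by
  have h1 := h.sum_num_le (w + r)
  rw [sum_range_add] at h1
  calc _ ≤ ∑ t ∈ range r, num w S x s X (w + t) * x (w + t) * S := by
        refine sum_le_sum fun t ht => ?_
        rw [mem_range] at ht
        rw [add_comm t w, ← mul_assoc]
        exact Nat.mul_le_mul_left _ (by omega)
    _ ≤ _ := by
        rw [← sum_mul]
        exact Nat.mul_le_mul_right _ (by omega)

/-- The demanded entries have total mass at most U, and no size in the window is less than x (S +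
w). -/
theorem state_demand_le {ℓ d : ℕ} (hℓ : ℓ ≤ S * (m * n + 1)) (hd : d < m * w) :
    state m n w S x a s X col ℓ d * x (S + w) ≤ U := by
  rw [state, if_pos hd]
  have h1 : ℓ / (m * n + 1) ≤ S := by
    rw [Nat.div_le_iff_le_mul_add_pred (by omega), mul_comm]
    omega
  have h2 := Nat.mod_lt d h.w_pos
  exact (Nat.mul_le_mul (demand_le_num _ _ _) (h.anti (by omega))).trans (h.num_le _)

theorem state_le {ℓ : ℕ} (hℓ : ℓ ≤ S * (m * n + 1)) (d : ℕ) :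
    state m n w S x a s X col ℓ d ≤ U * S := by
  have h1 : ℓ / (m * n + 1) ≤ S := by
    rw [Nat.div_le_iff_le_mul_add_pred (by omega), mul_comm]
    omega
  have h2 : U ≤ U * S := Nat.le_mul_of_pos_right _ h.S_pos
  have h3 : ∀ t, num w S x s X t ≤ U * S := fun t =>
    (Nat.le_mul_of_pos_right _ (h.pos t)).trans ((h.num_le t).trans h2)
  rw [state]
  split_ifs with h4 h5 h6
  · exact (demand_le_num _ _ _).trans (h3 _)
  · exact (h.pool_le (by omega) ℓ).trans h2
  · exact Nat.zero_le _
  · exact h3 _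
  · exact h.cost_le h1

/-- At the end all sizes have been packed, and all excess has been used but for less than one entry
of the smallest size. -/
theorem state_final {i : ℕ} (hi : i < m) :
    state m n w S x a s X col (S * (m * n + 1)) (m * w + i) + ∑ e ∈ s, X e ≤
      U + x (S + w - 1) := by
  have hS := h.S_pos
  have h1 := h.packed_add_used_le hi (S * (m * n + 1))
  have h2 := (opened_le (m := m) (S := S) (x := x) i (S * (m * n + 1))).trans (h.row_le i hi)
  have h3 : packed m n S x a s X col i (S * (m * n + 1)) (S + w) =
      ∑ e ∈ s, x (level S x (X e)) := by
    refine sum_congr rfl fun e he => if_pos ⟨?_, ?_⟩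
    · exact (h.served_lt hi he).trans_le (Nat.mul_le_mul_right _ (h.level_lt he))
    · have := h.level_lt he
      omega
  have h4 : avail w S x s X (S + w - 1) = ∑ e ∈ s, crumb S x X e := by
    refine sum_congr rfl fun e he => if_pos ?_
    have := h.level_lt he
    omega
  have h5 := avail_lt (w := w) (S := S) (s := s) (X := X) (S + w - 1) (h.pos _)
  have h6 := h.sum_size_add_crumb
  rw [Nat.mul_div_cancel _ (Nat.succ_pos _)] at h1
  rw [show S + w - 1 + 1 = S + w by omega] at h5
  rw [state_pool hi, pool, Nat.mul_div_cancel _ (Nat.succ_pos _)]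
  omega

/-- By the choice of its level, an entry is smaller than the next larger size, which is at most (1 +
1 / K) times its own size. -/
theorem mul_sum_crumb_le {K : ℕ} (hK : ∀ t, K * x t ≤ (K + 1) * x (t + 1)) :
    K * ∑ e ∈ s, crumb S x X e ≤ U := by
  refine le_trans ?_ h.total_le
  rw [mul_sum]
  refine sum_le_sum fun e he => ?_
  have h1 := h.level_lt he
  have h2 := h.le_level (h.entry_le he) h1
  have h3 : X e < x (level S x (X e) - 1) :=
    (lt_level_iff (S := S) h.anti (by omega)).1 (by have := h.w_pos; omega)
  have h4 := hK (level S x (X e) - 1)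
  rw [show level S x (X e) - 1 + 1 = level S x (X e) by have := h.w_pos; omega] at h4
  have h5 := h.size_add_crumb he
  have h6 : K * X e ≤ K * x (level S x (X e) - 1) := Nat.mul_le_mul_left _ h3.le
  have h7 := h.size_le he
  have h8 : K * X e = K * x (level S x (X e)) + K * crumb S x X e := by rw [← h5, mul_add, h5]
  rw [Nat.succ_mul] at h4
  omega

omit h in
-- Summation by parts, used to compare the cost of the extra entries with the times at which excess
-- becomes available.
theorem sum_extra_mul (r : ℕ) :
    ∑ t ∈ range r, extra w S x s X (t + w) * (x (t + w) * t) +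
      ∑ t ∈ range r, used w S x s X (t + w + 1) = r * used w S x s X (r + w) := by
  induction r with
  | zero => simp
  | succ r ih =>
    rw [sum_range_succ, sum_range_succ, show r + 1 + w = r + w + 1 by ring]
    have h1 := used_succ (w := w) (S := S) (x := x) (s := s) (X := X) (r + w)
    have h2 : (r + 1) * used w S x s X (r + w + 1) = r * used w S x s X (r + w) +
        extra w S x s X (r + w) * (x (r + w) * r) + used w S x s X (r + w + 1) := by
      rw [Nat.succ_mul, h1]
      ring
    omega

theorem sum_avail :
    ∑ t ∈ range S, avail w S x s X (t + w) + ∑ e ∈ s, crumb S x X e * level S x (X e) =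
      S * ∑ e ∈ s, crumb S x X e := by
  simp only [avail]
  rw [sum_comm, ← sum_add_distrib, mul_sum]
  refine sum_congr rfl fun e he => ?_
  have h1 := h.level_lt he
  rw [← sum_filter, sum_const, smul_eq_mul]
  have : (range S).filter (fun t => level S x (X e) + w ≤ t + w) = Ico (level S x (X e)) S := by
    ext t
    simp only [mem_filter, mem_range, mem_Ico]
    omega
  rw [this, Nat.card_Ico, mul_comm _ (level S x (X e)), ← add_mul]
  congr 1
  omega

/-- If excess were used as soon as it is available, each crumb would be charged its level. Waiting
costs less than x t at each index t, and nothing before 2 * w, since all levels are at least w. -/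
theorem sum_extra_mul_le :
    ∑ t ∈ range S, extra w S x s X (t + w) * (x (t + w) * t) ≤
      ∑ e ∈ s, crumb S x X e * level S x (X e) + ∑ t ∈ Ico (2 * w) (S + w), x t := by
  have h1 := sum_extra_mul (w := w) (S := S) (x := x) (s := s) (X := X) S
  have h2 := h.sum_avail
  have h3 : S * used w S x s X (S + w) ≤ S * ∑ e ∈ s, crumb S x X e :=
    Nat.mul_le_mul_left _ ((used_le _).trans (avail_le _))
  have h4 : ∑ t ∈ range S, avail w S x s X (t + w) ≤
      ∑ t ∈ range S, used w S x s X (t + w + 1) + ∑ t ∈ Ico (2 * w) (S + w), x t := by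
    have h5 : ∑ t ∈ range S, (if w ≤ t then x (t + w) else 0) = ∑ t ∈ Ico (2 * w) (S + w), x t := by
      rw [← sum_filter]
      refine sum_bij (fun t _ => t + w) ?_ ?_ ?_ ?_
      · intro t ht
        rw [mem_filter, mem_range] at ht
        rw [mem_Ico]
        omega
      · intro t _ t' _ heq
        omega
      · intro t ht
        rw [mem_Ico] at ht
        exact ⟨t - w, by rw [mem_filter, mem_range]; omega, by omega⟩
      · intros
        rfl
    rw [← h5, ← sum_add_distrib]
    refine sum_le_sum fun t _ => ?_
    split_ifs with h6
    · exact (avail_lt _ (h.pos _)).le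
    · rw [avail, sum_eq_zero]
      · exact Nat.zero_le _
      · refine fun e he => if_neg fun hh => h6 ?_
        have := h.le_level (h.entry_le he) (h.level_lt he)
        omega
  omega

/-- An entry is charged its level minus w, but its crumb, reused w indices later, is charged its
full level. The difference and the waiting cost are the error terms. -/
theorem state_cost_le :
    state m n w S x a s X col (S * (m * n + 1)) (m * w + m + 1) ≤
      ∑ e ∈ s, X e * (level S x (X e) - w) + w * ∑ e ∈ s, crumb S x X e +
        ∑ t ∈ Ico (2 * w) (S + w), x t := by
  have h1 : ∑ t ∈ range S, (∑ e ∈ s, if level S x (X e) = t + w then 1 else 0) *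
      (x (t + w) * t) = ∑ e ∈ s, x (level S x (X e)) * (level S x (X e) - w) := by
    simp only [sum_mul, ite_mul, one_mul, zero_mul]
    rw [sum_comm]
    refine sum_congr rfl fun e he => ?_
    have h2 := h.level_lt he
    have h3 := h.le_level (h.entry_le he) h2
    rw [sum_eq_single (level S x (X e) - w)]
    · rw [Nat.sub_add_cancel h3, if_pos rfl]
    · intro t _ hne
      exact if_neg fun hh => hne (by omega)
    · intro hn
      rw [mem_range] at hn
      omega
  have h4 : ∑ e ∈ s, x (level S x (X e)) * (level S x (X e) - w) +
      ∑ e ∈ s, crumb S x X e * level S x (X e) =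
      ∑ e ∈ s, X e * (level S x (X e) - w) + w * ∑ e ∈ s, crumb S x X e := by
    rw [mul_sum, ← sum_add_distrib, ← sum_add_distrib]
    refine sum_congr rfl fun e he => ?_
    obtain ⟨k, hk⟩ := Nat.exists_eq_add_of_le (h.le_level (h.entry_le he) (h.level_lt he))
    have h5 := h.size_add_crumb he
    rw [hk, Nat.add_sub_cancel_left]
    rw [hk] at h5
    nlinarith
  have h6 := h.sum_extra_mul_le
  rw [state_cost, Nat.mul_div_cancel _ (Nat.succ_pos _)]
  simp only [num, add_mul, sum_add_distrib]
  omega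

end Profile

end MinEntropyCoupling

/-! ### The sizes -/

namespace MinEntropyCoupling

open Finset

/-- The number of sizes that a bin packs. -/
def width (g : ℕ) : ℕ := 4 ^ g * g

def layers (g σ : ℕ) : ℕ := 4 ^ g * σ

/-- The sizes that occur have smaller indices than this. Up to here the ratio is exact with integer
sizes; beyond, `size` is constant. -/
def horizon (g σ : ℕ) : ℕ := layers g σ + width g

/-- The sizes of the entries; consecutive ones have the ratio `4 ^ g / (4 ^ g + 1)`. -/
def size (g σ t : ℕ) : ℕ := (4 ^ g + 1) ^ (horizon g σ - t) * (4 ^ g) ^ (min t (horizon g σ))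

/-- The mass that corresponds to probability one. -/
def total (g σ : ℕ) : ℕ := size g σ (width g)

section

variable {g σ : ℕ}

theorem size_pos (t : ℕ) : 0 < size g σ t := by unfold size; positivity

theorem total_pos : 0 < total g σ := size_pos _

theorem size_succ {t : ℕ} (ht : t < horizon g σ) :
    4 ^ g * size g σ t = (4 ^ g + 1) * size g σ (t + 1) := by
  rw [size, size, min_eq_left ht.le, min_eq_left ht,
    show horizon g σ - t = horizon g σ - (t + 1) + 1 by omega]
  ring

theorem size_of_le {t : ℕ} (ht : horizon g σ ≤ t) : size g σ t = size g σ (horizon g σ) := by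
  rw [size, size, min_eq_right ht, min_self, Nat.sub_self, Nat.sub_eq_zero_of_le ht]

theorem size_succ_lt {t : ℕ} (ht : t < horizon g σ) : size g σ (t + 1) < size g σ t := by
  have h1 := size_succ ht
  have h2 := size_pos (g := g) (σ := σ) (t + 1)
  have h3 : 0 < 4 ^ g := by positivity
  rw [Nat.succ_mul] at h1
  exact lt_of_mul_lt_mul_left (by omega : 4 ^ g * size g σ (t + 1) < 4 ^ g * size g σ t)
    (Nat.zero_le _)

theorem size_anti : Antitone (size g σ) := by
  refine antitone_nat_of_succ_le fun t => ?_
  rcases lt_or_ge t (horizon g σ) with h | h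
  · exact (size_succ_lt h).le
  · rw [size_of_le h, size_of_le (h.trans (Nat.le_succ _))]

theorem mul_size_le (t : ℕ) : 4 ^ g * size g σ t ≤ (4 ^ g + 1) * size g σ (t + 1) := by
  rcases lt_or_ge t (horizon g σ) with h | h
  · exact (size_succ h).le
  · rw [size_of_le h, size_of_le (h.trans (Nat.le_succ _))]
    exact Nat.mul_le_mul_right _ (Nat.le_succ _)

theorem size_lt {t t' : ℕ} (h : t < t') (ht' : t' ≤ horizon g σ) : size g σ t' < size g σ t :=
  (size_anti h).trans_lt (size_succ_lt (h.trans_le ht'))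

theorem size_add {t j : ℕ} (h : t + j ≤ horizon g σ) :
    (4 ^ g) ^ j * size g σ t = (4 ^ g + 1) ^ j * size g σ (t + j) := by
  induction j with
  | zero => simp
  | succ j ih =>
    have h1 := size_succ (g := g) (σ := σ) (t := t + j) (by omega)
    rw [pow_succ, mul_comm _ (4 ^ g), mul_assoc, ih (by omega), mul_left_comm, h1, ← add_assoc]
    ring

/-- Bernoulli's inequality; it says that K levels at least halve the size. -/
theorem two_mul_pow_le {K : ℕ} (hK : 0 < K) : 2 * K ^ K ≤ (K + 1) ^ K := by
  have hK' : (0 : ℝ) < K := by exact_mod_cast hK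
  have h1 := one_add_mul_le_pow (a := (1 / K : ℝ)) (by linarith [one_div_pos.2 hK']) K
  rw [mul_one_div_cancel hK'.ne'] at h1
  have h2 : 2 * (K : ℝ) ^ K ≤ ((K : ℝ) + 1) ^ K := by
    have h3 : (K : ℝ) + 1 = (1 + 1 / K) * K := by field_simp
    rw [h3, mul_pow]
    exact mul_le_mul_of_nonneg_right (by linarith) (by positivity)
  exact_mod_cast h2

/-- (1 + 1 / K) ^ K ≤ e < 3: the sizes do not decrease too fast, which bounds the demands. -/
theorem pow_le_three_mul (K : ℕ) : (K + 1) ^ K ≤ 3 * K ^ K := by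
  rcases Nat.eq_zero_or_pos K with rfl | hK
  · norm_num
  have hK' : (0 : ℝ) < K := by exact_mod_cast hK
  have h1 : ((1 / K : ℝ) + 1) ^ K ≤ Real.exp 1 := by
    calc ((1 / K : ℝ) + 1) ^ K ≤ Real.exp (1 / K) ^ K :=
          pow_le_pow_left₀ (by positivity) (Real.add_one_le_exp _) _
      _ = Real.exp 1 := by rw [← Real.exp_nat_mul, mul_one_div_cancel hK'.ne']
  have h2 : ((K : ℝ) + 1) ^ K ≤ 3 * (K : ℝ) ^ K := by
    have h3 : (K : ℝ) + 1 = (1 / K + 1) * K := by field_simp; ring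
    rw [h3, mul_pow]
    refine mul_le_mul_of_nonneg_right (h1.trans ?_) (by positivity)
    exact (Real.exp_one_lt_d9.le).trans (by norm_num)
  exact_mod_cast h2

theorem two_pow_mul_size_le {t j : ℕ} (h : t + 4 ^ g * j ≤ horizon g σ) :
    2 ^ j * size g σ (t + 4 ^ g * j) ≤ size g σ t := by
  have h1 := size_add h
  have h2 : 2 ^ j * (4 ^ g) ^ (4 ^ g * j) ≤ (4 ^ g + 1) ^ (4 ^ g * j) := by
    rw [pow_mul, pow_mul, ← mul_pow]
    exact Nat.pow_le_pow_left (two_mul_pow_le (by positivity)) _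
  have h3 : 0 < (4 ^ g) ^ (4 ^ g * j) := by positivity
  refine le_of_mul_le_mul_left ?_ h3
  rw [h1, ← mul_assoc]
  refine Nat.mul_le_mul_right _ ?_
  linarith

theorem size_le_three_pow {t j : ℕ} (h : t + 4 ^ g * j ≤ horizon g σ) :
    size g σ t ≤ 3 ^ j * size g σ (t + 4 ^ g * j) := by
  have h1 := size_add h
  have h2 : (4 ^ g + 1) ^ (4 ^ g * j) ≤ 3 ^ j * (4 ^ g) ^ (4 ^ g * j) := by
    rw [pow_mul, pow_mul, ← mul_pow]
    exact Nat.pow_le_pow_left (pow_le_three_mul _) _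
  have h3 : 0 < (4 ^ g) ^ (4 ^ g * j) := by positivity
  refine le_of_mul_le_mul_left ?_ h3
  rw [h1, ← mul_assoc]
  refine Nat.mul_le_mul_right _ ?_
  linarith

theorem two_pow_mul_size_width_le {t : ℕ} (ht : t ∈ Ico (width g) (width g + layers g σ)) :
    2 ^ g * size g σ t ≤ size g σ (t - width g) := by
  rw [mem_Ico] at ht
  have h := two_pow_mul_size_le (g := g) (σ := σ) (t := t - width g) (j := g) (by
    rw [← width, horizon]
    omega)
  rwa [← width, Nat.sub_add_cancel ht.1] at h

theorem total_le : total g σ ≤ 3 ^ σ * size g σ (horizon g σ) := by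
  have h := size_le_three_pow (g := g) (σ := σ) (t := width g) (j := σ) (by
    rw [← layers, horizon, add_comm])
  rwa [← layers, add_comm, ← horizon] at h

theorem size_layers_le (hσ : g ≤ σ) (hg : 0 < g) :
    2 ^ (σ - g) * size g σ (layers g σ - 1) ≤ 2 * total g σ := by
  have hS : 0 < layers g σ := Nat.mul_pos (by positivity) (by omega)
  have hw : width g ≤ layers g σ := Nat.mul_le_mul_left _ hσ
  have h1 := mul_size_le (g := g) (σ := σ) (layers g σ - 1)
  rw [Nat.sub_add_cancel hS] at h1
  have h2 := two_pow_mul_size_le (g := g) (σ := σ) (t := width g) (j := σ - g) (by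
    rw [Nat.mul_sub, ← layers, ← width, horizon]
    omega)
  rw [Nat.mul_sub, ← layers, ← width, Nat.add_sub_cancel' hw] at h2
  have h3 : 0 < 4 ^ g := by positivity
  have h4 : size g σ (layers g σ - 1) ≤ 2 * size g σ (layers g σ) := by
    refine le_of_mul_le_mul_left (h1.trans ?_) h3
    nlinarith [Nat.zero_le (size g σ (layers g σ))]
  calc _ ≤ 2 ^ (σ - g) * (2 * size g σ (layers g σ)) := Nat.mul_le_mul_left _ h4
    _ = 2 * (2 ^ (σ - g) * size g σ (layers g σ)) := by ring
    _ ≤ _ := Nat.mul_le_mul_left _ h2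

theorem total_mul_lt : total g σ * layers g σ < 2 ^ ((2 * g + 2) * horizon g σ) := by
  have h1 : total g σ ≤ 2 ^ ((2 * g + 1) * horizon g σ) := by
    have hle : 4 ^ g + 1 ≤ 2 ^ (2 * g + 1) := by
      rw [pow_succ, pow_mul]
      have : 0 < 4 ^ g := by positivity
      norm_num
    rw [total, size, pow_mul]
    calc _ ≤ (2 ^ (2 * g + 1)) ^ (horizon g σ - width g) *
          (2 ^ (2 * g + 1)) ^ (min (width g) (horizon g σ)) :=
          Nat.mul_le_mul (Nat.pow_le_pow_left hle _)
            (Nat.pow_le_pow_left ((Nat.le_succ _).trans hle) _)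
      _ = _ := by
          rw [← pow_add]
          congr 1
          rw [horizon]
          omega
  calc total g σ * layers g σ < 2 ^ ((2 * g + 1) * horizon g σ) * 2 ^ horizon g σ :=
        Nat.mul_lt_mul_of_le_of_lt h1 (Nat.lt_two_pow_self.trans_le
          (Nat.pow_le_pow_right two_pos (Nat.le_add_right _ _))) (by positivity)
    _ = _ := by rw [← pow_add]; congr 1; ring

/-- A telescoping sum: size t is (4 ^ g + 1) times the difference of the sizes at t and t + 1. -/
theorem sum_size_le {t : ℕ} (ht : t ≤ horizon g σ) :
    ∑ u ∈ Ico t (horizon g σ), size g σ u ≤ (4 ^ g + 1) * size g σ t := by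
  have h : ∑ u ∈ Ico t (horizon g σ), size g σ u + (4 ^ g + 1) * size g σ (horizon g σ) ≤
      (4 ^ g + 1) * size g σ t := by
    induction ht using Nat.decreasingInduction with
    | self => simp
    | of_succ t ht ih =>
      rw [sum_eq_sum_Ico_succ_bot ht]
      have := size_succ ht
      rw [Nat.succ_mul (4 ^ g) (size g σ t)]
      omega
  omega

end

/-- The cost of one more level. -/
noncomputable def levelCost (g : ℕ) : ℝ := Real.logb 2 (1 + 1 / 4 ^ g)

theorem levelCost_nonneg (g : ℕ) : 0 ≤ levelCost g :=
  Real.logb_nonneg one_lt_two (by have : (0 : ℝ) < 1 / 4 ^ g := by positivity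
                                  linarith)

theorem levelCost_le (g : ℕ) : levelCost g ≤ 2 / 4 ^ g := by
  have h1 := Real.log_two_gt_d9
  have h0 : (0 : ℝ) < 1 / 4 ^ g := by positivity
  have h2 := Real.log_le_sub_one_of_pos (by linarith : (0 : ℝ) < 1 + 1 / 4 ^ g)
  rw [levelCost, Real.logb, div_le_iff₀ (by linarith)]
  have : (2 : ℝ) / 4 ^ g = 2 * (1 / 4 ^ g) := by ring
  rw [this]
  nlinarith

/-- Since the sizes are geometric, the information content of an entry is a multiple of `levelCost`,
so that chains can measure cost by an integer. -/
theorem logb_total_div {g σ t : ℕ} (ht : width g ≤ t) (ht' : t ≤ horizon g σ) :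
    Real.logb 2 (total g σ / size g σ t) = (t - width g : ℕ) * levelCost g := by
  have h1 := size_add (g := g) (σ := σ) (t := width g) (j := t - width g) (by omega)
  rw [Nat.add_sub_cancel' ht] at h1
  have h2 : ((4 : ℝ) ^ g) ^ (t - width g) * total g σ =
      (4 ^ g + 1) ^ (t - width g) * size g σ t := by
    exact_mod_cast h1
  have h3 : (0 : ℝ) < size g σ t := by exact_mod_cast size_pos t
  have h4 : (total g σ : ℝ) / size g σ t = (1 + 1 / 4 ^ g) ^ (t - width g) := by
    rw [div_eq_iff h3.ne', show (1 + 1 / 4 ^ g : ℝ) = (4 ^ g + 1) / 4 ^ g by field_simp; try ring,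
      div_pow, div_mul_eq_mul_div, eq_div_iff (by positivity), mul_comm, h2]
  rw [h4, ← Real.rpow_natCast, Real.logb_rpow_eq_mul_logb_of_pos (by positivity), levelCost]

/-- The masses of the states of the marginals. -/
noncomputable def mass (g σ : ℕ) (P : ℕ → ℝ) (b : ℕ) : ℕ := ⌊total g σ * P b⌋₊

/-! ### Rounding a coupling to a profile -/

section

variable {m n g σ : ℕ} {p : Fin m → Fin n → ℝ} {q : (Fin m → Fin n) → ℝ} {P : ℕ → ℝ}

theorem IsDistribution.le_one {ι : Type*} [Fintype ι] {q : ι → ℝ} (h : IsDistribution q) (e : ι) :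
    q e ≤ 1 := by
  rw [← h.2]
  exact single_le_sum (fun e _ => h.1 e) (mem_univ e)

theorem IsDistribution.logb_nonneg {ι : Type*} [Fintype ι] {q : ι → ℝ} (h : IsDistribution q)
    (e : ι) : 0 ≤ Real.logb 2 (1 / q e) := by
  rcases (h.1 e).eq_or_lt with h0 | h0
  · simp [← h0]
  · exact Real.logb_nonneg one_lt_two ((one_le_div h0).2 (h.le_one e))

theorem sum_floor_le {ι : Type*} (s : Finset ι) (f : ι → ℝ) (hf : ∀ e ∈ s, 0 ≤ f e) {y : ℝ}
    (hy : ∑ e ∈ s, f e ≤ y) : ∑ e ∈ s, ⌊f e⌋₊ ≤ ⌊y⌋₊ := by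
  refine Nat.le_floor ?_
  push_cast
  exact (sum_le_sum fun e he => Nat.floor_le (hf e he)).trans hy

noncomputable def entryMass (g σ : ℕ) (q : (Fin m → Fin n) → ℝ) (e : Fin m → Fin n) : ℕ :=
  ⌊total g σ * q e⌋₊

open Classical in
noncomputable def entries (g σ : ℕ) (q : (Fin m → Fin n) → ℝ) : Finset (Fin m → Fin n) :=
  univ.filter fun e => size g σ (layers g σ - 1) ≤ entryMass g σ q e

def column (i : ℕ) (e : Fin m → Fin n) : ℕ := if h : i < m then e ⟨i, h⟩ else 0

theorem profile (hp : ∀ i, IsDistribution (p i)) (hq : IsCoupling p q)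
    (hP : ∀ (i : Fin m) (j : Fin n), P (i * n + j) = p i j) (hg : 0 < g) (hσ : g ≤ σ) :
    Profile m n (width g) (layers g σ) (total g σ) (size g σ) (mass g σ P) (entries g σ q)
      (entryMass g σ q) column where
  pos := size_pos
  anti := size_anti
  w_pos := Nat.mul_pos (by positivity) hg
  S_pos := Nat.mul_pos (by positivity) (by omega)
  large t ht := size_lt ht (by rw [horizon]; omega)
  col_lt i hi e _ := by
    rw [column, dif_pos hi]
    exact (e _).2
  sum_le i hi j hj := by
    rw [← sum_filter]
    refine (sum_le_sum_of_subset (t := univ.filter fun e : Fin m → Fin n => e ⟨i, hi⟩ = ⟨j, hj⟩)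
      fun e he => ?_).trans (sum_floor_le _ _ (fun e _ => mul_nonneg (Nat.cast_nonneg _)
        (hq.1.1 e)) ?_)
    · rw [mem_filter, column, dif_pos hi] at he
      exact mem_filter.2 ⟨mem_univ _, Fin.ext he.2⟩
    · rw [← mul_sum, hq.2, ← hP]
  row_le i hi := by
    have := sum_floor_le (univ : Finset (Fin n)) (fun j => total g σ * P (i * n + j))
      (fun j _ => mul_nonneg (Nat.cast_nonneg _) (by
        rw [hP ⟨i, hi⟩ j]; exact (hp _).1 _)) (y := total g σ) (by
        rw [← mul_sum, sum_congr rfl fun j _ => hP ⟨i, hi⟩ j, (hp _).2, mul_one])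
    rw [Nat.floor_natCast] at this
    rwa [← Fin.sum_univ_eq_sum_range fun j => mass g σ P (i * n + j)]
  kept e he := (mem_filter.1 he).2
  total_le := by
    refine (sum_le_sum_of_subset (subset_univ _)).trans ?_
    have := sum_floor_le univ (fun e => total g σ * q e)
      (fun e _ => mul_nonneg (Nat.cast_nonneg _) (hq.1.1 e)) (y := total g σ)
      (by rw [← mul_sum, hq.1.2, mul_one])
    rwa [Nat.floor_natCast] at this

/-- Each of the n ^ m entries loses less than one unit to the floor, and less than the smallest kept
size if it is discarded. -/
theorem total_le_sum (hq : IsCoupling p q) :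
    total g σ ≤ ∑ e ∈ entries g σ q, entryMass g σ q e +
      n ^ m * (size g σ (layers g σ - 1) + 1) := by
  classical
  have h1 : (total g σ : ℝ) ≤ ∑ e, ((entryMass g σ q e + 1 : ℕ) : ℝ) := by
    calc (total g σ : ℝ) = ∑ e, total g σ * q e := by rw [← mul_sum, hq.1.2, mul_one]
      _ ≤ _ := sum_le_sum fun e _ => by
        push_cast
        exact (Nat.lt_floor_add_one _).le
  have h2 : total g σ ≤ ∑ e, (entryMass g σ q e + 1) := by exact_mod_cast h1
  refine h2.trans ?_
  have h3 : ∑ e ∈ entries g σ q, entryMass g σ q e =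
      ∑ e, if size g σ (layers g σ - 1) ≤ entryMass g σ q e then entryMass g σ q e else 0 := by
    rw [entries, sum_filter]
  have h4 : n ^ m * (size g σ (layers g σ - 1) + 1) =
      ∑ _e : Fin m → Fin n, (size g σ (layers g σ - 1) + 1) := by
    simp
  rw [h3, h4, ← sum_add_distrib]
  refine sum_le_sum fun e _ => ?_
  split_ifs <;> omega

/-- An entry is smaller than the size one level above its own, so the level exceeds what the
information content allows by at most one; this accounts for the additional `levelCost`. -/
theorem sum_level_le (hp : ∀ i, IsDistribution (p i)) (hq : IsCoupling p q)
    (hP : ∀ (i : Fin m) (j : Fin n), P (i * n + j) = p i j) (hg : 0 < g) (hσ : g ≤ σ) :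
    (∑ e ∈ entries g σ q, entryMass g σ q e *
      (level (layers g σ) (size g σ) (entryMass g σ q e) - width g) : ℕ) * levelCost g ≤
        total g σ * (entropy q + levelCost g) := by
  have h := profile hp hq hP hg hσ
  have hU : (0 : ℝ) < total g σ := by exact_mod_cast total_pos
  have hc := levelCost_nonneg g
  have key : ∀ e ∈ entries g σ q, (entryMass g σ q e : ℝ) *
      (level (layers g σ) (size g σ) (entryMass g σ q e) - width g : ℕ) * levelCost g ≤
      total g σ * (q e * Real.logb 2 (1 / q e)) + entryMass g σ q e * levelCost g := by
    intro e he
    set X := entryMass g σ q e with hX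
    have h1 := h.level_lt he
    have h2 := h.le_level (h.entry_le he) h1
    have h3 := h.w_pos
    rw [← hX] at h1 h2
    have hXq : (X : ℝ) ≤ total g σ * q e := Nat.floor_le (mul_nonneg hU.le (hq.1.1 e))
    have hlog : ((level (layers g σ) (size g σ) X - width g : ℕ) : ℝ) * levelCost g ≤
        Real.logb 2 (1 / q e) + levelCost g := by
      rcases h2.eq_or_lt with h4 | h4
      · rw [← h4, Nat.sub_self, Nat.cast_zero, zero_mul]
        exact add_nonneg (hq.1.logb_nonneg e) hc
      · have h5 : X < size g σ (level (layers g σ) (size g σ) X - 1) :=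
          (lt_level_iff (S := layers g σ) size_anti (by omega)).1 (by omega)
        have h6 : (total g σ : ℝ) * q e < size g σ (level (layers g σ) (size g σ) X - 1) := by
          refine (Nat.lt_floor_add_one _).trans_le ?_
          exact_mod_cast h5
        have h7 := logb_total_div (g := g) (σ := σ)
          (t := level (layers g σ) (size g σ) X - 1) (by omega) (by rw [horizon]; omega)
        have hqe : 0 < q e := by
          rcases (hq.1.1 e).eq_or_lt with h0 | h0
          · have h8 := h.kept e he
            have h9 := size_pos (g := g) (σ := σ) (layers g σ - 1)
            rw [← hX] at h8
            rw [← h0, mul_zero] at hXq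
            have : X = 0 := by exact_mod_cast le_antisymm hXq (Nat.cast_nonneg _)
            omega
          · exact h0
        have hx : (0 : ℝ) < size g σ (level (layers g σ) (size g σ) X - 1) := by
          exact_mod_cast size_pos _
        have h8 : Real.logb 2 (total g σ / size g σ (level (layers g σ) (size g σ) X - 1)) ≤
            Real.logb 2 (1 / q e) := by
          refine Real.logb_le_logb_of_le one_lt_two (by positivity) ?_
          rw [div_le_div_iff₀ hx hqe]
          linarith
        have h9 : level (layers g σ) (size g σ) X - width g =
            level (layers g σ) (size g σ) X - 1 - width g + 1 := by omega
        rw [h9]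
        push_cast
        linarith
    calc (X : ℝ) * (level (layers g σ) (size g σ) X - width g : ℕ) * levelCost g
        = X * ((level (layers g σ) (size g σ) X - width g : ℕ) * levelCost g) := by ring
      _ ≤ X * (Real.logb 2 (1 / q e) + levelCost g) :=
          mul_le_mul_of_nonneg_left hlog (Nat.cast_nonneg _)
      _ ≤ _ := by
          have := mul_le_mul_of_nonneg_right hXq (hq.1.logb_nonneg e)
          linarith
  push_cast
  rw [sum_mul]
  refine (sum_le_sum key).trans ?_
  rw [sum_add_distrib, ← mul_sum, ← sum_mul, mul_add]
  refine add_le_add (mul_le_mul_of_nonneg_left ?_ hU.le) (mul_le_mul_of_nonneg_right ?_ hc)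
  · exact sum_le_sum_of_subset_of_nonneg (subset_univ _) fun e _ _ =>
      mul_nonneg (hq.1.1 e) (hq.1.logb_nonneg e)
  · exact_mod_cast h.total_le

/-- A coupling has a chain whose cost is hardly larger than its entropy. -/
theorem exists_chain (hp : ∀ i, IsDistribution (p i)) (hq : IsCoupling p q)
    (hP : ∀ (i : Fin m) (j : Fin n), P (i * n + j) = p i j) (hg : 0 < g) (hσ : g ≤ σ)
    (hn : 0 < n) :
    ∃ δ, Chain m n (width g) (layers g σ) (size g σ) (mass g σ P) δ ∧
      (∀ ℓ ≤ layers g σ * (m * n + 1), ∀ d < m * width g, δ ℓ d < 2 ^ (2 * σ)) ∧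
      (∀ ℓ ≤ layers g σ * (m * n + 1), ∀ d, δ ℓ d < 2 ^ ((2 * g + 2) * horizon g σ)) ∧
      (∀ i < m, δ (layers g σ * (m * n + 1)) (m * width g + i) ≤
        3 * n ^ m * size g σ (layers g σ - 1)) ∧
      (δ (layers g σ * (m * n + 1)) (m * width g + m + 1) : ℝ) * levelCost g ≤
        total g σ * (entropy q + 8 / 2 ^ g) := by
  have h := profile hp hq hP hg hσ
  refine ⟨_, h.chain, fun ℓ hℓ d hd => ?_, fun ℓ hℓ d => (h.state_le hℓ d).trans_lt total_mul_lt,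
    fun i hi => ?_, ?_⟩
  · have h1 := (h.state_demand_le hℓ hd).trans total_le
    rw [← horizon] at h1
    -- A demand is at most 3 ^ σ, which is less than 4 ^ σ.
    refine (le_of_mul_le_mul_right h1 (size_pos _)).trans_lt ?_
    rw [pow_mul]
    exact Nat.pow_lt_pow_left (by norm_num) (by omega)
  -- The factor 3: discarded entries, floors, and the excess that does not fill a last entry.
  · have h1 := h.state_final hi
    have h2 := total_le_sum (g := g) (σ := σ) hq
    have h3 : size g σ (layers g σ + width g - 1) ≤ size g σ (layers g σ - 1) :=
      size_anti (by have := h.w_pos; omega)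
    have h4 := size_pos (g := g) (σ := σ) (layers g σ - 1)
    have h5 : 0 < n ^ m := by positivity
    have h6 : size g σ (layers g σ - 1) ≤ n ^ m * size g σ (layers g σ - 1) :=
      Nat.le_mul_of_pos_left _ h5
    have h7 : n ^ m ≤ n ^ m * size g σ (layers g σ - 1) := Nat.le_mul_of_pos_right _ h4
    rw [mul_add, mul_one] at h2
    rw [mul_assoc]
    omega
  · have hU : (0 : ℝ) < total g σ := by exact_mod_cast total_pos
    have hc := levelCost_nonneg g
    have hG : (0 : ℝ) < 2 ^ g := by positivity
    have h1 := h.state_cost_le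
    have h2 := h.mul_sum_crumb_le mul_size_le
    have h3 := sum_size_le (g := g) (σ := σ) (t := 2 * width g) (by
      rw [horizon]
      have : width g ≤ layers g σ := Nat.mul_le_mul_left _ hσ
      omega)
    have h4 := two_pow_mul_size_le (g := g) (σ := σ) (t := width g) (j := g) (by
      rw [← width, horizon]
      have : width g ≤ layers g σ := Nat.mul_le_mul_left _ hσ
      omega)
    rw [← width, ← two_mul, ← total] at h4
    have h5 := sum_level_le hp hq hP hg hσ
    -- The excess is at most total / 4 ^ g, so the delay by 4 ^ g * g levels contributes at most g *
    -- total.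
    have h6 : width g * ∑ e ∈ entries g σ q, Profile.crumb (layers g σ) (size g σ) (entryMass g σ q) e ≤
        g * total g σ := by
      rw [width, mul_comm (4 ^ g) g, mul_assoc]
      exact Nat.mul_le_mul_left _ h2
    have h7 : 2 ^ g * ∑ t ∈ Ico (2 * width g) (layers g σ + width g), size g σ t ≤
        (4 ^ g + 1) * total g σ := by
      refine (Nat.mul_le_mul_left _ h3).trans ?_
      rw [mul_left_comm]
      exact Nat.mul_le_mul_left _ h4
    rw [← Nat.cast_le (α := ℝ)] at h1 h6 h7
    push_cast at h1 h5 h6 h7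
    have hgG : (g : ℝ) ≤ 2 ^ g := by exact_mod_cast Nat.lt_two_pow_self.le
    have hK : (4 : ℝ) ^ g = (2 ^ g) ^ 2 := by rw [← pow_mul, mul_comm, pow_mul]; norm_num
    have hℓ := levelCost_le g
    have hone : (1 : ℝ) ≤ 2 ^ g := one_le_pow₀ one_le_two
    rw [hK] at h7 hℓ
    generalize (2 : ℝ) ^ g = Γ at *
    have h8 : ∑ t ∈ Ico (2 * width g) (layers g σ + width g), (size g σ t : ℝ) ≤
        (Γ + 1) * total g σ := by
      refine le_of_mul_le_mul_left (h7.trans ?_) hG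
      nlinarith
    refine (mul_le_mul_of_nonneg_right h1 hc).trans ?_
    -- With Γ = 2 ^ g the errors are, in units of total * levelCost: g for the delay, Γ + 1 for the
    -- waiting, 1 for the rounding of levels; together at most 4 * Γ.
    have h9 : levelCost g * (Γ * 4) ≤ 8 / Γ := by
      calc _ ≤ 2 / Γ ^ 2 * (Γ * 4) := mul_le_mul_of_nonneg_right hℓ (by positivity)
        _ = _ := by field_simp; norm_num
    have h10 := mul_le_mul_of_nonneg_right h6 hc
    have h11 := mul_le_mul_of_nonneg_right h8 hc
    have h12 : (g : ℝ) * total g σ * levelCost g ≤ Γ * total g σ * levelCost g := by gcongr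
    have h13 : (total g σ : ℝ) * levelCost g ≤ Γ * total g σ * levelCost g := by
      rw [mul_assoc Γ]
      exact le_mul_of_one_le_left (by positivity) hone
    have h14 := mul_le_mul_of_nonneg_left h9 hU.le
    rw [add_mul, add_mul]
    linarith

end

end MinEntropyCoupling

/-! ### Codes of states, and the search for a chain -/

namespace MinEntropyCoupling

open Finset RealRAM

/-- Only finitely many components matter, so a state may be replaced by the digits of its code. -/
theorem Step.congr {m n w : ℕ} {x a : ℕ → ℕ} {s b : ℕ} {δ₁ δ₁' δ₂ δ₂' : ℕ → ℕ} (hw : 0 < w)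
    (h : Step m n w x a s b δ₁ δ₁') (h₁ : ∀ d < m * w + m + 2, δ₂ d = δ₁ d)
    (h₂ : ∀ d < m * w + m + 2, δ₂' d = δ₁' d) : Step m n w x a s b δ₂ δ₂' := by
  have hd : ∀ i < m, ∀ c < w, i * w + c < m * w + m + 2 := fun i hi c hc => by
    have := idx_lt hi hc
    omega
  rw [Step] at h ⊢
  split_ifs with hb hact
  · rw [if_pos hb, if_pos hact] at h
    have hi : b / n < m := Nat.div_lt_of_lt_mul (by rwa [mul_comm])
    obtain ⟨e1, e2, e3, e4⟩ := h
    refine ⟨fun d hd hne => ?_, fun c hc => ?_, ?_, ?_⟩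
    · rw [h₁ d hd, h₂ d hd, e1 d hd hne]
    · rw [h₁ _ (hd _ hi c hc), h₂ _ (hd _ hi c hc)]
      exact e2 c hc
    · rw [h₁ _ (by omega), h₂ _ (by omega)]
      exact e3
    · rw [h₁ _ (by omega), h₂ _ (by omega), ← e4]
      congr 1
      refine sum_congr rfl fun c hc => ?_
      rw [mem_range] at hc
      rw [h₁ _ (hd _ hi c hc), h₂ _ (hd _ hi c hc)]
  · rw [if_pos hb, if_neg hact] at h
    exact fun d hd => by rw [h₁ d hd, h₂ d hd, h d hd]
  · rw [if_neg hb] at h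
    rw [h₁ _ (by omega), h₂ _ (by omega), h₂ _ (by omega)]
    refine ⟨h.1, fun i hi => ?_⟩
    obtain ⟨e1, e2, e3, e4⟩ := h.2 i hi
    have h0 := hd i hi 0 hw
    rw [add_zero] at h0
    rw [h₁ _ h0, h₁ _ (by omega), h₂ _ (hd i hi (w - 1) (by omega)), h₂ _ (by omega)]
    refine ⟨e1, fun c hc => ?_, e3, e4⟩
    rw [h₁ _ (by have := hd i hi (c + 1) (by omega); omega), h₂ _ (hd i hi c (by omega)), e2 c hc]

theorem exists_code {off δ : ℕ → ℕ} (hoff : Monotone off) (D : ℕ)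
    (hδ : ∀ d < D, δ d < 2 ^ (off (d + 1) - off d)) :
    ∃ c < 2 ^ (off D), ∀ d < D, c / 2 ^ off d % 2 ^ (off (d + 1) - off d) = δ d := by
  induction D with
  | zero => exact ⟨0, by positivity, by simp⟩
  | succ D ih =>
    obtain ⟨c, hc, hd⟩ := ih fun d hd => hδ d (hd.trans (Nat.lt_succ_self _))
    refine ⟨c + 2 ^ off D * δ D, ?_, fun d hd' => ?_⟩
    · have h1 := hδ D (Nat.lt_succ_self _)
      calc c + 2 ^ off D * δ D < 2 ^ off D + 2 ^ off D * δ D := by omega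
        _ = 2 ^ off D * (δ D + 1) := by ring
        _ ≤ 2 ^ off D * 2 ^ (off (D + 1) - off D) := Nat.mul_le_mul_left _ h1
        _ = 2 ^ off (D + 1) := by
            rw [← pow_add, Nat.add_sub_cancel' (hoff (Nat.le_succ _))]
    · rcases Nat.lt_succ_iff_lt_or_eq.1 hd' with h1 | rfl
      · have h2 : 2 ^ off D = 2 ^ off d * (2 ^ (off (d + 1) - off d) * 2 ^ (off D - off (d + 1))) := by
          have h3 : off (d + 1) ≤ off D := hoff h1
          have h4 : off d ≤ off (d + 1) := hoff (Nat.le_succ d)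
          rw [← pow_add, ← pow_add]
          congr 1
          omega
        rw [h2, mul_assoc, Nat.add_mul_div_left _ _ (by positivity), mul_assoc,
          Nat.add_mul_mod_self_left, hd d h1]
      · rw [Nat.add_mul_div_left _ _ (by positivity), Nat.div_eq_of_lt hc, zero_add,
          Nat.mod_eq_of_lt (hδ _ hd')]

section

variable (m n g σ : ℕ) (a : ℕ → ℕ) (τ : ℕ)

/-- The position of the `d`-th component in the code of a state. -/
def offset (d : ℕ) : ℕ :=
  -- The m * width g demands get 2 * σ bits each; only the other m + 2 components get the long
  -- fields. Long fields throughout would square the factor 4 ^ g in the number of bits.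
  2 * σ * min d (m * width g) + (2 * g + 2) * horizon g σ * (d - m * width g)

def dim : ℕ := m * width g + m + 2

/-- The number of codes. -/
def codes : ℕ := 2 ^ offset m g σ (dim m g)

/-- The components of the state with code `c`. -/
def digit (c d : ℕ) : ℕ :=
  if c < codes m g σ ∧ d < dim m g then
    c / 2 ^ offset m g σ d % 2 ^ (offset m g σ (d + 1) - offset m g σ d) else 0

/-- The number of transitions. -/
def steps : ℕ := layers g σ * (m * n + 1)

def Move (ℓ c c' : ℕ) : Prop :=
  Step m n (width g) (size g σ) a (ℓ / (m * n + 1)) (ℓ % (m * n + 1)) (digit m g σ c) (digit m g σ c')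

/-- The codes that are reached in `ℓ` transitions. -/
def Reach : ℕ → ℕ → Prop
  | 0, c => c = 0
  | ℓ + 1, c => ∃ b < codes m g σ, Reach ℓ b ∧ Move m n g σ a ℓ b c

/-- It suffices to test the pool of marginal 0: all marginals contain the same entries, so this
already controls the mass that is not covered. -/
def Accept (c : ℕ) : Prop :=
  (∀ d < m * width g, digit m g σ c d = 0) ∧ digit m g σ c (m * width g) ≤ τ

/-- The codes of a cheapest chain, in reverse order. -/
noncomputable def path : ℕ → ℕ
  | 0 => least (codes m g σ) fun c => Reach m n g σ a (steps m n g σ) c ∧ Accept m g σ τ c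
  | r + 1 => least (codes m g σ) fun c =>
      Reach m n g σ a (steps m n g σ - (r + 1)) c ∧
        Move m n g σ a (steps m n g σ - (r + 1)) c (path r)

/-- The states of a cheapest chain. -/
noncomputable def trace (ℓ d : ℕ) : ℕ :=
  digit m g σ (path m n g σ a τ (steps m n g σ - ℓ)) d

end

section

variable {m n g σ : ℕ} {a : ℕ → ℕ} {τ : ℕ}

theorem offset_mono : Monotone (offset m g σ) := by
  intro d d' h
  exact add_le_add (Nat.mul_le_mul_left _ (by omega)) (Nat.mul_le_mul_left _ (by omega))

theorem offset_succ_sub (d : ℕ) : offset m g σ (d + 1) - offset m g σ d =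
    if d < m * width g then 2 * σ else (2 * g + 2) * horizon g σ := by
  rw [offset, offset]
  split_ifs with h
  · rw [min_eq_left h, min_eq_left h.le, Nat.sub_eq_zero_of_le h, Nat.sub_eq_zero_of_le h.le,
      mul_add]
    omega
  · rw [min_eq_right (by omega), min_eq_right (by omega),
      show d + 1 - m * width g = d - m * width g + 1 by omega, mul_add _ _ 1]
    omega

theorem digit_zero (d : ℕ) : digit m g σ 0 d = 0 := by simp [digit]

/-- The cost occupies the leading bits, so the least accepted code is one of least cost. -/
theorem digit_top_mono {c c' : ℕ} (h : c ≤ c') (hc' : c' < codes m g σ) :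
    digit m g σ c (m * width g + m + 1) ≤ digit m g σ c' (m * width g + m + 1) := by
  have key : ∀ b < codes m g σ, digit m g σ b (m * width g + m + 1) =
      b / 2 ^ offset m g σ (m * width g + m + 1) := by
    intro b hb
    rw [digit, if_pos ⟨hb, Nat.lt_succ_self _⟩]
    refine Nat.mod_eq_of_lt (Nat.div_lt_of_lt_mul ?_)
    rw [← pow_add, Nat.add_sub_cancel' (offset_mono (Nat.le_succ _))]
    exact hb
  rw [key _ hc', key _ (h.trans_lt hc')]
  exact Nat.div_le_div_right h

/-- The codes of any admissible chain are reached and its last one is accepted, so the search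
succeeds. Following least predecessors back from the least accepted code gives a chain that costs no
more. -/
theorem trace_spec {δ : ℕ → ℕ → ℕ} (hg : 0 < g)
    (h : Chain m n (width g) (layers g σ) (size g σ) a δ)
    (h₁ : ∀ ℓ ≤ steps m n g σ, ∀ d < m * width g, δ ℓ d < 2 ^ (2 * σ))
    (h₂ : ∀ ℓ ≤ steps m n g σ, ∀ d, δ ℓ d < 2 ^ ((2 * g + 2) * horizon g σ))
    (h₃ : δ (steps m n g σ) (m * width g) ≤ τ) :
    Chain m n (width g) (layers g σ) (size g σ) a (trace m n g σ a τ) ∧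
      trace m n g σ a τ (steps m n g σ) (m * width g) ≤ τ ∧
      trace m n g σ a τ (steps m n g σ) (m * width g + m + 1) ≤
        δ (steps m n g σ) (m * width g + m + 1) := by
  have hw : 0 < width g := Nat.mul_pos (by positivity) hg
  have hex : ∀ ℓ, ∃ c < codes m g σ, (ℓ = 0 → c = 0) ∧
      (ℓ ≤ steps m n g σ → ∀ d < dim m g, digit m g σ c d = δ ℓ d) := by
    intro ℓ
    by_cases hℓ : ℓ ≤ steps m n g σ
    · rcases Nat.eq_zero_or_pos ℓ with rfl | h0
      · refine ⟨0, by unfold codes; positivity, fun _ => rfl, fun _ d hd => ?_⟩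
        rw [digit_zero, h.zero d hd]
      · obtain ⟨c, hc, hd⟩ := exists_code (offset_mono (m := m) (g := g) (σ := σ)) (dim m g)
          (δ := δ ℓ) fun d _ => by
            rw [offset_succ_sub]
            split_ifs with h4
            · exact h₁ ℓ hℓ d h4
            · exact h₂ ℓ hℓ d
        exact ⟨c, hc, fun h5 => by omega, fun _ d hd' => by rw [digit, if_pos ⟨hc, hd'⟩, hd d hd']⟩
    · exact ⟨0, by unfold codes; positivity, fun _ => rfl, fun h5 => absurd h5 hℓ⟩
  choose c hc hc0 hcd using hex
  have hreach : ∀ ℓ ≤ steps m n g σ, Reach m n g σ a ℓ (c ℓ) := by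
    intro ℓ
    induction ℓ with
    | zero => exact fun _ => hc0 0 rfl
    | succ ℓ ih =>
      intro hℓ
      exact ⟨c ℓ, hc ℓ, ih (by omega),
        (h.step ℓ hℓ).congr hw (hcd ℓ (by omega)) (hcd (ℓ + 1) hℓ)⟩
  have hacc : Accept m g σ τ (c (steps m n g σ)) := by
    constructor
    · intro d hd
      rw [hcd _ le_rfl d (by rw [dim]; omega)]
      exact h.final d hd
    · rw [hcd _ le_rfl _ (by rw [dim]; omega)]
      exact h₃
  have hbest := least_spec (p := fun c => Reach m n g σ a (steps m n g σ) c ∧ Accept m g σ τ c)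
    (hc (steps m n g σ)) ⟨hreach _ le_rfl, hacc⟩
  -- That a code is reached provides the predecessor that the next search needs.
  have hpath : ∀ r ≤ steps m n g σ, Reach m n g σ a (steps m n g σ - r) (path m n g σ a τ r) := by
    intro r
    induction r with
    | zero => exact fun _ => hbest.1.1
    | succ r ih =>
      intro hr
      have h4 := ih (by omega)
      rw [show steps m n g σ - r = steps m n g σ - (r + 1) + 1 by omega] at h4
      obtain ⟨b, hb, hb1, hb2⟩ := h4
      exact (least_spec (p := fun c => Reach m n g σ a (steps m n g σ - (r + 1)) c ∧
        Move m n g σ a (steps m n g σ - (r + 1)) c (path m n g σ a τ r)) hb ⟨hb1, hb2⟩).1.1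
  have hmove : ∀ r < steps m n g σ, Move m n g σ a (steps m n g σ - (r + 1))
      (path m n g σ a τ (r + 1)) (path m n g σ a τ r) := by
    intro r hr
    have h4 := hpath r hr.le
    rw [show steps m n g σ - r = steps m n g σ - (r + 1) + 1 by omega] at h4
    obtain ⟨b, hb, hb1, hb2⟩ := h4
    exact (least_spec (p := fun c => Reach m n g σ a (steps m n g σ - (r + 1)) c ∧
      Move m n g σ a (steps m n g σ - (r + 1)) c (path m n g σ a τ r)) hb ⟨hb1, hb2⟩).1.2
  have htr : ∀ ℓ ≤ steps m n g σ, ∀ d < dim m g, trace m n g σ a τ ℓ d =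
      digit m g σ (path m n g σ a τ (steps m n g σ - ℓ)) d := fun ℓ _ d _ => rfl
  refine ⟨⟨fun d hd => ?_, fun ℓ hℓ => ?_, fun d hd => ?_⟩, ?_, ?_⟩
  · have h4 := hpath (steps m n g σ) le_rfl
    rw [Nat.sub_self] at h4
    rw [htr 0 (Nat.zero_le _) d hd, Nat.sub_zero, (h4 : path m n g σ a τ (steps m n g σ) = 0),
      digit_zero]
  · have hℓ' : ℓ < steps m n g σ := hℓ
    have h4 := hmove (steps m n g σ - (ℓ + 1)) (by omega)
    rw [show steps m n g σ - (steps m n g σ - (ℓ + 1) + 1) = ℓ by omega,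
      show steps m n g σ - (ℓ + 1) + 1 = steps m n g σ - ℓ by omega] at h4
    exact Step.congr hw h4 (htr ℓ hℓ'.le) (htr (ℓ + 1) hℓ')
  · have h4 := htr (steps m n g σ) le_rfl d (by rw [dim]; omega)
    rw [Nat.sub_self] at h4
    exact h4.trans (hbest.1.2.1 d hd)
  · rw [htr _ le_rfl _ (by rw [dim]; omega), Nat.sub_self]
    exact hbest.1.2.2
  · rw [htr _ le_rfl _ (by rw [dim]; omega), Nat.sub_self, ← hcd _ le_rfl _ (by rw [dim]; omega)]
    exact digit_top_mono hbest.2 (hc _)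

end

end MinEntropyCoupling

/-! ### The coupling that an assignment of states to cells determines -/

namespace MinEntropyCoupling

open Finset Real

section

variable (m n : ℕ) (s : Finset ℕ) (N x : ℕ → ℕ) (c : ℕ → ℕ → ℕ → ℕ) (U : ℝ) (P : ℕ → ℝ)

/-- The number of cells with the states that `y` codes. -/
def jointCount (y : ℕ) : ℕ :=
  ∑ t ∈ s, ∑ o ∈ range (N t * x t), if ∑ i ∈ range m, c i t o * n ^ i = y then 1 else 0

/-- The number of cells with state `j` in marginal `i`. -/
def stateCount (i j : ℕ) : ℕ :=
  ∑ t ∈ s, ∑ o ∈ range (N t * x t), if c i t o = j then 1 else 0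

def cellCount : ℕ := ∑ t ∈ s, N t * x t

/-- The probability that is not covered by cells. -/
noncomputable def leftover : ℝ := 1 - cellCount s N x / U

noncomputable def residual (i j : ℕ) : ℝ := P (i * n + j) - stateCount s N x c i j / U

noncomputable def table (y : ℕ) : ℝ :=
  jointCount m n s N x c y / U + leftover s N x U *
    ∏ i ∈ range m, (residual n s N x c U P i (y / n ^ i % n) / leftover s N x U)

end

section

variable {m n : ℕ} {s : Finset ℕ} {N x : ℕ → ℕ} {c : ℕ → ℕ → ℕ → ℕ} {U : ℝ} {P : ℕ → ℝ}
  {p : Fin m → Fin n → ℝ}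

theorem code_digit (y : Fin m → Fin n) (i : Fin m) :
    (∑ i : Fin m, (y i : ℕ) * n ^ (i : ℕ)) / n ^ (i : ℕ) % n = y i := by
  have h := congrFun (finFunctionFinEquiv.symm_apply_apply y) i
  rw [← finFunctionFinEquiv_apply]
  exact congrArg Fin.val h

def word (hn : 0 < n) (c : ℕ → ℕ → ℕ → ℕ) (t o : ℕ) : Fin m → Fin n :=
  fun i => ⟨c i t o % n, Nat.mod_lt _ hn⟩

theorem word_apply (hn : 0 < n) (hc : ∀ i < m, ∀ t o, c i t o < n) (t o : ℕ) (i : Fin m) :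
    (word hn c t o i : ℕ) = c i t o := Nat.mod_eq_of_lt (hc i i.2 t o)

theorem jointCount_eq (hn : 0 < n) (hc : ∀ i < m, ∀ t o, c i t o < n) (y : Fin m → Fin n) :
    jointCount m n s N x c (∑ i : Fin m, (y i : ℕ) * n ^ (i : ℕ)) =
      ∑ t ∈ s, ∑ o ∈ range (N t * x t), if word hn c t o = y then 1 else 0 := by
  refine sum_congr rfl fun t _ => sum_congr rfl fun o _ => ?_
  congr 1
  rw [← Fin.sum_univ_eq_sum_range (fun i => c i t o * n ^ i) m]
  have h1 : ∑ i : Fin m, c i t o * n ^ (i : ℕ) =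
      ∑ i : Fin m, (word hn c t o i : ℕ) * n ^ (i : ℕ) :=
    sum_congr rfl fun i _ => by rw [word_apply hn hc]
  rw [h1, ← finFunctionFinEquiv_apply, ← finFunctionFinEquiv_apply, Fin.val_inj,
    EmbeddingLike.apply_eq_iff_eq]

theorem stateCount_eq (hn : 0 < n) (hc : ∀ i < m, ∀ t o, c i t o < n) (i : Fin m) (j : Fin n) :
    (∑ y : Fin m → Fin n with y i = j,
      jointCount m n s N x c (∑ i : Fin m, (y i : ℕ) * n ^ (i : ℕ))) =
      stateCount s N x c i j := by
  simp only [jointCount_eq hn hc, stateCount]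
  rw [sum_comm]
  refine sum_congr rfl fun t _ => ?_
  rw [sum_comm]
  refine sum_congr rfl fun o _ => ?_
  rw [sum_ite_eq]
  congr 1
  rw [mem_filter, Fin.ext_iff, word_apply hn hc]
  simp

theorem sum_stateCount (hc : ∀ i < m, ∀ t o, c i t o < n) {i : ℕ} (hi : i < m) :
    ∑ j : Fin n, stateCount s N x c i j = cellCount s N x := by
  rw [Fin.sum_univ_eq_sum_range (fun j => stateCount s N x c i j)]
  simp only [stateCount, cellCount]
  rw [sum_comm]
  refine sum_congr rfl fun t _ => ?_
  rw [sum_comm]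
  calc _ = ∑ o ∈ range (N t * x t), 1 := sum_congr rfl fun o _ => by
        rw [sum_ite_eq, if_pos (mem_range.2 (hc i hi t o))]
    _ = _ := by simp

variable (hn : 0 < n) (hU : 0 < U) (hc : ∀ i < m, ∀ t o, c i t o < n)
  (hp : ∀ i, IsDistribution (p i)) (hP : ∀ (i : Fin m) (j : Fin n), P (i * n + j) = p i j)
  (hle : ∀ (i : Fin m) (j : Fin n), (stateCount s N x c i j : ℝ) ≤ U * p i j)

include hU hP hle in
theorem residual_nonneg (i : Fin m) (j : Fin n) : 0 ≤ residual n s N x c U P i j := by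
  rw [residual, hP, sub_nonneg, div_le_iff₀ hU, mul_comm]
  exact hle i j

include hc hp hP in
theorem sum_residual (i : Fin m) :
    ∑ j : Fin n, residual n s N x c U P i j = leftover s N x U := by
  simp only [residual, hP]
  rw [sum_sub_distrib, (hp i).2, ← sum_div, ← Nat.cast_sum, sum_stateCount hc i.2, leftover]

include hc hp hP hU hle in
theorem leftover_nonneg (hm : 0 < m) : 0 ≤ leftover s N x U := by
  rw [← sum_residual hc hp hP ⟨0, hm⟩]
  exact sum_nonneg fun j _ => residual_nonneg hU hP hle _ j

include hc hp hP hU hle in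
theorem residual_le (i : Fin m) (j : Fin n) :
    residual n s N x c U P i j ≤ leftover s N x U := by
  rw [← sum_residual hc hp hP i]
  exact single_le_sum (f := fun j : Fin n => residual n s N x c U P i j)
    (fun j _ => residual_nonneg hU hP hle _ j) (mem_univ j)

theorem table_eq (y : Fin m → Fin n) :
    table m n s N x c U P (∑ i : Fin m, (y i : ℕ) * n ^ (i : ℕ)) =
      jointCount m n s N x c (∑ i : Fin m, (y i : ℕ) * n ^ (i : ℕ)) / U + leftover s N x U *
        ∏ i : Fin m, (residual n s N x c U P i (y i) / leftover s N x U) := by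
  rw [table, ← Fin.prod_univ_eq_prod_range (fun i => residual n s N x c U P i
    ((∑ i : Fin m, (y i : ℕ) * n ^ (i : ℕ)) / n ^ i % n) / leftover s N x U) m]
  simp only [code_digit]

include hn hc hp hP hU hle in
-- The residual marginals are nonnegative and all have the total mass `leftover`; a scaled product
-- distribution therefore completes the partial coupling.
theorem isCoupling_table (hm : 0 < m) :
    IsCoupling p fun y => table m n s N x c U P (∑ i : Fin m, (y i : ℕ) * n ^ (i : ℕ)) := by
  have h0 := leftover_nonneg hU hc hp hP hle hm
  have hmarg : ∀ (i : Fin m) (j : Fin n), ∑ y : Fin m → Fin n with y i = j,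
      table m n s N x c U P (∑ i : Fin m, (y i : ℕ) * n ^ (i : ℕ)) = p i j := by
    intro i j
    simp only [table_eq]
    rw [sum_add_distrib, ← sum_div, ← Nat.cast_sum, stateCount_eq hn hc, ← mul_sum]
    have h1 : leftover s N x U * ∑ y : Fin m → Fin n with y i = j,
        ∏ k : Fin m, (residual n s N x c U P k (y k) / leftover s N x U) =
        residual n s N x c U P i j := by
      -- If nothing is left over, the residuals vanish too, and the value of the division by zero
      -- does not matter.
      rcases h0.eq_or_lt with h2 | h2
      · have h3 := residual_nonneg hU hP hle i j
        have h4 := residual_le hU hc hp hP hle i j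
        rw [← h2, zero_mul]
        linarith
      · rw [sum_prod_filter (fun (k : Fin m) (j : Fin n) => residual n s N x c U P k j /
          leftover s N x U) (c := 1) (fun k => by
            rw [← sum_div, sum_residual hc hp hP, div_self h2.ne']), one_pow, mul_one,
          mul_div_cancel₀ _ h2.ne']
    rw [h1, residual, hP]
    ring
  refine ⟨⟨fun y => ?_, ?_⟩, hmarg⟩
  · simp only [table_eq]
    refine add_nonneg (by positivity) (mul_nonneg h0 (prod_nonneg fun i _ => ?_))
    exact div_nonneg (residual_nonneg hU hP hle _ _) h0
  · rw [← sum_fiberwise (g := fun y => y ⟨0, hm⟩), ← (hp ⟨0, hm⟩).2]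
    exact sum_congr rfl fun j _ => hmarg _ j

include hn hc hp hP hU hle in
-- A tuple of states changes only if a coordinate does, so the cuts of the marginals add up. Each of
-- the n ^ m product terms is at most `leftover` and contributes at most twice its square root;
-- division by log 2 > 1 / 2 gives the factor 4.
theorem entropy_table_le (hm : 0 < m) (hx : ∀ t ∈ s, 0 < x t) :
    entropy (fun y : Fin m → Fin n =>
        table m n s N x c U P (∑ i : Fin m, (y i : ℕ) * n ^ (i : ℕ))) ≤
      ∑ t ∈ s, N t * (x t / U * logb 2 (U / x t)) +
        (∑ i ∈ range m, ∑ t ∈ s, x t * changes (c i t) (N t) (x t) : ℕ) / U +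
        4 * n ^ m * √(leftover s N x U) := by
  have h0 := leftover_nonneg hU hc hp hP hle hm
  have hlog := Real.log_two_gt_d9
  have h1 : ∑ y : Fin m → Fin n, negMulLog
      (table m n s N x c U P (∑ i : Fin m, (y i : ℕ) * n ^ (i : ℕ))) ≤
      ∑ y : Fin m → Fin n, negMulLog
        (jointCount m n s N x c (∑ i : Fin m, (y i : ℕ) * n ^ (i : ℕ)) / U) +
      ∑ _y : Fin m → Fin n, 2 * √(leftover s N x U) := by
    rw [← sum_add_distrib]
    refine sum_le_sum fun y _ => ?_
    rw [table_eq]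
    have hprod : ∀ i : Fin m, 0 ≤ residual n s N x c U P i (y i) / leftover s N x U ∧
        residual n s N x c U P i (y i) / leftover s N x U ≤ 1 := fun i =>
      ⟨div_nonneg (residual_nonneg hU hP hle _ _) h0,
        div_le_one_of_le₀ (residual_le hU hc hp hP hle _ _) h0⟩
    have hB : 0 ≤ leftover s N x U *
        ∏ i : Fin m, (residual n s N x c U P i (y i) / leftover s N x U) :=
      mul_nonneg h0 (prod_nonneg fun i _ => (hprod i).1)
    refine (negMulLog_add_le (by positivity) hB).trans (add_le_add le_rfl ?_)
    refine (negMulLog_le_sqrt hB).trans ?_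
    have := Real.sqrt_le_sqrt (mul_le_of_le_one_right h0
      (prod_le_one (fun i _ => (hprod i).1) fun i _ => (hprod i).2) : leftover s N x U *
        ∏ i : Fin m, (residual n s N x c U P i (y i) / leftover s N x U) ≤ leftover s N x U)
    linarith
  simp only [jointCount_eq hn hc] at h1
  have h2 := sum_negMulLog_cells_le s N x hx (word (m := m) hn c) U hU
  have h3 : ∀ t, changes (word (m := m) hn c t) (N t) (x t) ≤
      ∑ i ∈ range m, changes (c i t) (N t) (x t) := by
    intro t
    simp only [changes]
    rw [sum_comm]
    refine sum_le_sum fun o _ => ?_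
    split_ifs with h4
    · by_contra h5
      refine h4.2 (funext fun i => Fin.ext ?_)
      have h6 := (sum_eq_zero_iff.1 (Nat.lt_one_iff.1 (not_le.1 h5))) i (mem_range.2 i.2)
      rw [ite_eq_right_iff] at h6
      simp only [word]
      by_contra h7
      exact one_ne_zero (h6 ⟨h4.1, fun h8 => h7 (by rw [h8])⟩)
    · exact Nat.zero_le _
  have h4 : ∑ t ∈ s, (x t : ℝ) / U * (changes (word (m := m) hn c t) (N t) (x t) : ℕ) ≤
      (∑ i ∈ range m, ∑ t ∈ s, x t * changes (c i t) (N t) (x t) : ℕ) / U := by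
    rw [sum_comm, Nat.cast_sum, sum_div]
    refine sum_le_sum fun t _ => ?_
    rw [div_mul_eq_mul_div, ← mul_sum]
    gcongr
    exact_mod_cast Nat.mul_le_mul_left _ (h3 t)
  have h5 : ∑ t ∈ s, (N t : ℝ) * (x t / U * logb 2 (U / x t)) =
      (∑ t ∈ s, (N t : ℝ) * (x t / U * log (U / x t))) / log 2 := by
    rw [sum_div]
    refine sum_congr rfl fun t _ => ?_
    rw [logb]
    ring
  rw [entropy_eq, h5, div_le_iff₀ (by linarith), add_mul, add_mul,
    div_mul_cancel₀ _ (by linarith : log 2 ≠ 0)]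
  refine h1.trans (add_le_add (h2.trans (add_le_add le_rfl ?_)) ?_)
  · rw [mul_comm]
    exact mul_le_mul_of_nonneg_right h4 (by linarith)
  · rw [sum_const, card_univ, Fintype.card_fun, Fintype.card_fin, Fintype.card_fin, nsmul_eq_mul]
    push_cast
    have h6 : 0 ≤ (n : ℝ) ^ m * √(leftover s N x U) := by positivity
    nlinarith

end

end MinEntropyCoupling

/-! ### The coupling of a cheapest chain -/

namespace MinEntropyCoupling

open Finset Real

section

variable (m n g σ : ℕ) (P : ℕ → ℝ)

/-- The mass that a chain may leave over. -/
def slack : ℕ := 3 * n ^ m * size g σ (layers g σ - 1)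

/-- The states of a cheapest chain for the marginals `P`. -/
noncomputable def best : ℕ → ℕ → ℕ := trace m n g σ (mass g σ P) (slack m n g σ)

noncomputable def number (t : ℕ) : ℕ := entryCount m n (width g) (best m n g σ P) t

noncomputable def cell (i t o : ℕ) : ℕ :=
  Chain.cellState m n (width g) (layers g σ) (size g σ) (best m n g σ P) i t o

def window : Finset ℕ := Ico (width g) (width g + layers g σ)

noncomputable def result (y : ℕ) : ℝ :=
  table m n (window g σ) (number m n g σ P) (size g σ) (cell m n g σ P) (total g σ) P y

end

variable {m n g σ h : ℕ} {p : Fin m → Fin n → ℝ} {P : ℕ → ℝ}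

/-- The chain that is found does not depend on q, so the bound holds for all couplings at once, in
particular for an optimal one. -/
theorem best_spec (hg : 0 < g) (hσ : g ≤ σ) (hm : 0 < m) (hn : 0 < n)
    (hp : ∀ i, IsDistribution (p i)) (hP : ∀ (i : Fin m) (j : Fin n), P (i * n + j) = p i j)
    {q : (Fin m → Fin n) → ℝ} (hq : IsCoupling p q) :
    Chain m n (width g) (layers g σ) (size g σ) (mass g σ P) (best m n g σ P) ∧
      best m n g σ P (steps m n g σ) (m * width g) ≤ slack m n g σ ∧
      (best m n g σ P (steps m n g σ) (m * width g + m + 1) : ℝ) * levelCost g ≤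
        total g σ * (entropy q + 8 / 2 ^ g) := by
  obtain ⟨δ, h1, h2, h3, h4, h5⟩ := exists_chain hp hq hP hg hσ hn
  obtain ⟨k1, k2, k3⟩ := trace_spec hg h1 h2 h3 (h4 0 hm)
  refine ⟨k1, k2, le_trans ?_ h5⟩
  exact mul_le_mul_of_nonneg_right (by exact_mod_cast k3) (levelCost_nonneg g)

theorem cell_lt (hn : 0 < n) (i t o : ℕ) : cell m n g σ P i t o < n := Nat.mod_lt _ hn

theorem stateCount_le (hg : 0 < g)
    (hp : ∀ i, IsDistribution (p i)) (hP : ∀ (i : Fin m) (j : Fin n), P (i * n + j) = p i j)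
    (hc : Chain m n (width g) (layers g σ) (size g σ) (mass g σ P) (best m n g σ P))
    (i : Fin m) (j : Fin n) :
    (stateCount (window g σ) (number m n g σ P) (size g σ) (cell m n g σ P) i j : ℝ) ≤
      total g σ * p i j := by
  have h1 := hc.cellState_count_le i.2 (Nat.mul_pos (by positivity) hg) size_anti j
  have h2 : (mass g σ P (i * n + j) : ℝ) ≤ total g σ * p i j := by
    rw [mass, hP]
    exact Nat.floor_le (mul_nonneg (Nat.cast_nonneg _) ((hp i).1 j))
  refine le_trans ?_ h2
  exact_mod_cast h1

theorem sum_mass_le (hp : ∀ i, IsDistribution (p i))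
    (hP : ∀ (i : Fin m) (j : Fin n), P (i * n + j) = p i j) (i : Fin m) :
    ∑ j ∈ range n, mass g σ P (i * n + j) ≤ total g σ := by
  have := sum_floor_le (univ : Finset (Fin n)) (fun j => total g σ * P (i * n + j))
    (fun j _ => mul_nonneg (Nat.cast_nonneg _) (by rw [hP i j]; exact (hp _).1 _))
    (y := total g σ) (by rw [← mul_sum, sum_congr rfl fun j _ => hP i j, (hp _).2, mul_one])
  rw [Nat.floor_natCast] at this
  rwa [← Fin.sum_univ_eq_sum_range fun j => mass g σ P (i * n + j)]

theorem total_le_sum_mass (hp : ∀ i, IsDistribution (p i))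
    (hP : ∀ (i : Fin m) (j : Fin n), P (i * n + j) = p i j) (i : Fin m) :
    total g σ ≤ ∑ j ∈ range n, mass g σ P (i * n + j) + n := by
  have h1 : (total g σ : ℝ) ≤ ∑ j : Fin n, ((mass g σ P (i * n + j) + 1 : ℕ) : ℝ) := by
    calc (total g σ : ℝ) = ∑ j, total g σ * p i j := by rw [← mul_sum, (hp i).2, mul_one]
      _ ≤ _ := sum_le_sum fun j _ => by
        rw [← hP]
        push_cast
        exact (Nat.lt_floor_add_one _).le
  have h2 : total g σ ≤ ∑ j : Fin n, (mass g σ P (i * n + j) + 1) := by exact_mod_cast h1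
  rwa [Fin.sum_univ_eq_sum_range (fun j => mass g σ P (i * n + j) + 1), sum_add_distrib, sum_const,
    card_range, smul_eq_mul, mul_one] at h2

theorem leftover_le (hg : 0 < g) (hσ : g ≤ σ) (hm : 0 < m) (hn : 0 < n)
    (hp : ∀ i, IsDistribution (p i)) (hP : ∀ (i : Fin m) (j : Fin n), P (i * n + j) = p i j)
    (hc : Chain m n (width g) (layers g σ) (size g σ) (mass g σ P) (best m n g σ P))
    (hs : best m n g σ P (steps m n g σ) (m * width g) ≤ slack m n g σ) :
    leftover (window g σ) (number m n g σ P) (size g σ) (total g σ) ≤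
      10 * n ^ m / 2 ^ (σ - g) := by
  have hU : (0 : ℝ) < total g σ := by exact_mod_cast total_pos
  have hw : 0 < width g := Nat.mul_pos (by positivity) hg
  have h1 := hc.total hm hw size_anti
  have h2 := Chain.le_sum_binSize (m := m) (n := n) (S := layers g σ) (x := size g σ)
    (a := mass g σ P) (i := 0) hm fun j hj => by
      refine lt_of_le_of_lt ?_ (size_lt hw (by rw [horizon]; omega) : total g σ < size g σ 0)
      refine le_trans ?_ (sum_mass_le hp hP ⟨0, hm⟩)
      exact single_le_sum (f := fun j => mass g σ P (0 * n + j)) (fun _ _ => Nat.zero_le _)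
        (mem_range.2 hj)
  have h3 := total_le_sum_mass (g := g) (σ := σ) hp hP ⟨0, hm⟩
  have h4 : cellCount (window g σ) (number m n g σ P) (size g σ) =
    ∑ t ∈ Ico (width g) (width g + layers g σ),
      entryCount m n (width g) (best m n g σ P) t * size g σ t := rfl
  have h5 : n ≤ n ^ m := Nat.le_self_pow hm.ne' n
  have h6 := size_pos (g := g) (σ := σ) (layers g σ - 1)
  have h7 : n * size g σ (layers g σ - 1) ≤ n ^ m * size g σ (layers g σ - 1) :=
    Nat.mul_le_mul_right _ h5
  have h8 : n ^ m ≤ n ^ m * size g σ (layers g σ - 1) := Nat.le_mul_of_pos_right _ h6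
  rw [slack, mul_assoc] at hs
  rw [add_zero] at h1
  -- The factor 5: three from `slack`, one from states that are never opened, one from the floors.
  have h9 : total g σ ≤ cellCount (window g σ) (number m n g σ P) (size g σ) +
      5 * (n ^ m * size g σ (layers g σ - 1)) := by
    rw [h4]
    change best m n g σ P (layers g σ * (m * n + 1)) (m * width g) ≤ _ at hs
    simp only [zero_mul, zero_add] at h1 h2 h3
    omega
  have h10 := size_layers_le hσ hg
  rw [← Nat.cast_le (α := ℝ)] at h9 h10
  push_cast at h9 h10
  have h11 : (1 : ℝ) - cellCount (window g σ) (number m n g σ P) (size g σ) / total g σ =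
      (total g σ - cellCount (window g σ) (number m n g σ P) (size g σ)) / total g σ := by
    field_simp
  rw [leftover, h11, div_le_div_iff₀ hU (by positivity)]
  have h12 : (0 : ℝ) ≤ (n : ℝ) ^ m := by positivity
  calc _ ≤ 5 * ((n : ℝ) ^ m * size g σ (layers g σ - 1)) * 2 ^ (σ - g) :=
        mul_le_mul_of_nonneg_right (by linarith) (by positivity)
    _ = 5 * (n : ℝ) ^ m * (2 ^ (σ - g) * size g σ (layers g σ - 1)) := by ring
    _ ≤ 5 * (n : ℝ) ^ m * (2 * total g σ) := mul_le_mul_of_nonneg_left h10 (by positivity)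
    _ = _ := by ring

theorem isCoupling_result (hg : 0 < g) (hσ : g ≤ σ) (hm : 0 < m) (hn : 0 < n)
    (hp : ∀ i, IsDistribution (p i)) (hP : ∀ (i : Fin m) (j : Fin n), P (i * n + j) = p i j) :
    IsCoupling p fun y => result m n g σ P (∑ i : Fin m, (y i : ℕ) * n ^ (i : ℕ)) := by
  -- Some coupling is needed to know that a chain exists.
  obtain ⟨q, hq⟩ := exists_isMinEntropyCoupling hp
  obtain ⟨hc, -, -⟩ := best_spec hg hσ hm hn hp hP hq.1
  exact isCoupling_table hn (by exact_mod_cast total_pos) (fun i _ => cell_lt hn i) hp hP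
    (stateCount_le hg hp hP hc) hm

/-- The three errors: 8 for rounding, m for the cuts, 16 for the uncovered mass, each over 2 ^ g. -/
theorem entropy_result_le (hg : 0 < g) (hσ : σ = 3 * g + 3 * (m * h)) (hh : n ≤ 2 ^ h) (hm : 0 < m)
    (hn : 0 < n) (hp : ∀ i, IsDistribution (p i))
    (hP : ∀ (i : Fin m) (j : Fin n), P (i * n + j) = p i j)
    {q : (Fin m → Fin n) → ℝ} (hq : IsCoupling p q) :
    entropy (fun y : Fin m → Fin n => result m n g σ P (∑ i : Fin m, (y i : ℕ) * n ^ (i : ℕ))) ≤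
      entropy q + (m + 24) / 2 ^ g := by
  have hσ' : g ≤ σ := by omega
  have hU : (0 : ℝ) < total g σ := by exact_mod_cast total_pos
  have hG : (0 : ℝ) < 2 ^ g := by positivity
  have hw : 0 < width g := Nat.mul_pos (by positivity) hg
  obtain ⟨hc, hs, hcost⟩ := best_spec hg hσ' hm hn hp hP hq
  have h1 := entropy_table_le hn hU (fun i _ => cell_lt hn i) hp hP (stateCount_le hg hp hP hc) hm
    fun t _ => size_pos t
  refine h1.trans ?_
  have h2 : ∑ t ∈ window g σ, (number m n g σ P t : ℝ) *
      (size g σ t / total g σ * logb 2 (total g σ / size g σ t)) ≤ entropy q + 8 / 2 ^ g := by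
    have h3 : ∑ t ∈ window g σ, (number m n g σ P t : ℝ) *
        (size g σ t / total g σ * logb 2 (total g σ / size g σ t)) =
        (best m n g σ P (steps m n g σ) (m * width g + m + 1) : ℝ) * levelCost g / total g σ := by
      rw [steps, hc.cost_eq hw, window, sum_Ico_eq_sum_range, Nat.add_sub_cancel_left,
        Nat.cast_sum, sum_mul, sum_div]
      refine sum_congr rfl fun t ht => ?_
      rw [mem_range] at ht
      rw [add_comm (width g) t, logb_total_div (by omega) (by rw [horizon]; omega),
        Nat.add_sub_cancel, number]
      push_cast
      ring
    rw [h3, div_le_iff₀ hU, mul_comm _ (total g σ : ℝ)]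
    exact hcost
  have h4 : ((∑ i ∈ range m, ∑ t ∈ window g σ, size g σ t *
      changes (cell m n g σ P i t) (number m n g σ P t) (size g σ t) : ℕ) : ℝ) / total g σ ≤
      m / 2 ^ g := by
    rw [div_le_div_iff₀ hU hG]
    have h5 : (∑ i ∈ range m, ∑ t ∈ window g σ, size g σ t *
        changes (cell m n g σ P i t) (number m n g σ P t) (size g σ t)) * 2 ^ g ≤
        m * total g σ := by
      rw [sum_mul]
      calc _ ≤ ∑ i ∈ range m, total g σ := by
            refine sum_le_sum fun i hi => ?_
            rw [mem_range] at hi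
            rw [mul_comm]
            exact (hc.changes_cellState_le hi hw size_anti fun t ht =>
              two_pow_mul_size_width_le ht).trans (sum_mass_le hp hP ⟨i, hi⟩)
        _ = _ := by rw [sum_const, card_range, smul_eq_mul]
    exact_mod_cast h5
  have h6 : 4 * (n : ℝ) ^ m * √(leftover (window g σ) (number m n g σ P) (size g σ) (total g σ)) ≤
      16 / 2 ^ g := by
    have h7 : (n : ℝ) ^ m ≤ 2 ^ (m * h) := by
      rw [mul_comm m h, pow_mul]
      exact pow_le_pow_left₀ (Nat.cast_nonneg _) (by exact_mod_cast hh) _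
    have h8 : leftover (window g σ) (number m n g σ P) (size g σ) (total g σ) ≤
        (4 / (2 ^ g * 2 ^ (m * h))) ^ 2 := by
      refine (leftover_le hg hσ' hm hn hp hP hc hs).trans ?_
      -- One factor 2 ^ (m * h) compensates the n ^ m in the bound for `leftover`; the others leave
      -- a square, whose root cancels the n ^ m tuples.
      rw [show σ - g = g + g + (m * h + m * h + m * h) by omega, pow_add, pow_add, pow_add, pow_add,
        div_pow, div_le_div_iff₀ (by positivity) (by positivity)]
      generalize (2 : ℝ) ^ (m * h) = H at *
      have hH : 0 ≤ H := le_trans (by positivity) h7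
      have : 10 * (n : ℝ) ^ m ≤ 16 * H := by linarith
      calc 10 * (n : ℝ) ^ m * (2 ^ g * H) ^ 2 ≤ 16 * H * (2 ^ g * H) ^ 2 :=
            mul_le_mul_of_nonneg_right this (by positivity)
        _ = _ := by ring
    have h9 := Real.sqrt_le_sqrt h8
    rw [Real.sqrt_sq (by positivity)] at h9
    calc _ ≤ 4 * (2 : ℝ) ^ (m * h) * (4 / (2 ^ g * 2 ^ (m * h))) := by gcongr
      _ = _ := by field_simp; norm_num
  have h10 : ((m : ℝ) + 24) / 2 ^ g = 8 / 2 ^ g + m / 2 ^ g + 16 / 2 ^ g := by ring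
  rw [h10]
  linarith

end MinEntropyCoupling

/-! ### Terms for the search -/

namespace RealRAM

open Finset

section

variable {ι : Type} {A : Spec ι} {a : ℕ} {Γ : Type} [Scope A a Γ]

/-- Read an array that has been filled, and zero outside of it. -/
theorem Calc.readIf (b : ℕ) {f N : Γ → ℕ} (hf : Calc f) (hN : Calc N) (hb : b < a)
    (h : ∀ γ, N γ ≤ A.bnd b (Scope.inp γ)) :
    Calc fun γ => if f γ < N γ then A.val b (Scope.inp γ) (f γ) else 0 := by
  obtain ⟨τ, hτ⟩ := hf
  obtain ⟨υ, hυ⟩ := hN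
  refine ⟨.ite (.add τ (.const 1)) υ (.arr b τ) (.const 0), fun γ => ?_⟩
  simp only [NTerm.eval, hτ, hυ, Nat.succ_le_iff]
  split_ifs with h1
  · exact (Scope.holds γ).nat b hb _ (h1.trans_le (h γ))
  · rfl

/-- Read the array that is being filled, and zero outside of it. -/
theorem Calc.selfIf {f N : Γ → ℕ} (hf : Calc f) (hN : Calc N) (h : ∀ γ : Γ, N γ ≤ Scope.idx γ) :
    Calc fun γ => if f γ < N γ then A.val a (Scope.inp γ) (f γ) else 0 := by
  obtain ⟨τ, hτ⟩ := hf
  obtain ⟨υ, hυ⟩ := hN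
  refine ⟨.ite (.add τ (.const 1)) υ (.arr a τ) (.const 0), fun γ => ?_⟩
  simp only [NTerm.eval, hτ, hυ, Nat.succ_le_iff]
  split_ifs with h1
  · exact Scope.prev γ _ (h1.trans_le (h γ))
  · rfl

theorem CalcP.or {p r : Γ → Prop} (hp : CalcP p) (hr : CalcP r) : CalcP fun γ => p γ ∨ r γ :=
  (hp.not.imp hr).congr fun γ => by tauto

theorem Calc.min {f g : Γ → ℕ} (hf : Calc f) (hg : Calc g) : Calc fun γ => min (f γ) (g γ) :=
  (hf.sub (hf.sub hg)).congr fun γ => by omega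

theorem Calc.countLt {b : Γ → ℕ} (hb : Calc b) {p : Γ → ℕ → Prop}
    (hp : CalcP fun γ : Push Γ b => p γ.base γ.k) :
    Calc fun γ => MinEntropyCoupling.countLt (b γ) (p γ) := by
  classical
  refine (hb.sum (F := fun γ k => if p γ k then 1 else 0) hp.calc).congr fun γ => ?_
  rw [MinEntropyCoupling.countLt]

theorem Calc.filterIco {u v : Γ → ℕ} (hv : Calc v) {p : Γ → ℕ → Prop}
    [∀ γ, DecidablePred (p γ)] {F : Γ → ℕ → ℕ}
    (hp : CalcP fun γ : Push Γ v => p γ.base (u γ.base + γ.k))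
    (hF : Calc fun γ : Push Γ v => F γ.base (u γ.base + γ.k)) :
    Calc fun γ => ∑ t ∈ Ico (u γ) (u γ + v γ) with p γ t, F γ t := by
  classical
  refine (hv.sum (F := fun γ k => if p γ (u γ + k) then F γ (u γ + k) else 0)
    (CalcP.ite hp hF (.const 0))).congr fun γ => ?_
  rw [sum_filter, sum_Ico_eq_sum_range, Nat.add_sub_cancel_left]

theorem Calc.sumIco {u v : Γ → ℕ} (hv : Calc v) {F : Γ → ℕ → ℕ}
    (hF : Calc fun γ : Push Γ v => F γ.base (u γ.base + γ.k)) :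
    Calc fun γ => ∑ t ∈ Ico (u γ) (u γ + v γ), F γ t := by
  refine (hv.sum (F := fun γ k => F γ (u γ + k)) hF).congr fun γ => ?_
  rw [sum_Ico_eq_sum_range, Nat.add_sub_cancel_left]

theorem Calc.sqPow {f g : Γ → ℕ} (hf : Calc f) (h : ∀ γ, f γ = 2 ^ g γ) :
    Calc fun γ => 4 ^ g γ :=
  (hf.mul hf).congr fun γ => by rw [h, ← mul_pow]; rfl

end

end RealRAM

/-! ### Parameters of the algorithm and the list of its arrays -/

namespace MinEntropyCoupling

open Finset RealRAM

/-- The inputs of the algorithm. -/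
structure Inp : Type where
  m : ℕ
  n : ℕ
  ε : ℝ
  p : Fin m → Fin n → ℝ
  two_le_m : 2 ≤ m
  ε_pos : 0 < ε
  ε_lt : ε < 1 / 2
  dist : ∀ i, IsDistribution (p i)

namespace Inp

variable (I : Inp)

noncomputable def mem : Mem := input I.m I.n I.ε I.p

noncomputable def P : ℕ → ℝ := I.mem.real 1

theorem exists_g : ∃ g, (2 ^ (I.m + 5) : ℕ) ≤ I.ε * (2 ^ g : ℕ) := by
  obtain ⟨g, hg⟩ := pow_unbounded_of_one_lt ((2 : ℝ) ^ (I.m + 5) / I.ε) one_lt_two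
  refine ⟨g, ?_⟩
  rw [div_lt_iff₀ I.ε_pos] at hg
  push_cast
  linarith

/-- Large enough for the error, as m + 24 ≤ 2 ^ (m + 5); minimality makes 2 ^ g at most 2 ^ (m + 6)
/ ε. -/
noncomputable def g : ℕ := Nat.find I.exists_g

def h : ℕ := Nat.clog 2 I.n

noncomputable def σ : ℕ := 3 * I.g + 3 * (I.m * I.h)

theorem g_spec : (2 : ℝ) ^ (I.m + 5) ≤ I.ε * 2 ^ I.g := by
  exact_mod_cast Nat.find_spec I.exists_g

theorem g_pos : 0 < I.g := by
  rw [Nat.pos_iff_ne_zero]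
  intro h0
  have h1 := I.g_spec
  have h2 := I.ε_lt
  have h3 : (1 : ℝ) ≤ 2 ^ (I.m + 5) := one_le_pow₀ one_le_two
  rw [h0, pow_zero] at h1
  linarith

theorem n_pos : 0 < I.n := by
  rw [Nat.pos_iff_ne_zero]
  intro h0
  have h1 := (I.dist ⟨0, by have := I.two_le_m; omega⟩).2
  have : IsEmpty (Fin I.n) := by rw [h0]; infer_instance
  simp at h1

theorem n_le : I.n ≤ 2 ^ I.h := Nat.le_pow_clog one_lt_two _

theorem le_σ : I.g ≤ I.σ := by rw [σ]; omega

theorem P_apply (i : Fin I.m) (j : Fin I.n) : I.P (i * I.n + j) = I.p i j := by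
  have h1 : (i : ℕ) * I.n + j < I.m * I.n := idx_lt i.2 j.2
  have h2 : (⟨i * I.n + j, h1⟩ : Fin (I.m * I.n)) = finProdFinEquiv (i, j) := by
    ext
    simp [finProdFinEquiv]
    ring
  rw [← Equiv.symm_apply_eq] at h2
  simp only [P, mem, input, dif_pos h1, h2]
  rfl

theorem P_eq_zero {k : ℕ} (hk : ¬ k < I.m * I.n) : I.P k = 0 := by
  simp [P, mem, input, hk]

theorem P_nonneg (k : ℕ) : 0 ≤ I.P k := by
  by_cases hk : k < I.m * I.n
  · simp only [P, mem, input, dif_pos hk]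
    exact (I.dist _).1 _
  · rw [I.P_eq_zero hk]

theorem P_le (k : ℕ) : I.P k ≤ 1 := by
  by_cases hk : k < I.m * I.n
  · simp only [P, mem, input, dif_pos hk]
    exact (I.dist _).le_one _
  · rw [I.P_eq_zero hk]
    exact zero_le_one

/-- The logarithm of the number of codes. -/
noncomputable def bits : ℕ := offset I.m I.g I.σ (dim I.m I.g)

theorem bits_eq : I.bits = 2 * I.σ * (I.m * width I.g) +
    (2 * I.g + 2) * horizon I.g I.σ * (I.m + 2) := by
  rw [bits, offset, dim, min_eq_right (by omega)]
  congr 2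
  omega

theorem le_bits {y : ℕ} (h : y ≤ (2 * I.g + 2) * horizon I.g I.σ) : y ≤ I.bits := by
  rw [bits_eq]
  have h1 : (2 * I.g + 2) * horizon I.g I.σ * 1 ≤ (2 * I.g + 2) * horizon I.g I.σ * (I.m + 2) :=
    Nat.mul_le_mul_left _ (by omega)
  omega

theorem σ_le_layers : I.σ ≤ layers I.g I.σ := Nat.le_mul_of_pos_left _ (by positivity)

theorem horizon_le_bits : horizon I.g I.σ ≤ I.bits :=
  I.le_bits (Nat.le_mul_of_pos_left _ (by omega))

theorem σ_le_bits : I.σ ≤ I.bits :=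
  (I.σ_le_layers.trans (Nat.le_add_right _ _)).trans I.horizon_le_bits

theorem m_le_bits : I.m ≤ I.bits := by
  have h1 : 0 < (2 * I.g + 2) * horizon I.g I.σ := by
    refine Nat.mul_pos (by omega) ?_
    have := I.σ_le_layers
    have := I.g_pos
    have := I.le_σ
    rw [horizon]
    omega
  rw [bits_eq]
  have := Nat.le_mul_of_pos_left (I.m + 2) h1
  omega

theorem n_pow_le : I.n ^ I.m ≤ 2 ^ I.bits := by
  refine (Nat.pow_le_pow_left I.n_le _).trans ?_
  rw [← pow_mul]
  refine Nat.pow_le_pow_right two_pos (le_trans ?_ I.σ_le_bits)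
  rw [σ, mul_comm I.h]
  omega

end Inp

open Classical in
/-- The arrays of natural numbers that the algorithm fills. -/
noncomputable def spec : Spec Inp where
  val b I k :=
    match b with
    | 0 => I.m
    | 1 => I.n
    | 2 => I.g
    | 3 => I.h
    | 4 => 2 ^ I.g
    | 5 => 2 ^ k
    | 6 => (4 ^ I.g + 1) ^ k
    | 7 => I.n ^ k
    | 8 => mass I.g I.σ I.P k
    | 9 => if Reach I.m I.n I.g I.σ (mass I.g I.σ I.P) (k / codes I.m I.g I.σ)
        (k % codes I.m I.g I.σ) then 1 else 0
    | 10 => path I.m I.n I.g I.σ (mass I.g I.σ I.P) (slack I.m I.n I.g I.σ) k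
    | 11 => jointCount I.m I.n (window I.g I.σ) (number I.m I.n I.g I.σ I.P) (size I.g I.σ)
        (cell I.m I.n I.g I.σ I.P) k
    | 12 => stateCount (window I.g I.σ) (number I.m I.n I.g I.σ I.P) (size I.g I.σ)
        (cell I.m I.n I.g I.σ I.P) (k / I.n) (k % I.n)
    | 13 => cellCount (window I.g I.σ) (number I.m I.n I.g I.σ I.P) (size I.g I.σ)
    | 14 => total I.g I.σ
    | 15 => if k % (I.m + 1) = 0 then 1 else 0
    | 16 => (k % (I.m + 1) - 1) * I.n + k / (I.m + 1) / I.n ^ (k % (I.m + 1) - 1) % I.n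
    | 17 => k * (I.m + 1) + I.m
    | 18 => I.m * I.n
    | 19 => I.n ^ I.m * (I.m + 1)
    | 20 => I.n ^ I.m
    | _ => 0
  bnd b I :=
    match b with
    | 5 => I.bits + 1
    | 6 => horizon I.g I.σ + 1
    | 7 => I.m + 1
    | 8 => I.m * I.n
    | 9 => (steps I.m I.n I.g I.σ + 1) * codes I.m I.g I.σ
    | 10 => steps I.m I.n I.g I.σ + 1
    | 11 => I.n ^ I.m
    | 12 => I.m * I.n
    | 15 => I.n ^ I.m * (I.m + 1)
    | 16 => I.n ^ I.m * (I.m + 1)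
    | 17 => I.n ^ I.m
    | _ => 1
  init I := I.mem
  -- All times and contents are measured by powers of the number of codes.
  size I := codes I.m I.g I.σ
  two_le_size I := by
    have h1 := I.m_le_bits
    have h2 := I.two_le_m
    calc 2 = 2 ^ 1 := rfl
      _ ≤ 2 ^ I.bits := Nat.pow_le_pow_right two_pos (by omega)

/-! ### The transition relation as a term -/

section

variable {a : ℕ} {Γ : Type} [Scope spec a Γ]

theorem calc_m (ha : 5 ≤ a) : Calc fun γ : Γ => (Scope.inp γ : Inp).m :=
  Calc.read (A := spec) 0 (.const 0) (by omega) fun _ => Nat.one_pos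

theorem calc_n (ha : 5 ≤ a) : Calc fun γ : Γ => (Scope.inp γ : Inp).n :=
  Calc.read (A := spec) 1 (.const 0) (by omega) fun _ => Nat.one_pos

theorem calc_g (ha : 5 ≤ a) : Calc fun γ : Γ => (Scope.inp γ : Inp).g :=
  Calc.read (A := spec) 2 (.const 0) (by omega) fun _ => Nat.one_pos

theorem calc_h (ha : 5 ≤ a) : Calc fun γ : Γ => (Scope.inp γ : Inp).h :=
  Calc.read (A := spec) 3 (.const 0) (by omega) fun _ => Nat.one_pos

theorem calc_K (ha : 5 ≤ a) : Calc fun γ : Γ => 4 ^ (Scope.inp γ : Inp).g :=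
  Calc.sqPow (Calc.read (A := spec) 4 (.const 0) (by omega) fun _ => Nat.one_pos) fun _ => rfl

theorem calc_σ (ha : 5 ≤ a) : Calc fun γ : Γ => (Scope.inp γ : Inp).σ :=
  ((Calc.const 3).mul (calc_g ha)).add ((Calc.const 3).mul ((calc_m ha).mul (calc_h ha)))

theorem calc_width (ha : 5 ≤ a) : Calc fun γ : Γ => width (Scope.inp γ : Inp).g :=
  (calc_K ha).mul (calc_g ha)

theorem calc_layers (ha : 5 ≤ a) :
    Calc fun γ : Γ => layers (Scope.inp γ : Inp).g (Scope.inp γ : Inp).σ :=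
  (calc_K ha).mul (calc_σ ha)

theorem calc_horizon (ha : 5 ≤ a) :
    Calc fun γ : Γ => horizon (Scope.inp γ : Inp).g (Scope.inp γ : Inp).σ :=
  (calc_layers ha).add (calc_width ha)

theorem calc_bins (ha : 5 ≤ a) :
    Calc fun γ : Γ => (Scope.inp γ : Inp).m * (Scope.inp γ : Inp).n + 1 :=
  ((calc_m ha).mul (calc_n ha)).add (.const 1)

theorem calc_steps (ha : 5 ≤ a) : Calc fun γ : Γ => steps (Scope.inp γ : Inp).m
    (Scope.inp γ : Inp).n (Scope.inp γ : Inp).g (Scope.inp γ : Inp).σ :=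
  (calc_layers ha).mul (calc_bins ha)

theorem calc_demands (ha : 5 ≤ a) :
    Calc fun γ : Γ => (Scope.inp γ : Inp).m * width (Scope.inp γ : Inp).g :=
  (calc_m ha).mul (calc_width ha)

theorem calc_dim (ha : 5 ≤ a) :
    Calc fun γ : Γ => dim (Scope.inp γ : Inp).m (Scope.inp γ : Inp).g :=
  ((calc_demands ha).add (calc_m ha)).add (.const 2)

theorem calc_offset (ha : 5 ≤ a) {f : Γ → ℕ} (hf : Calc f) : Calc fun γ : Γ =>
    offset (Scope.inp γ : Inp).m (Scope.inp γ : Inp).g (Scope.inp γ : Inp).σ (f γ) :=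
  (((Calc.const 2).mul (calc_σ ha)).mul (hf.min (calc_demands ha))).add
    (((((Calc.const 2).mul (calc_g ha)).add (.const 2)).mul (calc_horizon ha)).mul
      (hf.sub (calc_demands ha)))

theorem calc_bits (ha : 5 ≤ a) : Calc fun γ : Γ => (Scope.inp γ : Inp).bits :=
  calc_offset ha (calc_dim ha)

theorem calc_two_pow (ha : 6 ≤ a) {f : Γ → ℕ} (hf : Calc f)
    (h : ∀ γ, f γ ≤ (Scope.inp γ : Inp).bits) : Calc fun γ : Γ => 2 ^ f γ :=
  Calc.read (A := spec) 5 hf (by omega) fun γ => Nat.lt_succ_of_le (h γ)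

theorem calc_codes (ha : 6 ≤ a) : Calc fun γ : Γ =>
    codes (Scope.inp γ : Inp).m (Scope.inp γ : Inp).g (Scope.inp γ : Inp).σ :=
  calc_two_pow ha (calc_bits (by omega)) fun _ => le_rfl

theorem calc_digit (ha : 6 ≤ a) {c d : Γ → ℕ} (hc : Calc c) (hd : Calc d) : Calc fun γ : Γ =>
    digit (Scope.inp γ : Inp).m (Scope.inp γ : Inp).g (Scope.inp γ : Inp).σ (c γ) (d γ) := by
  have ha' : 5 ≤ a := by omega
  -- Reading the table of powers requires indices in range even where the digit is zero by
  -- definition; truncating at `dim` ensures this.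
  have hd' := hd.min (calc_dim ha')
  have hd1 := (hd.add (.const 1)).min (calc_dim ha')
  have h1 : ∀ γ : Γ, offset (Scope.inp γ : Inp).m (Scope.inp γ : Inp).g (Scope.inp γ : Inp).σ
      (min (d γ + 1) (dim (Scope.inp γ : Inp).m (Scope.inp γ : Inp).g)) ≤
      (Scope.inp γ : Inp).bits := fun γ => offset_mono (by omega)
  have h2 : ∀ γ : Γ, offset (Scope.inp γ : Inp).m (Scope.inp γ : Inp).g (Scope.inp γ : Inp).σ
      (min (d γ) (dim (Scope.inp γ : Inp).m (Scope.inp γ : Inp).g)) ≤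
      (Scope.inp γ : Inp).bits := fun γ => offset_mono (by omega)
  have key := CalcP.ite ((CalcP.lt hc (calc_codes ha)).and (CalcP.lt hd (calc_dim ha')))
    ((hc.div (calc_two_pow ha (calc_offset ha' hd') h2)).mod
      (calc_two_pow ha ((calc_offset ha' hd1).sub (calc_offset ha' hd'))
        fun γ => (Nat.sub_le _ _).trans (h1 γ))) (.const 0)
  refine key.congr fun γ => ?_
  rw [digit]
  split_ifs with h3
  · rw [min_eq_left h3.2.le, min_eq_left (Nat.succ_le_of_lt h3.2)]
  · rfl

theorem calc_size (ha : 7 ≤ a) {t : Γ → ℕ} (ht : Calc t) : Calc fun γ : Γ =>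
    size (Scope.inp γ : Inp).g (Scope.inp γ : Inp).σ (t γ) := by
  have ha' : 5 ≤ a := by omega
  have h1 : Calc fun γ : Γ => (4 ^ (Scope.inp γ : Inp).g + 1) ^
      (horizon (Scope.inp γ : Inp).g (Scope.inp γ : Inp).σ - t γ) :=
    Calc.read (A := spec) 6 ((calc_horizon ha').sub ht) (by omega)
      fun γ => Nat.lt_succ_of_le (Nat.sub_le _ _)
  have h2 : Calc fun γ : Γ => 2 ^ (2 * (Scope.inp γ : Inp).g *
      min (t γ) (horizon (Scope.inp γ : Inp).g (Scope.inp γ : Inp).σ)) :=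
    calc_two_pow (by omega) (((Calc.const 2).mul (calc_g ha')).mul (ht.min (calc_horizon ha')))
      fun γ => (Scope.inp γ : Inp).le_bits (Nat.mul_le_mul (by omega) (by omega))
  refine (h1.mul h2).congr fun γ => ?_
  rw [size, pow_mul, pow_mul]
  norm_num

theorem calc_total (ha : 7 ≤ a) : Calc fun γ : Γ =>
    total (Scope.inp γ : Inp).g (Scope.inp γ : Inp).σ :=
  calc_size ha (calc_width (by omega))

theorem calc_n_pow (ha : 8 ≤ a) {f : Γ → ℕ} (hf : Calc f) (h : ∀ γ, f γ ≤ (Scope.inp γ : Inp).m) :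
    Calc fun γ : Γ => (Scope.inp γ : Inp).n ^ f γ :=
  Calc.read (A := spec) 7 hf (by omega) fun γ => Nat.lt_succ_of_le (h γ)

theorem calc_slack (ha : 8 ≤ a) : Calc fun γ : Γ => slack (Scope.inp γ : Inp).m
    (Scope.inp γ : Inp).n (Scope.inp γ : Inp).g (Scope.inp γ : Inp).σ :=
  ((Calc.const 3).mul (calc_n_pow ha (calc_m (by omega)) fun _ => le_rfl)).mul
    (calc_size (by omega) ((calc_layers (by omega)).sub (.const 1)))

/-- The floor without rounding: since P k ≤ 1, it is the number of c < total with c + 1 ≤ total * P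
k, each a comparison of reals. -/
theorem mass_eq (I : Inp) (k : ℕ) : mass I.g I.σ I.P k =
    ∑ c ∈ range (total I.g I.σ), if ((c + 1 : ℕ) : ℝ) ≤ I.P k * (total I.g I.σ : ℕ) then 1 else 0 := by
  have h0 := I.P_nonneg k
  have h1 := I.P_le k
  have h2 : mass I.g I.σ I.P k ≤ total I.g I.σ := by
    rw [mass]
    exact Nat.floor_le_of_le (mul_le_of_le_one_right (Nat.cast_nonneg _) h1)
  have h3 : (range (total I.g I.σ)).filter
      (fun c => ((c + 1 : ℕ) : ℝ) ≤ I.P k * (total I.g I.σ : ℕ)) = range (mass I.g I.σ I.P k) := by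
    ext c
    rw [mem_filter, mem_range, mem_range, mul_comm, ← Nat.le_floor_iff (by positivity)]
    change _ ∧ c + 1 ≤ mass I.g I.σ I.P k ↔ _
    omega
  rw [sum_boole, h3, card_range, Nat.cast_id]

theorem calc_mass (ha : 9 ≤ a) {f : Γ → ℕ} (hf : Calc f) : Calc fun γ : Γ =>
    mass (Scope.inp γ : Inp).g (Scope.inp γ : Inp).σ (Scope.inp γ : Inp).P (f γ) := by
  have ha' : 5 ≤ a := by omega
  refine (Calc.readIf (A := spec) 8 hf ((calc_m ha').mul (calc_n ha')) (by omega)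
    fun _ => le_rfl).congr fun γ => ?_
  split_ifs with h
  · rfl
  · rw [mass, Inp.P_eq_zero _ h]
    simp

theorem calcP_move (ha : 9 ≤ a) {ℓ c c' : Γ → ℕ} (hℓ : Calc ℓ) (hc : Calc c) (hc' : Calc c') :
    CalcP fun γ : Γ => Move (Scope.inp γ : Inp).m (Scope.inp γ : Inp).n (Scope.inp γ : Inp).g
      (Scope.inp γ : Inp).σ (mass (Scope.inp γ : Inp).g (Scope.inp γ : Inp).σ (Scope.inp γ : Inp).P)
      (ℓ γ) (c γ) (c' γ) := by
  have h5 : 5 ≤ a := by omega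
  have h6 : 6 ≤ a := by omega
  have h7 : 7 ≤ a := by omega
  unfold Move Step
  have hs := hℓ.div (calc_bins h5)
  have hb := hℓ.mod (calc_bins h5)
  have hi := hb.div (calc_n h5)
  have hR := (calc_demands (Γ := Γ) h5).add hi
  have hN := (calc_demands (Γ := Γ) h5).add (calc_m h5)
  refine CalcP.cond (CalcP.lt hb ((calc_m h5).mul (calc_n h5))) (CalcP.cond
    ((CalcP.le (calc_size h7 hs) (calc_mass ha hb)).and
      (CalcP.lt (calc_mass ha hb) (calc_size h7 (hs.sub (.const 1)))))
    (CalcP.and ?_ (CalcP.and ?_ (CalcP.and ?_ ?_))) ?_) (CalcP.and ?_ ?_)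
  · refine CalcP.forall (calc_dim h5) (CalcP.imp ((CalcP.eq ?_ ?_).not.and (CalcP.eq ?_ ?_).not)
      (CalcP.eq ?_ ?_))
    · exact (Calc.top _).div (calc_width h5)
    · exact hi.weaken _
    · exact Calc.top _
    · exact hR.weaken _
    · exact calc_digit h6 (hc'.weaken _) (Calc.top _)
    · exact calc_digit h6 (hc.weaken _) (Calc.top _)
  · refine CalcP.forall (calc_width h5) (CalcP.le ?_ ?_)
    · exact calc_digit h6 (hc'.weaken _) (((hi.weaken _).mul (calc_width h5)).add (Calc.top _))
    · exact calc_digit h6 (hc.weaken _) (((hi.weaken _).mul (calc_width h5)).add (Calc.top _))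
  · exact CalcP.le (calc_digit h6 hc hR) (calc_digit h6 hc' hR)
  · refine CalcP.eq ((calc_digit h6 hc' hR).add (Calc.sum (calc_width h5) (Calc.mul (Calc.sub ?_ ?_)
      ?_))) ((calc_digit h6 hc hR).add (calc_mass ha hb))
    · exact calc_digit h6 (hc.weaken _) (((hi.weaken _).mul (calc_width h5)).add (Calc.top _))
    · exact calc_digit h6 (hc'.weaken _) (((hi.weaken _).mul (calc_width h5)).add (Calc.top _))
    · exact calc_size h7 ((hs.weaken _).add (Calc.top _))
  · refine CalcP.forall (calc_dim h5) (CalcP.eq ?_ ?_)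
    · exact calc_digit h6 (hc'.weaken _) (Calc.top _)
    · exact calc_digit h6 (hc.weaken _) (Calc.top _)
  · exact CalcP.eq (calc_digit h6 hc' (hN.add (.const 1))) ((calc_digit h6 hc (hN.add (.const 1))).add
      ((calc_digit h6 hc' hN).mul ((calc_size h7 (hs.add (calc_width h5))).mul hs)))
  · refine CalcP.forall (calc_m h5) (CalcP.and (CalcP.eq ?_ (.const 0)) (CalcP.and
      (CalcP.forall ((calc_width h5).sub (.const 1)) (CalcP.eq ?_ ?_)) (CalcP.and
        (CalcP.le ?_ ?_) (CalcP.eq ?_ ?_))))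
    · exact calc_digit h6 (hc.weaken _) ((Calc.top _).mul (calc_width h5))
    · exact calc_digit h6 ((hc'.weaken _).weaken _)
        ((((Calc.top _).weaken _).mul (calc_width h5)).add (Calc.top _))
    · exact calc_digit h6 ((hc.weaken _).weaken _)
        (((((Calc.top _).weaken _).mul (calc_width h5)).add (Calc.top _)).add (.const 1))
    · exact calc_digit h6 (hc'.weaken _)
        (((Calc.top _).mul (calc_width h5)).add ((calc_width h5).sub (.const 1)))
    · exact calc_digit h6 (hc'.weaken _) (hN.weaken _)
    · exact (calc_digit h6 (hc'.weaken _) ((calc_demands h5).add (Calc.top _))).add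
        (((calc_digit h6 (hc'.weaken _) (hN.weaken _)).sub (calc_digit h6 (hc'.weaken _)
          (((Calc.top _).mul (calc_width h5)).add ((calc_width h5).sub (.const 1))))).mul
          (calc_size h7 ((hs.weaken _).add (calc_width h5))))
    · exact calc_digit h6 (hc.weaken _) ((calc_demands h5).add (Calc.top _))

end

end MinEntropyCoupling

/-! ### Filling the arrays of the search -/

namespace RealRAM

/-- Powers are tabulated by one multiplication with the preceding cell. -/
theorem Calc.powRec {ι : Type} {A : Spec ι} {a : ℕ} (B : ι → ℕ)
    (hB : Calc fun γ : FillRec A a => B γ.inp) (hval : ∀ I k, A.val a I k = B I ^ k) :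
    Calc fun γ : FillRec A a => A.val a γ.inp γ.k := by
  refine (CalcP.ite (p := fun γ : FillRec A a => γ.k = 0) (CalcP.eq fillRecIndex (.const 0))
    (.const 1) (hB.mul (Calc.selfIf (fillRecIndex.sub (.const 1)) fillRecIndex
      fun _ => le_rfl))).congr fun γ => ?_
  split_ifs with h1 h2
  · rw [hval, h1, pow_zero]
  · change B γ.inp * A.val a γ.inp (γ.k - 1) = _
    rw [hval, hval, ← pow_succ', Nat.sub_add_cancel (by omega)]
  · omega

end RealRAM

namespace MinEntropyCoupling

open Finset RealRAM

open Classical in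
theorem spec_reach {I : Inp} {ℓ c : ℕ} (hc : c < codes I.m I.g I.σ) :
    spec.val 9 I (ℓ * codes I.m I.g I.σ + c) =
      if Reach I.m I.n I.g I.σ (mass I.g I.σ I.P) ℓ c then 1 else 0 := by
  change (if Reach I.m I.n I.g I.σ (mass I.g I.σ I.P) ((ℓ * codes I.m I.g I.σ + c) /
    codes I.m I.g I.σ) ((ℓ * codes I.m I.g I.σ + c) % codes I.m I.g I.σ) then 1 else 0) = _
  exact if_congr (by rw [layer_div hc, layer_mod hc]) rfl rfl

section

variable {a : ℕ} {Γ : Type} [Scope spec a Γ]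

theorem calcP_reach (ha : 10 ≤ a) {ℓ c : Γ → ℕ} (hℓ : Calc ℓ) (hc : Calc c)
    (h₁ : ∀ γ, ℓ γ ≤ steps (Scope.inp γ : Inp).m (Scope.inp γ : Inp).n (Scope.inp γ : Inp).g
      (Scope.inp γ : Inp).σ)
    (h₂ : ∀ γ, c γ < codes (Scope.inp γ : Inp).m (Scope.inp γ : Inp).g (Scope.inp γ : Inp).σ) :
    CalcP fun γ : Γ => Reach (Scope.inp γ : Inp).m (Scope.inp γ : Inp).n (Scope.inp γ : Inp).g
      (Scope.inp γ : Inp).σ (mass (Scope.inp γ : Inp).g (Scope.inp γ : Inp).σ (Scope.inp γ : Inp).P)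
      (ℓ γ) (c γ) := by
  refine (Calc.read (A := spec) 9 ((hℓ.mul (calc_codes (by omega))).add hc) (by omega)
    fun γ => ?_).congr fun γ => ?_
  · exact idx_lt (Nat.lt_succ_of_le (h₁ γ)) (h₂ γ)
  · exact spec_reach (h₂ γ)

theorem calcP_accept (ha : 8 ≤ a) {c : Γ → ℕ} (hc : Calc c) :
    CalcP fun γ : Γ => Accept (Scope.inp γ : Inp).m (Scope.inp γ : Inp).g (Scope.inp γ : Inp).σ
      (slack (Scope.inp γ : Inp).m (Scope.inp γ : Inp).n (Scope.inp γ : Inp).g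
        (Scope.inp γ : Inp).σ) (c γ) := by
  have h5 : 5 ≤ a := by omega
  have h6 : 6 ≤ a := by omega
  unfold Accept
  exact CalcP.and (CalcP.forall (calc_demands h5) (CalcP.eq
    (calc_digit h6 (hc.weaken _) (Calc.top _)) (.const 0)))
    (CalcP.le (calc_digit h6 hc (calc_demands h5)) (calc_slack ha))

theorem calc_best (ha : 11 ≤ a) {ℓ d : Γ → ℕ} (hℓ : Calc ℓ) (hd : Calc d) :
    Calc fun γ : Γ => best (Scope.inp γ : Inp).m (Scope.inp γ : Inp).n (Scope.inp γ : Inp).g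
      (Scope.inp γ : Inp).σ (Scope.inp γ : Inp).P (ℓ γ) (d γ) :=
  calc_digit (by omega) (Calc.read (A := spec) 10 ((calc_steps (by omega)).sub hℓ) (by omega)
    fun _ => Nat.lt_succ_of_le (Nat.sub_le _ _)) hd

theorem calc_startTime (ha : 5 ≤ a) {t : Γ → ℕ} (ht : Calc t) :
    Calc fun γ : Γ => startTime (Scope.inp γ : Inp).m (Scope.inp γ : Inp).n
      (width (Scope.inp γ : Inp).g) (t γ) :=
  ((ht.sub (calc_width ha)).add (.const 1)).mul (calc_bins ha)

theorem calc_number (ha : 11 ≤ a) {t : Γ → ℕ} (ht : Calc t) :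
    Calc fun γ : Γ => number (Scope.inp γ : Inp).m (Scope.inp γ : Inp).n (Scope.inp γ : Inp).g
      (Scope.inp γ : Inp).σ (Scope.inp γ : Inp).P (t γ) :=
  calc_best ha (calc_startTime (by omega) ht) ((calc_demands (by omega)).add (calc_m (by omega)))

theorem calc_remaining (ha : 11 ≤ a) {i t ℓ : Γ → ℕ} (hi : Calc i) (ht : Calc t) (hℓ : Calc ℓ) :
    Calc fun γ : Γ => remaining (Scope.inp γ : Inp).m (Scope.inp γ : Inp).n
      (width (Scope.inp γ : Inp).g) (best (Scope.inp γ : Inp).m (Scope.inp γ : Inp).n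
        (Scope.inp γ : Inp).g (Scope.inp γ : Inp).σ (Scope.inp γ : Inp).P) (i γ) (t γ) (ℓ γ) := by
  have h5 : 5 ≤ a := by omega
  have hs := hℓ.div (calc_bins h5)
  exact CalcP.ite (CalcP.le hs ht) (calc_best ha hℓ ((hi.mul (calc_width h5)).add (ht.sub hs)))
    (.const 0)

theorem calc_restSpace (ha : 11 ≤ a) {i ℓ : Γ → ℕ} (hi : Calc i) (hℓ : Calc ℓ) :
    Calc fun γ : Γ => restSpace (Scope.inp γ : Inp).m (Scope.inp γ : Inp).n
      (width (Scope.inp γ : Inp).g) (best (Scope.inp γ : Inp).m (Scope.inp γ : Inp).n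
        (Scope.inp γ : Inp).g (Scope.inp γ : Inp).σ (Scope.inp γ : Inp).P) (i γ) (ℓ γ) := by
  have h5 : 5 ≤ a := by omega
  exact CalcP.ite (CalcP.lt (hℓ.mod (calc_bins h5)) ((calc_m h5).mul (calc_n h5)))
    ((calc_best ha (hℓ.add (.const 1)) ((calc_demands h5).add hi)).sub
      (calc_best ha hℓ ((calc_demands h5).add hi))) (.const 0)

theorem calc_cell (ha : 11 ≤ a) {i t o : Γ → ℕ} (hi : Calc i) (ht : Calc t) (ho : Calc o) :
    Calc fun γ : Γ => cell (Scope.inp γ : Inp).m (Scope.inp γ : Inp).n (Scope.inp γ : Inp).g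
      (Scope.inp γ : Inp).σ (Scope.inp γ : Inp).P (i γ) (t γ) (o γ) := by
  have h5 : 5 ≤ a := by omega
  have h7 : 7 ≤ a := by omega
  unfold cell Chain.cellState bin
  refine ((CalcP.ite (CalcP.lt ho (Calc.mul (Calc.sub (calc_number ha ht) (calc_remaining ha hi ht
    (calc_startTime h5 ht))) (calc_size h7 ht))) (Calc.countLt (calc_steps h5) (CalcP.le
      (Calc.sum ((Calc.top _).add (.const 1)) ?_) (Calc.add (Calc.filterIco (calc_layers h5) ?_ ?_)
      (ho.weaken _)))) (Calc.countLt (calc_steps h5) (CalcP.or (CalcP.lt (Calc.top _)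
        ?_) (CalcP.le (Calc.mul (Calc.sub ?_ ?_) ?_) ?_)))).mod (calc_bins h5)).mod (calc_n h5)
  · exact calc_restSpace ha ((hi.weaken _).weaken _) (Calc.top _)
  · exact CalcP.lt ((calc_width h5).add (Calc.top _)) ((ht.weaken _).weaken _)
  · exact ((calc_number ha ((calc_width h5).add (Calc.top _))).sub (calc_remaining ha
      ((hi.weaken _).weaken _) ((calc_width h5).add (Calc.top _)) (calc_startTime h5
        ((calc_width h5).add (Calc.top _))))).mul (calc_size h7 ((calc_width h5).add (Calc.top _)))
  · exact calc_startTime h5 (ht.weaken _)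
  · exact calc_number ha (ht.weaken _)
  · exact calc_remaining ha (hi.weaken _) (ht.weaken _) ((Calc.top _).add (.const 1))
  · exact calc_size h7 (ht.weaken _)
  · exact ho.weaken _

theorem calc_jointCount (ha : 11 ≤ a) {y : Γ → ℕ} (hy : Calc y) :
    Calc fun γ : Γ => jointCount (Scope.inp γ : Inp).m (Scope.inp γ : Inp).n
      (window (Scope.inp γ : Inp).g (Scope.inp γ : Inp).σ) (number (Scope.inp γ : Inp).m
        (Scope.inp γ : Inp).n (Scope.inp γ : Inp).g (Scope.inp γ : Inp).σ (Scope.inp γ : Inp).P)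
      (size (Scope.inp γ : Inp).g (Scope.inp γ : Inp).σ) (cell (Scope.inp γ : Inp).m
        (Scope.inp γ : Inp).n (Scope.inp γ : Inp).g (Scope.inp γ : Inp).σ (Scope.inp γ : Inp).P)
      (y γ) := by
  have h5 : 5 ≤ a := by omega
  unfold jointCount window
  refine Calc.sumIco (calc_layers h5) ?_
  have ht : Calc fun γ : Push Γ (fun γ => layers (Scope.inp γ : Inp).g (Scope.inp γ : Inp).σ) =>
      width (Scope.inp γ.base : Inp).g + γ.k := (calc_width h5).add (Calc.top _)
  refine Calc.sum ((calc_number ha ht).mul (calc_size (by omega) ht)) ?_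
  refine CalcP.calc (CalcP.eq ?_ ((hy.weaken _).weaken _))
  refine Calc.sum (calc_m h5) (Calc.mul ?_ ?_)
  · exact calc_cell ha (Calc.top _) ((ht.weaken _).weaken _) ((Calc.top _).weaken _)
  · exact calc_n_pow (by omega) (Calc.top _) fun γ => γ.lt.le

theorem calc_stateCount (ha : 11 ≤ a) {i j : Γ → ℕ} (hi : Calc i) (hj : Calc j) :
    Calc fun γ : Γ => stateCount (window (Scope.inp γ : Inp).g (Scope.inp γ : Inp).σ)
      (number (Scope.inp γ : Inp).m (Scope.inp γ : Inp).n (Scope.inp γ : Inp).g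
        (Scope.inp γ : Inp).σ (Scope.inp γ : Inp).P)
      (size (Scope.inp γ : Inp).g (Scope.inp γ : Inp).σ) (cell (Scope.inp γ : Inp).m
        (Scope.inp γ : Inp).n (Scope.inp γ : Inp).g (Scope.inp γ : Inp).σ (Scope.inp γ : Inp).P)
      (i γ) (j γ) := by
  have h5 : 5 ≤ a := by omega
  unfold stateCount window
  refine Calc.sumIco (calc_layers h5) ?_
  have ht : Calc fun γ : Push Γ (fun γ => layers (Scope.inp γ : Inp).g (Scope.inp γ : Inp).σ) =>
      width (Scope.inp γ.base : Inp).g + γ.k := (calc_width h5).add (Calc.top _)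
  refine Calc.sum ((calc_number ha ht).mul (calc_size (by omega) ht)) ?_
  refine CalcP.calc (CalcP.eq ?_ ((hj.weaken _).weaken _))
  exact calc_cell ha ((hi.weaken _).weaken _) (ht.weaken _) (Calc.top _)

theorem calc_cellCount (ha : 11 ≤ a) :
    Calc fun γ : Γ => cellCount (window (Scope.inp γ : Inp).g (Scope.inp γ : Inp).σ)
      (number (Scope.inp γ : Inp).m (Scope.inp γ : Inp).n (Scope.inp γ : Inp).g
        (Scope.inp γ : Inp).σ (Scope.inp γ : Inp).P)
      (size (Scope.inp γ : Inp).g (Scope.inp γ : Inp).σ) := by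
  have h5 : 5 ≤ a := by omega
  unfold cellCount window
  refine Calc.sumIco (calc_layers h5) ?_
  have ht : Calc fun γ : Push Γ (fun γ => layers (Scope.inp γ : Inp).g (Scope.inp γ : Inp).σ) =>
      width (Scope.inp γ.base : Inp).g + γ.k := (calc_width h5).add (Calc.top _)
  exact (calc_number ha ht).mul (calc_size (by omega) ht)

end

theorem ratio_pow_le (I : Inp) {k : ℕ} (hk : k ≤ horizon I.g I.σ) :
    (4 ^ I.g + 1) ^ k ≤ 2 ^ I.bits := by
  have hle : 4 ^ I.g + 1 ≤ 2 ^ (2 * I.g + 1) := by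
    rw [pow_succ, pow_mul]
    have : 0 < 4 ^ I.g := by positivity
    norm_num
  refine (Nat.pow_le_pow_left hle _).trans ?_
  rw [← pow_mul]
  exact Nat.pow_le_pow_right two_pos (I.le_bits (Nat.mul_le_mul (by omega) hk))

/-- The table of reached codes is filled row by row: a row depends on the preceding one, which has
smaller indices in the same array. -/
theorem realizable_reach (h : spec.Realizable 5) : spec.Realizable 10 := by
  have h6 : spec.Realizable 6 := h.fillRec ((calc_bits le_rfl).add (.const 1))
    (Calc.powRec (fun _ => 2) (.const 2) fun _ _ => rfl)
    ⟨1, fun I k hk => by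
      rw [pow_one]
      exact Nat.pow_le_pow_right two_pos (Nat.le_of_lt_succ hk)⟩
  have h7 : spec.Realizable 7 := h6.fillRec ((calc_horizon (by omega)).add (.const 1))
    (Calc.powRec (fun I => 4 ^ I.g + 1)
      ((calc_K (a := 6) (Γ := FillRec spec 6) (by omega)).add (.const 1)) fun _ _ => rfl)
    ⟨1, fun I k hk => by
      rw [pow_one]
      exact ratio_pow_le I (Nat.le_of_lt_succ hk)⟩
  have h8 : spec.Realizable 8 := h7.fillRec ((calc_m (by omega)).add (.const 1))
    (Calc.powRec (fun I => I.n) (calc_n (a := 7) (Γ := FillRec spec 7) (by omega)) fun _ _ => rfl)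
    ⟨1, fun I k hk => by
      rw [pow_one]
      exact (Nat.pow_le_pow_right I.n_pos (Nat.le_of_lt_succ hk)).trans I.n_pow_le⟩
  have h9 : spec.Realizable 9 := by
    refine h8.fill ((calc_m (by omega)).mul (calc_n (by omega))) ?_
    refine Calc.congr (Calc.sum (calc_total (by omega)) (F := fun (γ : Fill spec 8) c =>
      if ((c + 1 : ℕ) : ℝ) ≤ γ.inp.P γ.k * (total γ.inp.g γ.inp.σ : ℕ) then 1 else 0)
      (CalcP.calc (CalcP.realLe 1 ((Calc.top _).add (.const 1)) (Calc.fillIndex.weaken _)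
        (calc_total (by omega))))) fun γ => ?_
    exact (mass_eq γ.inp γ.k).symm
  refine h9.fillRec (((calc_steps (by omega)).add (.const 1)).mul (calc_codes (by omega))) ?_
    ⟨1, fun I k _ => ?_⟩
  · have hZ : Calc fun γ : FillRec spec 9 => codes γ.inp.m γ.inp.g γ.inp.σ := calc_codes (by omega)
    have hℓ := Calc.fillRecIndex.div hZ
    have hc := Calc.fillRecIndex.mod hZ
    -- The guard is needed for the row ℓ = 0 only; in later rows, cell b of the preceding row always
    -- precedes the current one.
    have hself := Calc.selfIf (a := 9) (A := spec) ((((hℓ.sub (.const 1)).mul hZ).weaken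
      (fun γ : FillRec spec 9 => codes γ.inp.m γ.inp.g γ.inp.σ)).add (Calc.top _))
      (Calc.fillRecIndex.weaken _) fun _ => le_rfl
    have key := CalcP.cond (CalcP.eq hℓ (.const 0)) (CalcP.eq hc (.const 0))
      (CalcP.exists hZ (p := fun γ b =>
        (if (γ.k / codes γ.inp.m γ.inp.g γ.inp.σ - 1) * codes γ.inp.m γ.inp.g γ.inp.σ + b < γ.k
          then spec.val 9 γ.inp ((γ.k / codes γ.inp.m γ.inp.g γ.inp.σ - 1) *
            codes γ.inp.m γ.inp.g γ.inp.σ + b) else 0) = 1 ∧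
        Move γ.inp.m γ.inp.n γ.inp.g γ.inp.σ (mass γ.inp.g γ.inp.σ γ.inp.P)
          (γ.k / codes γ.inp.m γ.inp.g γ.inp.σ - 1) b (γ.k % codes γ.inp.m γ.inp.g γ.inp.σ))
        (CalcP.and (CalcP.eq hself (.const 1)) (calcP_move le_rfl ((hℓ.sub (.const 1)).weaken _)
          (Calc.top _) (hc.weaken _))))
    refine (CalcP.congr (r := fun γ : FillRec spec 9 => Reach γ.inp.m γ.inp.n γ.inp.g γ.inp.σ
      (mass γ.inp.g γ.inp.σ γ.inp.P) (γ.k / codes γ.inp.m γ.inp.g γ.inp.σ)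
      (γ.k % codes γ.inp.m γ.inp.g γ.inp.σ)) key fun γ => ?_)
    by_cases h0 : γ.k / codes γ.inp.m γ.inp.g γ.inp.σ = 0
    · rw [if_pos h0, h0]
      rfl
    · rw [if_neg h0]
      obtain ⟨ℓ, hℓ'⟩ := Nat.exists_eq_succ_of_ne_zero h0
      rw [hℓ', Nat.succ_sub_one, Reach]
      refine exists_congr fun b => and_congr_right fun hb => and_congr_left fun _ => ?_
      have h1 : ℓ * codes γ.inp.m γ.inp.g γ.inp.σ + b < γ.k := by
        have h2 := Nat.div_mul_le_self γ.k (codes γ.inp.m γ.inp.g γ.inp.σ)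
        rw [hℓ', Nat.succ_mul] at h2
        omega
      rw [if_pos h1, spec_reach hb]
      simp
  · have := spec.two_le_size I
    rw [pow_one]
    simp only [spec]
    split_ifs <;> [exact this.trans' one_le_two; exact Nat.zero_le _]

theorem realizable_path (h : spec.Realizable 10) : spec.Realizable 11 := by
  refine h.fillRec ((calc_steps (by omega)).add (.const 1)) ?_ ⟨1, fun I k _ => ?_⟩
  · have hZ : Calc fun γ : FillRec spec 10 => codes γ.inp.m γ.inp.g γ.inp.σ :=
      calc_codes (by omega)
    have hL : Calc fun γ : FillRec spec 10 => steps γ.inp.m γ.inp.n γ.inp.g γ.inp.σ :=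
      calc_steps (by omega)
    have hself := Calc.selfIf (a := 10) (A := spec) (Calc.fillRecIndex.sub (.const 1))
      Calc.fillRecIndex fun _ => le_rfl
    have key := CalcP.ite (CalcP.eq Calc.fillRecIndex (.const 0))
      (Calc.least hZ (p := fun γ c => Reach γ.inp.m γ.inp.n γ.inp.g γ.inp.σ
        (mass γ.inp.g γ.inp.σ γ.inp.P) (steps γ.inp.m γ.inp.n γ.inp.g γ.inp.σ) c ∧
        Accept γ.inp.m γ.inp.g γ.inp.σ (slack γ.inp.m γ.inp.n γ.inp.g γ.inp.σ) c)
        (CalcP.and (calcP_reach le_rfl (calc_steps (by omega)) (Calc.top _) (fun _ => le_rfl)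
          fun γ => (Nat.le_of_lt_succ γ.lt).trans_lt γ.base.lt)
          (calcP_accept (by omega) (Calc.top _))))
      (Calc.least hZ (p := fun γ c => Reach γ.inp.m γ.inp.n γ.inp.g γ.inp.σ
        (mass γ.inp.g γ.inp.σ γ.inp.P) (steps γ.inp.m γ.inp.n γ.inp.g γ.inp.σ - γ.k) c ∧
        Move γ.inp.m γ.inp.n γ.inp.g γ.inp.σ (mass γ.inp.g γ.inp.σ γ.inp.P)
          (steps γ.inp.m γ.inp.n γ.inp.g γ.inp.σ - γ.k) c
          (if γ.k - 1 < γ.k then spec.val 10 γ.inp (γ.k - 1) else 0))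
        (CalcP.and (calcP_reach le_rfl (((hL.sub Calc.fillRecIndex).weaken _).weaken _)
            (Calc.top _) (fun _ => Nat.sub_le _ _)
          fun γ => (Nat.le_of_lt_succ γ.lt).trans_lt γ.base.lt)
          (calcP_move (by omega) (((hL.sub Calc.fillRecIndex).weaken _).weaken _) (Calc.top _)
            ((hself.weaken _).weaken _))))
    refine key.congr fun γ => ?_
    change _ = path _ _ _ _ _ _ γ.k
    cases hk : γ.k with
    | zero =>
      rw [if_pos rfl, path]
    | succ r =>
      rw [if_neg (by omega), Nat.add_sub_cancel, if_pos (by omega), path]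
      rfl
  · rw [pow_one]
    change path _ _ _ _ _ _ k ≤ codes _ _ _
    cases k <;> exact least_le _ _

theorem realizable_counts (h : spec.Realizable 11) : spec.Realizable 21 := by
  have h12 : spec.Realizable 12 :=
    h.fill (calc_n_pow (by omega) (calc_m (by omega)) fun _ => le_rfl)
      (calc_jointCount (by omega) Calc.fillIndex)
  have h13 : spec.Realizable 13 :=
    h12.fill ((calc_m (by omega)).mul (calc_n (by omega))) (calc_stateCount (by omega)
      (Calc.fillIndex.div (calc_n (by omega))) (Calc.fillIndex.mod (calc_n (by omega))))
  have h14 : spec.Realizable 14 := h13.fill (.const 1) (calc_cellCount (by omega))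
  have h15 : spec.Realizable 15 := h14.fill (.const 1) (calc_total (by omega))
  have h16 : spec.Realizable 16 := by
    refine h15.fill ((calc_n_pow (by omega) (calc_m (by omega)) fun _ => le_rfl).mul
      ((calc_m (by omega)).add (.const 1))) ?_
    exact CalcP.calc (CalcP.eq (Calc.fillIndex.mod ((calc_m (by omega)).add (.const 1))) (.const 0))
  have h17 : spec.Realizable 17 := by
    refine h16.fill ((calc_n_pow (by omega) (calc_m (by omega)) fun _ => le_rfl).mul
      ((calc_m (by omega)).add (.const 1))) ?_
    have hi : Calc fun γ : Fill spec 16 => γ.k % (γ.inp.m + 1) - 1 :=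
      (Calc.fillIndex.mod ((calc_m (by omega)).add (.const 1))).sub (.const 1)
    exact (hi.mul (calc_n (by omega))).add (((Calc.fillIndex.div ((calc_m (by omega)).add
      (.const 1))).div (calc_n_pow (by omega) hi fun γ => by
        have : γ.k % (γ.inp.m + 1) < γ.inp.m + 1 := Nat.mod_lt _ (Nat.succ_pos _)
        change _ ≤ γ.inp.m
        omega)).mod (calc_n (by omega)))
  have h18 : spec.Realizable 18 := h17.fill (calc_n_pow (by omega) (calc_m (by omega))
    fun _ => le_rfl) ((Calc.fillIndex.mul ((calc_m (by omega)).add (.const 1))).add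
      (calc_m (by omega)))
  have h19 : spec.Realizable 19 :=
    h18.fill (.const 1) ((calc_m (by omega)).mul (calc_n (by omega)))
  have h20 : spec.Realizable 20 := h19.fill (.const 1)
    ((calc_n_pow (by omega) (calc_m (by omega)) fun _ => le_rfl).mul
      ((calc_m (by omega)).add (.const 1)))
  exact h20.fill (.const 1) (calc_n_pow (by omega) (calc_m (by omega)) fun _ => le_rfl)

end MinEntropyCoupling

/-! ### The program -/

namespace MinEntropyCoupling

open Finset RealRAM

/-- Memory with `u`, `v`, `w`, `y`, `z` in cell zero of the integer arrays from `1` to `5`. -/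
def fiveCells (u v w y z : ℕ) (b k : ℕ) : ℕ :=
  if k = 0 then
    if b = 0 then u else if b = 1 then v else if b = 2 then w else if b = 3 then y
    else if b = 4 then z else 0
  else 0

/-- Integer array 0 will be scratch memory, so m and n are moved away first. The 32 = 2 ^ 5 is to be
doubled m times. -/
def loadProg : Prog :=
  .seq (.setNat 1 (.const 0) (.load 0 (.const 0)))
  (.seq (.setNat 2 (.const 0) (.load 0 (.const 1)))
  (.seq (.setNat 0 (.const 2) (.const 32))
  (.setNat 0 (.const 3) (.const 0))))

def powProg : Prog :=
  .loop (.natLe (.add (.load 0 (.const 3)) (.const 1)) (.load 1 (.const 0)))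
    (.seq (.setNat 0 (.const 2) (.add (.load 0 (.const 2)) (.load 0 (.const 2))))
    (.setNat 0 (.const 3) (.add (.load 0 (.const 3)) (.const 1))))

/-- Doubles 2 ^ g until 2 ^ (m + 5) ≤ ε * 2 ^ g, which yields g without logarithms. -/
def precisionProg : Prog :=
  .loop (.not (.realLe (.ofNat (.load 0 (.const 2)))
      (.mul (.load 0 (.const 0)) (.ofNat (.load 5 (.const 0))))))
    (.seq (.setNat 5 (.const 0) (.add (.load 5 (.const 0)) (.load 5 (.const 0))))
    (.setNat 3 (.const 0) (.add (.load 3 (.const 0)) (.const 1))))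

def logProg : Prog :=
  .loop (.not (.natLe (.load 2 (.const 0)) (.load 0 (.const 4))))
    (.seq (.setNat 0 (.const 4) (.add (.load 0 (.const 4)) (.load 0 (.const 4))))
    (.setNat 4 (.const 0) (.add (.load 4 (.const 0)) (.const 1))))

theorem loadProg_spec (I : Inp) : ∃ t s, Runs loadProg I.mem t s ∧ t ≤ 100 ∧
    (∀ b k, s.nat (b + 1) k = fiveCells I.m I.n 0 0 0 b k) ∧ s.nat 0 2 = 32 ∧ s.nat 0 3 = 0 ∧
    s.real = I.mem.real := by
  refine ⟨_, _, .seq (.setNat _ _ _ _) (.seq (.setNat _ _ _ _) (.seq (.setNat _ _ _ _)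
    (.setNat _ _ _ _))), by simp [NatExpr.cost], fun b k => ?_, ?_, ?_, ?_⟩
  · simp [NatExpr.eval, Inp.mem, input, fiveCells]
    split_ifs <;> omega
  · simp [NatExpr.eval]
  · simp [NatExpr.eval]
  · simp

theorem powProg_spec (I : Inp) {s : Mem}
    (h : ∀ b k, s.nat (b + 1) k = fiveCells I.m I.n 0 0 0 b k) (h2 : s.nat 0 2 = 32)
    (h3 : s.nat 0 3 = 0) (hr : s.real = I.mem.real) :
    ∃ t s', Runs powProg s t s' ∧ t ≤ I.m * 100 + 100 ∧
      (∀ b k, s'.nat (b + 1) k = fiveCells I.m I.n 0 0 0 b k) ∧ s'.nat 0 2 = 2 ^ (I.m + 5) ∧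
      s'.real = I.mem.real := by
  obtain ⟨t, s', r, ht, h4, h5, h6, h7⟩ := Runs.loop_count
    (b := .natLe (.add (.load 0 (.const 3)) (.const 1)) (.load 1 (.const 0)))
    (P := .seq (.setNat 0 (.const 2) (.add (.load 0 (.const 2)) (.load 0 (.const 2))))
      (.setNat 0 (.const 3) (.add (.load 0 (.const 3)) (.const 1))))
    (I := fun j s => (∀ b k, s.nat (b + 1) k = fiveCells I.m I.n 0 0 0 b k) ∧
      s.nat 0 2 = 2 ^ (j + 5) ∧ s.nat 0 3 = j ∧ s.real = I.mem.real)
    (N := I.m) (B := 20) (by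
      rintro j hj s ⟨e1, e2, e3, e4⟩
      have e5 := e1 0 0
      simp only [zero_add, fiveCells, if_true] at e5
      refine ⟨by simp [Test.Holds, NatExpr.eval, e3, e5]; omega, _, _,
        .seq (.setNat _ _ _ _) (.setNat _ _ _ _), by simp [NatExpr.cost], ?_, ?_, ?_, ?_⟩
      · intro b k
        simp [e1]
      · simp [NatExpr.eval, e2]
        ring
      · simp [NatExpr.eval, e3]
      · simp [e4])
    (by
      rintro s ⟨e1, e2, e3, e4⟩
      have e5 := e1 0 0
      simp only [zero_add, fiveCells, if_true] at e5
      simp [Test.Holds, NatExpr.eval, e3, e5])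
    (Nat.zero_le _) ⟨h, h2, h3, hr⟩
  simp only [Test.cost, NatExpr.cost] at ht
  exact ⟨t, s', r, by omega, h4, h5, h7⟩

theorem precisionProg_spec (I : Inp) {s : Mem}
    (h : ∀ b k, s.nat (b + 1) k = fiveCells I.m I.n 0 0 1 b k) (h2 : s.nat 0 2 = 2 ^ (I.m + 5))
    (hr : s.real = I.mem.real) :
    ∃ t s', Runs precisionProg s t s' ∧ t ≤ I.g * 100 + 100 ∧
      (∀ b k, s'.nat (b + 1) k = fiveCells I.m I.n I.g 0 (2 ^ I.g) b k) ∧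
      s'.real = I.mem.real := by
  obtain ⟨t, s', r, ht, h4, h5, h6⟩ := Runs.loop_count
    (b := .not (.realLe (.ofNat (.load 0 (.const 2)))
      (.mul (.load 0 (.const 0)) (.ofNat (.load 5 (.const 0))))))
    (P := .seq (.setNat 5 (.const 0) (.add (.load 5 (.const 0)) (.load 5 (.const 0))))
      (.setNat 3 (.const 0) (.add (.load 3 (.const 0)) (.const 1))))
    (I := fun j s => (∀ b k, s.nat (b + 1) k = fiveCells I.m I.n j 0 (2 ^ j) b k) ∧
      s.nat 0 2 = 2 ^ (I.m + 5) ∧ s.real = I.mem.real)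
    (N := I.g) (B := 20) (by
      rintro j hj s ⟨e1, e2, e3⟩
      have e5 : s.nat 5 0 = 2 ^ j := e1 4 0
      have e6 : s.nat 3 0 = j := e1 2 0
      have e7 : s.real 0 0 = I.ε := by rw [e3]; rfl
      refine ⟨?_, _, _, .seq (.setNat _ _ _ _) (.setNat _ _ _ _), by simp [NatExpr.cost],
        ?_, ?_, ?_⟩
      · simp only [Test.Holds, RealExpr.eval, NatExpr.eval, e2, e5, e7]
        exact Nat.find_min I.exists_g hj
      · intro b k
        simp only [Mem.setNat_nat, NatExpr.eval, e5, e6, e1, fiveCells, pow_succ]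
        split_ifs <;> omega
      · simp [e2]
      · simp [e3])
    (by
      rintro s ⟨e1, e2, e3⟩
      have e5 : s.nat 5 0 = 2 ^ I.g := e1 4 0
      have e7 : s.real 0 0 = I.ε := by rw [e3]; rfl
      simp only [Test.Holds, RealExpr.eval, NatExpr.eval, e2, e5, e7, not_not]
      exact Nat.find_spec I.exists_g)
    (Nat.zero_le _) ⟨h, h2, hr⟩
  simp only [Test.cost, NatExpr.cost, RealExpr.cost] at ht
  exact ⟨t, s', r, by omega, h4, h6⟩

theorem logProg_spec (I : Inp) {s : Mem}
    (h : ∀ b k, s.nat (b + 1) k = fiveCells I.m I.n I.g 0 (2 ^ I.g) b k) (h2 : s.nat 0 4 = 1)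
    (hr : s.real = I.mem.real) :
    ∃ t s', Runs logProg s t s' ∧ t ≤ I.h * 100 + 100 ∧
      (∀ b k, s'.nat (b + 1) k = fiveCells I.m I.n I.g I.h (2 ^ I.g) b k) ∧
      s'.real = I.mem.real := by
  obtain ⟨t, s', r, ht, h4, h5, h6⟩ := Runs.loop_count
    (b := .not (.natLe (.load 2 (.const 0)) (.load 0 (.const 4))))
    (P := .seq (.setNat 0 (.const 4) (.add (.load 0 (.const 4)) (.load 0 (.const 4))))
      (.setNat 4 (.const 0) (.add (.load 4 (.const 0)) (.const 1))))
    (I := fun j s => (∀ b k, s.nat (b + 1) k = fiveCells I.m I.n I.g j (2 ^ I.g) b k) ∧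
      s.nat 0 4 = 2 ^ j ∧ s.real = I.mem.real)
    (N := I.h) (B := 20) (by
      rintro j hj s ⟨e1, e2, e3⟩
      have e5 : s.nat 2 0 = I.n := e1 1 0
      have e6 : s.nat 4 0 = j := e1 3 0
      refine ⟨?_, _, _, .seq (.setNat _ _ _ _) (.setNat _ _ _ _), by simp [NatExpr.cost],
        ?_, ?_, ?_⟩
      · simp only [Test.Holds, NatExpr.eval, e2, e5]
        exact fun hle => absurd (Nat.clog_le_of_le_pow hle) (not_le.2 hj)
      · intro b k
        simp [NatExpr.eval, e6, e1, fiveCells]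
        split_ifs <;> omega
      · simp [NatExpr.eval, e2, pow_succ]
        omega
      · simp [e3])
    (by
      rintro s ⟨e1, e2, e3⟩
      have e5 : s.nat 2 0 = I.n := e1 1 0
      simp only [Test.Holds, NatExpr.eval, e2, e5, not_not]
      exact I.n_le)
    (Nat.zero_le _) ⟨h, h2, hr⟩
  simp only [Test.cost, NatExpr.cost] at ht
  exact ⟨t, s', r, by omega, h4, h6⟩

theorem realizable_parameters : spec.Realizable 5 := by
  refine ⟨.seq loadProg (.seq powProg (.seq (.setNat 5 (.const 0) (.const 1)) (.seq precisionProg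
    (.seq (.setNat 0 (.const 4) (.const 1)) logProg)))), 11, fun I => ?_⟩
  obtain ⟨t₁, s₁, r₁, ht₁, a₁, b₁, c₁, d₁⟩ := loadProg_spec I
  obtain ⟨t₂, s₂, r₂, ht₂, a₂, b₂, c₂⟩ := powProg_spec I a₁ b₁ c₁ d₁
  obtain ⟨t₃, s₃, r₃, ht₃, a₃, c₃⟩ := precisionProg_spec I (s := s₂.setNat 5 0 1) (by
    intro b k
    simp only [Mem.setNat_nat, a₂, fiveCells]
    split_ifs <;> omega) (by simp [b₂]) (by simp [c₂])
  obtain ⟨t₄, s₄, r₄, ht₄, a₄, c₄⟩ := logProg_spec I (s := s₃.setNat 0 4 1) (by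
    intro b k
    simp [a₃]) (by simp) (by simp [c₃])
  have hcodes : codes I.m I.g I.σ = 2 ^ I.bits := rfl
  have hbits := Nat.lt_two_pow_self (n := I.bits)
  have hm := I.m_le_bits
  have hσ := I.σ_le_bits
  have hm2 := I.two_le_m
  have hh : I.h ≤ I.σ := by
    rw [Inp.σ]
    have := Nat.le_mul_of_pos_left I.h (by omega : 0 < I.m)
    omega
  have hg := I.le_σ
  have hn : I.n ≤ 2 ^ I.bits := I.n_le.trans (Nat.pow_le_pow_right two_pos (by omega))
  have hG : 2 ^ I.g ≤ 2 ^ I.bits := Nat.pow_le_pow_right two_pos (by omega)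
  have hpow : 1024 * codes I.m I.g I.σ ≤ codes I.m I.g I.σ ^ 11 := by
    rw [pow_succ _ 10]
    exact Nat.mul_le_mul_right _ ((by norm_num : 1024 = 2 ^ 10).le.trans
      (Nat.pow_le_pow_left (spec.two_le_size I) 10))
  have h2 : 2 ≤ codes I.m I.g I.σ := spec.two_le_size I
  refine ⟨_, s₄, .seq r₁ (.seq r₂ (.seq (.setNat _ _ _ _) (.seq r₃ (.seq (.setNat _ _ _ _) r₄)))),
    ?_, fun b k => ?_, fun b hb k hk => ?_, c₄⟩
  · change _ ≤ codes I.m I.g I.σ ^ 11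
    simp only [NatExpr.cost]
    omega
  · change _ ≤ codes I.m I.g I.σ ^ 11
    rw [a₄, fiveCells]
    split_ifs <;> omega
  · rw [a₄]
    interval_cases b
    all_goals
      obtain rfl : k = 0 := Nat.lt_one_iff.1 hk
      rfl

/-! ### The real tables -/

noncomputable def residuals (I : Inp) (k : ℕ) : ℝ :=
  residual I.n (window I.g I.σ) (number I.m I.n I.g I.σ I.P) (size I.g I.σ)
    (cell I.m I.n I.g I.σ I.P) (total I.g I.σ) I.P (k / I.n) (k % I.n)

noncomputable def rest (I : Inp) : ℝ :=
  leftover (window I.g I.σ) (number I.m I.n I.g I.σ I.P) (size I.g I.σ) (total I.g I.σ)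

/-- Partial products, tabulated so that each cell needs one multiplication with the preceding cell.
-/
noncomputable def products (I : Inp) (k : ℕ) : ℝ :=
  rest I * ∏ i ∈ range (k % (I.m + 1)),
    (residuals I (i * I.n + k / (I.m + 1) / I.n ^ i % I.n) / rest I)

theorem result_eq (I : Inp) (y : ℕ) : result I.m I.n I.g I.σ I.P y =
    jointCount I.m I.n (window I.g I.σ) (number I.m I.n I.g I.σ I.P) (size I.g I.σ)
      (cell I.m I.n I.g I.σ I.P) y / total I.g I.σ + products I (y * (I.m + 1) + I.m) := by
  rw [result, table, products, layer_div (Nat.lt_succ_self _), layer_mod (Nat.lt_succ_self _)]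
  congr 2
  refine prod_congr rfl fun i _ => ?_
  rw [residuals, layer_div (Nat.mod_lt _ I.n_pos), layer_mod (Nat.mod_lt _ I.n_pos), rest]

def restExpr : RealExpr :=
  .sub (.ofNat (.const 1)) (.div (.ofNat (.load 14 (.const 0))) (.ofNat (.load 15 (.const 0))))

def residualExpr : RealExpr :=
  .sub (.load 1 (NTerm.reg 0)) (.div (.ofNat (.load 13 (NTerm.reg 0))) (.ofNat (.load 15 (.const 0))))

/-- Expressions have no conditional. Array 16 holds 1 where a new product starts and 0 elsewhere,
and blends the two cases; the cell read for an empty product is multiplied by zero. -/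
def productExpr : RealExpr :=
  .add (.mul (.ofNat (.load 16 (NTerm.reg 0))) restExpr)
    (.mul (.sub (.ofNat (.const 1)) (.ofNat (.load 16 (NTerm.reg 0))))
      (.mul (.load 4 (.sub (NTerm.reg 0) (.const 1)))
        (.div (.load 3 (.load 17 (NTerm.reg 0))) restExpr)))

def resultExpr : RealExpr :=
  .add (.div (.ofNat (.load 12 (NTerm.reg 0))) (.ofNat (.load 15 (.const 0))))
    (.load 4 (.load 18 (NTerm.reg 0)))

section

variable {I : Inp} {s : Mem} {k : ℕ}

theorem eval_restExpr
    (h : ∀ b < 21, ∀ k < spec.bnd b I, s.nat (b + 1) k = spec.val b I k) :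
    restExpr.eval s = rest I := by
  have h1 : s.nat 14 0 = _ := h 13 (by norm_num) 0 Nat.one_pos
  have h2 : s.nat 15 0 = _ := h 14 (by norm_num) 0 Nat.one_pos
  simp only [restExpr, RealExpr.eval, NatExpr.eval, h1, h2]
  simp [spec, rest, leftover]

theorem eval_residualExpr
    (h : ∀ b < 21, ∀ k < spec.bnd b I, s.nat (b + 1) k = spec.val b I k)
    (hP : s.real 1 = I.P) (hk : k < I.m * I.n) (h0 : s.nat 0 0 = k) :
    residualExpr.eval s = residuals I k := by
  have h1 : s.nat 13 k = _ := h 12 (by norm_num) k hk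
  have h2 : s.nat 15 0 = _ := h 14 (by norm_num) 0 Nat.one_pos
  simp only [residualExpr, NTerm.reg, RealExpr.eval, NatExpr.eval, h0, h1, h2, hP]
  simp only [spec, residuals, residual, Nat.div_add_mod']

theorem eval_productExpr
    (h : ∀ b < 21, ∀ k < spec.bnd b I, s.nat (b + 1) k = spec.val b I k)
    (hr : ∀ k < I.m * I.n, s.real 3 k = residuals I k) (hk : k < I.n ^ I.m * (I.m + 1))
    (hp : ∀ j < k, s.real 4 j = products I j) (h0 : s.nat 0 0 = k) :
    productExpr.eval s = products I k := by
  have h1 : s.nat 16 k = _ := h 15 (by norm_num) k hk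
  have h2 : s.nat 17 k = _ := h 16 (by norm_num) k hk
  simp only [productExpr, NTerm.reg, RealExpr.eval, eval_restExpr h, NatExpr.eval, h0, h1, h2]
  simp only [spec]
  have hm : 0 < I.m + 1 := Nat.succ_pos _
  have hlt := Nat.mod_lt k hm
  rcases Nat.eq_zero_or_pos (k % (I.m + 1)) with h3 | h3
  · simp [h3, products]
  · obtain ⟨i, hi⟩ := Nat.exists_eq_succ_of_ne_zero h3.ne'
    obtain ⟨j, rfl⟩ : ∃ j, k = j + 1 :=
      Nat.exists_eq_succ_of_ne_zero (by rintro rfl; simp at h3)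
    have h4 : (j + 1) / (I.m + 1) = j / (I.m + 1) ∧ j % (I.m + 1) = i := by
      have h5 := Nat.div_add_mod' (j + 1) (I.m + 1)
      have h6 : j = (j + 1) / (I.m + 1) * (I.m + 1) + i := by omega
      constructor
      · conv_rhs => rw [h6]
        rw [layer_div (by omega)]
      · rw [h6, layer_mod (by omega)]
    have h7 : i * I.n + j / (I.m + 1) / I.n ^ i % I.n < I.m * I.n :=
      idx_lt (by omega) (Nat.mod_lt _ I.n_pos)
    simp only [hi, Nat.succ_ne_zero, if_false, Nat.succ_sub_one, h4.1]
    rw [hr _ h7, hp j (Nat.lt_succ_self _), products, products, h4.2, hi, prod_range_succ, h4.1]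
    push_cast
    ring

theorem eval_resultExpr
    (h : ∀ b < 21, ∀ k < spec.bnd b I, s.nat (b + 1) k = spec.val b I k)
    (hp : ∀ k < I.n ^ I.m * (I.m + 1), s.real 4 k = products I k) (hk : k < I.n ^ I.m)
    (h0 : s.nat 0 0 = k) : resultExpr.eval s = result I.m I.n I.g I.σ I.P k := by
  have h1 : s.nat 12 k = _ := h 11 (by norm_num) k hk
  have h2 : s.nat 15 0 = _ := h 14 (by norm_num) 0 Nat.one_pos
  have h3 : s.nat 18 k = _ := h 17 (by norm_num) k hk
  simp only [resultExpr, NTerm.reg, RealExpr.eval, NatExpr.eval, h0, h1, h2, h3, result_eq]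
  simp only [spec]
  rw [hp _ (idx_lt hk (Nat.lt_succ_self _))]

end

/-- The integer tables take time polynomial in the number of codes. The real tables add linear time
in their lengths, which are themselves entries of integer arrays and hence polynomially bounded. -/
theorem exists_prog : ∃ (A : Prog) (c : ℕ), ∀ I : Inp, ∃ t s, Runs A I.mem t s ∧
    t ≤ (2 ^ I.bits) ^ c ∧ ∀ y < I.n ^ I.m, s.real 2 y = result I.m I.n I.g I.σ I.P y := by
  obtain ⟨A, c, hA⟩ :=
    realizable_counts (realizable_path (realizable_reach realizable_parameters))
  refine ⟨.seq A (.seq (realFillProg 3 (.load 19 (.const 0)) residualExpr)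
    (.seq (realFillProg 4 (.load 20 (.const 0)) productExpr)
      (realFillProg 2 (.load 21 (.const 0)) resultExpr))), c + 10, fun I => ?_⟩
  obtain ⟨t, s, r, ht, hb, hs⟩ := hA I
  have hP : s.real 1 = I.P := by rw [hs.real]; rfl
  have e1 : s.nat 19 0 = I.m * I.n := hs.nat 18 (by norm_num) 0 Nat.one_pos
  have e2 : s.nat 20 0 = I.n ^ I.m * (I.m + 1) := hs.nat 19 (by norm_num) 0 Nat.one_pos
  have e3 : s.nat 21 0 = I.n ^ I.m := hs.nat 20 (by norm_num) 0 Nat.one_pos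
  have hH : ∀ s' : Mem, (∀ b, s'.nat (b + 1) = s.nat (b + 1)) →
      ∀ b < 21, ∀ k < spec.bnd b I, s'.nat (b + 1) k = spec.val b I k := fun s' h b hb k hk => by
    rw [h]
    exact hs.nat b hb k hk
  obtain ⟨t₁, s₁, r₁, ht₁, n₁, o₁, v₁⟩ := realFillProg_spec 3 18 residualExpr s (residuals I) _ e1
    fun k hk s' h1 h2 _ h4 => eval_residualExpr (hH s' h1) ((h2 1 (by norm_num)).trans hP) hk h4
  obtain ⟨t₂, s₂, r₂, ht₂, n₂, o₂, v₂⟩ := realFillProg_spec 4 19 productExpr s₁ (products I) _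
    ((congrFun (n₁ 19) 0).trans e2) fun k hk s' h1 h2 h3 h4 =>
      eval_productExpr (hH s' fun b => (h1 b).trans (n₁ b))
        (fun k hk => (congrFun (h2 3 (by norm_num)) k).trans (v₁ k hk)) hk h3 h4
  obtain ⟨t₃, s₃, r₃, ht₃, n₃, o₃, v₃⟩ := realFillProg_spec 2 20 resultExpr s₂
    (result I.m I.n I.g I.σ I.P) _
    ((congrFun ((n₂ 20).trans (n₁ 20)) 0).trans e3) fun k hk s' h1 h2 h3 h4 =>
      eval_resultExpr (hH s' fun b => ((h1 b).trans (n₂ b)).trans (n₁ b))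
        (fun k hk => (congrFun (h2 4 (by norm_num)) k).trans (v₂ k hk)) hk h4
  refine ⟨_, s₃, .seq r (.seq r₁ (.seq r₂ r₃)), ?_, v₃⟩
  have b1 := hb 18 0
  have b2 := hb 19 0
  have b3 := hb 20 0
  change _ ≤ (2 ^ I.bits) ^ c at ht b1 b2 b3
  rw [e1] at b1
  rw [e2] at b2
  rw [e3] at b3
  have hpow : 1024 * (2 ^ I.bits) ^ c ≤ (2 ^ I.bits) ^ (c + 10) := by
    rw [pow_add, mul_comm]
    exact Nat.mul_le_mul_left _ ((by norm_num : 1024 = 2 ^ 10).le.trans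
      (Nat.pow_le_pow_left (spec.two_le_size I) 10))
  have hc : 1 ≤ (2 ^ I.bits) ^ c := Nat.one_le_pow _ _ (by positivity)
  simp only [residualExpr, productExpr, resultExpr, restExpr, NTerm.reg, RealExpr.cost,
    NatExpr.cost] at ht₁ ht₂ ht₃
  omega

end MinEntropyCoupling

/-! ### Running time -/

namespace MinEntropyCoupling

open Finset RealRAM Real

namespace Inp

variable (I : Inp)

theorem two_pow_g_le : (2 : ℝ) ^ I.g ≤ 2 ^ (I.m + 6) / I.ε := by
  obtain ⟨k, hk⟩ := Nat.exists_eq_succ_of_ne_zero I.g_pos.ne'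
  have h1 := Nat.find_min I.exists_g (m := k) (by change k < I.g; omega)
  push_cast at h1
  rw [le_div_iff₀ I.ε_pos, hk, pow_succ, pow_succ _ (I.m + 5)]
  linarith

theorem one_le_n : (1 : ℝ) ≤ I.n := by exact_mod_cast I.n_pos

theorem one_le_logb : 1 ≤ logb 2 (1 / I.ε) := by
  rw [le_logb_iff_rpow_le one_lt_two (one_div_pos.2 I.ε_pos), rpow_one, le_div_iff₀ I.ε_pos]
  linarith [I.ε_lt]

theorem logb_div : logb 2 (I.n / I.ε) = logb 2 I.n + logb 2 (1 / I.ε) := by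
  rw [div_eq_mul_one_div,
    logb_mul (by linarith [I.one_le_n]) (one_div_pos.2 I.ε_pos).ne']

/-- From 2 ^ g ≤ 2 ^ (m + 6) / ε, as m + 6 ≤ 4 * m for m ≥ 2 and log (1 / ε) ≥ 1. -/
theorem g_le : (I.g : ℝ) ≤ 5 * (I.m * logb 2 (1 / I.ε)) := by
  have h1 : logb 2 (2 ^ I.g) ≤ logb 2 (2 ^ (I.m + 6) / I.ε) :=
    logb_le_logb_of_le one_lt_two (by positivity) I.two_pow_g_le
  have h2 := one_div_pos.2 I.ε_pos
  rw [div_eq_mul_one_div, logb_mul (by positivity) h2.ne', logb_pow, logb_pow,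
    logb_self_eq_one one_lt_two] at h1
  push_cast at h1
  have h3 := I.one_le_logb
  have h4 : (2 : ℝ) ≤ I.m := by exact_mod_cast I.two_le_m
  nlinarith

theorem h_le : (I.h : ℝ) ≤ logb 2 (I.n / I.ε) := by
  have h1 := I.one_le_logb
  have h2 := I.one_le_n
  have h3 : 0 ≤ logb 2 I.n := logb_nonneg one_lt_two h2
  rw [logb_div]
  rcases Nat.eq_zero_or_pos I.h with h4 | h4
  · rw [h4]
    push_cast
    linarith
  · have h5 : 2 ^ (I.h - 1) ≤ I.n := by
      by_contra hlt
      have := Nat.clog_le_of_le_pow (not_le.1 hlt).le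
      change I.h ≤ _ at this
      omega
    have h6 : (2 : ℝ) ^ (I.h - 1) ≤ I.n := by exact_mod_cast h5
    have h7 := logb_le_logb_of_le one_lt_two (by positivity) h6
    rw [logb_pow, logb_self_eq_one one_lt_two, Nat.cast_sub h4] at h7
    push_cast at h7
    linarith

theorem logb_le_logb_div : logb 2 (1 / I.ε) ≤ logb 2 (I.n / I.ε) := by
  rw [logb_div]
  linarith [logb_nonneg one_lt_two I.one_le_n]

theorem σ_le : (I.σ : ℝ) ≤ 18 * (I.m * logb 2 (I.n / I.ε)) := by
  have h1 := mul_le_mul_of_nonneg_left I.h_le (Nat.cast_nonneg (α := ℝ) I.m)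
  have h2 := mul_le_mul_of_nonneg_left I.logb_le_logb_div (Nat.cast_nonneg (α := ℝ) I.m)
  have h3 := I.g_le
  rw [σ]
  push_cast
  linarith

theorem bits_le_mul : I.bits ≤ 18 * (4 ^ I.g * I.g * I.σ * I.m) := by
  have h1 := I.g_pos
  have h2 := I.le_σ
  have h3 := I.two_le_m
  calc I.bits = 2 * I.σ * (I.m * (4 ^ I.g * I.g)) +
        (2 * I.g + 2) * (4 ^ I.g * (I.g + I.σ)) * (I.m + 2) := by
        rw [bits_eq, horizon, layers, width]
        ring
    _ ≤ 2 * I.σ * (I.m * (4 ^ I.g * I.g)) + (4 * I.g) * (4 ^ I.g * (2 * I.σ)) * (2 * I.m) := by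
        gcongr <;> omega
    _ = _ := by ring

/-- The constant is 18 * 5 * 18 * 2 ^ 12, where 2 ^ 12 comes from the square of 2 ^ (m + 6). -/
theorem bits_le : (I.bits : ℝ) ≤ 6635520 *
    ((I.m : ℝ) ^ 4 * 2 ^ (6 * I.m) * logb 2 (1 / I.ε) ^ 3 / I.ε ^ 2) * logb 2 (I.n / I.ε) := by
  have hL := I.one_le_logb
  have hN := hL.trans I.logb_le_logb_div
  have hε := I.ε_pos
  have h1 : (I.bits : ℝ) ≤ 18 * (4 ^ I.g * I.g * I.σ * I.m) := by exact_mod_cast I.bits_le_mul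
  have h2 : (4 : ℝ) ^ I.g ≤ (2 ^ (I.m + 6) / I.ε) ^ 2 := by
    calc (4 : ℝ) ^ I.g = (2 ^ I.g) ^ 2 := by rw [← pow_mul, mul_comm, pow_mul]; norm_num
      _ ≤ _ := pow_le_pow_left₀ (by positivity) I.two_pow_g_le 2
  have hm : (1 : ℝ) ≤ I.m := by exact_mod_cast (by have := I.two_le_m; omega : 1 ≤ I.m)
  have h3 : (2 : ℝ) ^ (2 * I.m) ≤ 2 ^ (6 * I.m) := pow_le_pow_right₀ one_le_two (by omega)
  have h4 : (I.m : ℝ) ^ 3 ≤ I.m ^ 4 := pow_le_pow_right₀ hm (by norm_num)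
  have h5 := le_self_pow₀ hL (three_ne_zero)
  calc (I.bits : ℝ) ≤ 18 * (4 ^ I.g * I.g * I.σ * I.m) := h1
    _ ≤ 18 * ((2 ^ (I.m + 6) / I.ε) ^ 2 * (5 * (I.m * logb 2 (1 / I.ε))) *
        (18 * (I.m * logb 2 (I.n / I.ε))) * I.m) := by
        gcongr
        · exact I.g_le
        · exact I.σ_le
    _ = 6635520 * ((I.m : ℝ) ^ 3 * 2 ^ (2 * I.m) * logb 2 (1 / I.ε) / I.ε ^ 2) *
        logb 2 (I.n / I.ε) := by
        rw [div_pow, pow_add, mul_pow, ← pow_mul, mul_comm I.m 2]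
        ring
    -- The preceding bound, with m ^ 3, 2 ^ (2 * m) and a single logarithm, is weakened to the
    -- required form.
    _ ≤ _ := by gcongr

/-- With base n / ε, the exponent is divided by log (n / ε), the last factor in the bound on the
bits. -/
theorem time_le (c : ℕ) : (((2 ^ I.bits) ^ c : ℕ) : ℝ) ≤ ((I.n : ℝ) / I.ε) ^ (6635520 * c *
    ((I.m : ℝ) ^ 4 * 2 ^ (6 * I.m) * logb 2 (1 / I.ε) ^ 3 / I.ε ^ 2)) := by
  have h1 : 0 < (I.n : ℝ) / I.ε := div_pos (by linarith [I.one_le_n]) I.ε_pos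
  conv_rhs => rw [← rpow_logb two_pos (by norm_num) h1]
  rw [← rpow_mul two_pos.le]
  push_cast
  rw [← pow_mul, ← rpow_natCast]
  refine rpow_le_rpow_of_exponent_le one_le_two ?_
  push_cast
  have h2 := mul_le_mul_of_nonneg_right I.bits_le (Nat.cast_nonneg (α := ℝ) c)
  linarith

end Inp

theorem index_lt {m n : ℕ} (x : Fin m → Fin n) :
    ∑ i : Fin m, (x i : ℕ) * n ^ (i : ℕ) < n ^ m := by
  rw [← finFunctionFinEquiv_apply]
  exact (finFunctionFinEquiv x).2

end MinEntropyCoupling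

theorem theorem1 :
    ∃ (A : RealRAM.Prog) (C : ℝ), ∀ (m n : ℕ) (ε : ℝ) (p : Fin m → Fin n → ℝ),
      2 ≤ m → 0 < ε → ε < 1 / 2 → (∀ i, MinEntropyCoupling.IsDistribution (p i)) →
      ∃ (t : ℕ) (s : RealRAM.Mem),
        RealRAM.Runs A (MinEntropyCoupling.input m n ε p) t s ∧
        (t : ℝ) ≤ ((n : ℝ) / ε) ^
          (C * ((m : ℝ) ^ 4 * 2 ^ (6 * m) * Real.logb 2 (1 / ε) ^ 3 / ε ^ 2)) ∧
        MinEntropyCoupling.IsCoupling p (MinEntropyCoupling.output m n s) ∧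
        ∃ OPT : (Fin m → Fin n) → ℝ, MinEntropyCoupling.IsMinEntropyCoupling p OPT ∧
          MinEntropyCoupling.entropy (MinEntropyCoupling.output m n s) ≤ MinEntropyCoupling.entropy OPT + ε := by
  obtain ⟨A, c, hA⟩ := MinEntropyCoupling.exists_prog
  refine ⟨A, 6635520 * c, fun m n ε p hm hε hε' hp => ?_⟩
  set I : MinEntropyCoupling.Inp := ⟨m, n, ε, p, hm, hε, hε', hp⟩ with hI
  obtain ⟨t, s, r, ht, hs⟩ := hA I
  have hout : MinEntropyCoupling.output m n s = fun x =>
      MinEntropyCoupling.result I.m I.n I.g I.σ I.P (∑ i : Fin m, (x i : ℕ) * n ^ (i : ℕ)) :=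
    funext fun x => hs _ (MinEntropyCoupling.index_lt x)
  have hm0 : 0 < I.m := lt_of_lt_of_le two_pos hm
  obtain ⟨OPT, hOPT⟩ := MinEntropyCoupling.exists_isMinEntropyCoupling hp
  refine ⟨t, s, r, le_trans (by exact_mod_cast ht) (I.time_le c), ?_, OPT, hOPT, ?_⟩
  · rw [hout]
    exact MinEntropyCoupling.isCoupling_result I.g_pos I.le_σ hm0 I.n_pos hp I.P_apply
  · rw [hout]
    refine (MinEntropyCoupling.entropy_result_le I.g_pos rfl I.n_le hm0 I.n_pos hp I.P_apply
      hOPT.1).trans ?_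
    gcongr
    rw [div_le_iff₀ (by positivity)]
    refine le_trans ?_ I.g_spec
    -- This is where the 5 in the choice of g comes from.
    have h1 : m + 24 ≤ 2 ^ (m + 5) := by
      have := Nat.lt_two_pow_self (n := m)
      rw [pow_add]
      omega
    exact_mod_cast h1
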